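/- Let $p\ge 1$ and let $M$ be a compact smooth Riemannian manifold without boundary, of dimension $n$. A framing of a compact smooth submanifold $N\subset M$ of codimension $p$ is a $p$-tuple $\nu=(\nu^1,\dots,\nu^p)$ of smooth sections along $N$ that form, at each $x\in N$, a basis of the orthogonal complement of $T_xN$ in $T_xM$. Two compact framed submanifolds $(N,\nu)$, $(N',\nu')$ of codimension $p$ without boundary are framed cobordant if there are $\varepsilon>0$ and a compact submanifold with boundary $X\subset M\times[0,1]$ of codimension $p$ which contains $N\times[0,\varepsilon)\cup N'\times(1-\varepsilon,1]$, has boundary $\partial X=N\times\{0\}\cup N'\times\{1\}$ and meets $M\times\{0,1\}$ only in $\partial X$, and a framing $u$ of $X$ (for the product metric) with $u^i(x,t)=(\nu^i(x),0)$ on $N\times[0,\varepsilon)$ and $u^i(x,t)=(\nu'^i(x),0)$ on $N'\times(1-\varepsilon,1]$. Two smooth maps $f_0,f_1:M\to S^p$ are smoothly homotopic if there is a smooth map $F:M\times[0,1]\to S^p$ with $F(\cdot,0)=f_0$ and $F(\cdot,1)=f_1$. Framed cobordism and smooth homotopy are equivalence relations; let $\Pi^p_{fr}(M)$ be the set of compact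 framed submanifolds of $M$ of codimension $p$ without boundary up to framed cobordism, and $[M,S^p]$ the set of smooth maps $M\to S^p$ up to smooth homotopy. Every smooth $f:M\to S^p$ has a regular value. If $y$ is a regular value of $f$ and $w=(w^1,\dots,w^p)$ a positively oriented basis of $T_yS^p$, then $f^{-1}(y)$ is a compact submanifold of codimension $p$, and it has exactly one framing $f^*w=\nu$ such that $df_x(\nu^i(x))=w^i$ for all $x\in f^{-1}(y)$ and all $i$. The framed submanifold $(f^{-1}(y),f^*w)$ is called a Pontryagin manifold of $f$. Then: (A) Any two Pontryagin manifolds of $f$, for regular values $y,y'$ and positively oriented bases $w,w'$ of $T_yS^p$, $T_{y'}S^p$, are framed cobordant. (B) Every compact framed submanifold of $M$ of codimension $p$ without boundary is a Pontryagin manifold of some smooth map $f:M\to S^p$. (C) Two smooth maps $f_0,f_1:M\to S^p$ are smoothly homotopic if and only if a Pontryagin manifold of $f_0$ and a Pontryagin manifold of $f_1$ (for any choice of regular values and positively oriented bases) are framed cobordant. Consequently there is exactly one bijection $\Pi^p_{fr}(M)\cong[M,S^p]$ that sends the class of every Pontryagin manifold of $f$ to the class of $f$, for every smooth $f:M\to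 S^p$. -/

import Mathlib

open Set Filter Topology Manifold Bundle
open scoped ContDiff

noncomputable section

namespace Pontryagin

/-! ### Submanifolds of a manifold, possibly with boundary, and their framings -/

section Ambient

variable {E : Type*} [NormedAddCommGroup E] [NormedSpace ℝ E]
  {H : Type*} [TopologicalSpace H] (I : ModelWithCorners ℝ E H)
  {W : Type*} [TopologicalSpace W] [ChartedSpace H W]

/-- Near `x ∈ X`, the set `X` is the zero set of a smooth submersion to `ℝ^p`:
`x` is an interior point of a smooth submanifold of codimension `p`. -/
def IsInteriorPt (p : ℕ) (X : Set W) (x : W) : Prop :=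
  x ∈ X ∧ ∃ U : Set W, IsOpen U ∧ x ∈ U ∧ ∃ h : W → EuclideanSpace ℝ (Fin p),
    ContMDiffOn I (𝓡 p) ∞ h U ∧
    Function.Surjective (mfderiv I (𝓡 p) h x) ∧
    X ∩ U = {z ∈ U | h z = 0}

/-- Near `x ∈ X`, the set `X` is a half `{h = 0, ρ ≥ 0}` of the zero set of a smooth map `h` to
`ℝ^p`, where `ρ x = 0` and `(h, ρ)` is a submersion at `x`: `x` is a boundary point of a smooth
submanifold with boundary of codimension `p`. -/
def IsBoundaryPt (p : ℕ) (X : Set W) (x : W) : Prop :=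
  x ∈ X ∧ ∃ U : Set W, IsOpen U ∧ x ∈ U ∧ ∃ (h : W → EuclideanSpace ℝ (Fin p)) (ρ : W → ℝ),
    ContMDiffOn I (𝓡 p) ∞ h U ∧ ContMDiffOn I 𝓘(ℝ, ℝ) ∞ ρ U ∧ ρ x = 0 ∧
    Function.Surjective (fun v : TangentSpace I x =>
      (mfderiv I (𝓡 p) h x v, mfderiv I 𝓘(ℝ, ℝ) ρ x v)) ∧
    X ∩ U = {z ∈ U | h z = 0 ∧ 0 ≤ ρ z}

/-- `X` is a smooth (embedded) submanifold of codimension `p`, without boundary. -/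
def IsSubmanifold (p : ℕ) (X : Set W) : Prop :=
  ∀ x ∈ X, IsInteriorPt I p X x

/-- `X` is a smooth (embedded) submanifold with boundary of codimension `p`. -/
def IsSubmanifoldWithBoundary (p : ℕ) (X : Set W) : Prop :=
  ∀ x ∈ X, IsInteriorPt I p X x ∨ IsBoundaryPt I p X x

/-- The boundary `∂X` of a submanifold with boundary. -/
def submanifoldBoundary (p : ℕ) (X : Set W) : Set W :=
  {x | IsBoundaryPt I p X x}

/-- The tangent space `T_x X ⊆ T_x W` of a submanifold `X` (possibly with boundary) at `x ∈ X`: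
the vectors annihilated by the differentials of all smooth functions vanishing on `X` near `x`.
If `X = {h = 0}` or `X = {h = 0, ρ ≥ 0}` near `x` as above, this is `ker dh_x`. -/
def tangentSpaceOf (X : Set W) (x : W) : Submodule ℝ (TangentSpace I x) where
  carrier := {v | ∀ φ : W → ℝ, ContMDiffAt I 𝓘(ℝ, ℝ) ∞ φ x → (∀ᶠ z in 𝓝[X] x, φ z = 0) →
    mfderiv I 𝓘(ℝ, ℝ) φ x v = 0}
  add_mem' := by
    intro v w hv hw φ h1 h2
    rw [map_add, hv φ h1 h2, hw φ h1 h2, add_zero]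
  zero_mem' := by
    intro φ _ _
    exact map_zero _
  smul_mem' := by
    intro c v hv φ h1 h2
    rw [map_smul, hv φ h1 h2, smul_zero]

variable {I} in
/-- The orthogonal complement of `T_x X` in `T_x W`, for a family `ip` of inner products on the
tangent spaces of `W`. -/
def normalSpace (ip : ∀ x : W, TangentSpace I x →L[ℝ] TangentSpace I x →L[ℝ] ℝ)
    (X : Set W) (x : W) : Submodule ℝ (TangentSpace I x) where
  carrier := {w | ∀ v ∈ tangentSpaceOf I X x, ip x v w = 0}
  add_mem' := by
    intro v w hv hw u hu
    rw [map_add, hv u hu, hw u hu, add_zero]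
  zero_mem' := by
    intro u _
    exact map_zero _
  smul_mem' := by
    intro c v hv u hu
    rw [map_smul, hv u hu, smul_zero]

variable {I} in
/-- `ν` is a framing of the submanifold `X` of codimension `p`: `ν¹, …, ν^p` are smooth along `X`,
and at each `x ∈ X` they form a basis of the orthogonal complement of `T_x X`. Only the values of
`ν` on `X` matter. -/
structure IsFraming [IsManifold I 1 W]
    (ip : ∀ x : W, TangentSpace I x →L[ℝ] TangentSpace I x →L[ℝ] ℝ)
    {p : ℕ} (X : Set W) (ν : Fin p → ∀ x : W, TangentSpace I x) : Prop where
  smooth : ∀ i, ContMDiffOn I I.tangent ∞ (fun x => (⟨x, ν i x⟩ : TangentBundle I W)) X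
  linearIndependent : ∀ x ∈ X, LinearIndependent ℝ (fun i => ν i x)
  span_eq : ∀ x ∈ X, Submodule.span ℝ (Set.range fun i => ν i x) = normalSpace ip X x

end Ambient

/-! ### Framed submanifolds of a closed Riemannian manifold and framed cobordism -/

section Closed

variable {n : ℕ} {M : Type*} [TopologicalSpace M] [ChartedSpace (EuclideanSpace ℝ (Fin n)) M]
  [IsManifold (𝓡 n) ∞ M]

/-- The product metric on `M × ℝ`: `⟨(v, s), (w, t)⟩ = ⟨v, w⟩ + s t`. -/
def prodMetric (g : ContMDiffRiemannianMetric (𝓡 n) ∞ (EuclideanSpace ℝ (Fin n))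
      (fun x : M => TangentSpace (𝓡 n) x)) (z : M × ℝ) :
    TangentSpace ((𝓡 n).prod 𝓘(ℝ, ℝ)) z →L[ℝ] TangentSpace ((𝓡 n).prod 𝓘(ℝ, ℝ)) z →L[ℝ] ℝ :=
  let a : TangentSpace ((𝓡 n).prod 𝓘(ℝ, ℝ)) z →L[ℝ] TangentSpace (𝓡 n) z.1 :=
    ContinuousLinearMap.fst ℝ (EuclideanSpace ℝ (Fin n)) ℝ
  let b : TangentSpace ((𝓡 n).prod 𝓘(ℝ, ℝ)) z →L[ℝ] ℝ :=
    ContinuousLinearMap.snd ℝ (EuclideanSpace ℝ (Fin n)) ℝ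
  (ContinuousLinearMap.precomp ℝ a).comp ((g.inner z.1).comp a) + b.smulRight b

/-- The tangent vector `(v, 0)` of `M × ℝ` at `(x, t)`. -/
def horizontal {x : M} (v : TangentSpace (𝓡 n) x) (t : ℝ) :
    TangentSpace ((𝓡 n).prod 𝓘(ℝ, ℝ)) (x, t) :=
  ((v, 0) : EuclideanSpace ℝ (Fin n) × ℝ)

/-- A compact framed submanifold (without boundary) of codimension `p` of `(M, g)`. -/
structure FramedSubmanifold (g : ContMDiffRiemannianMetric (𝓡 n) ∞ (EuclideanSpace ℝ (Fin n))
    (fun x : M => TangentSpace (𝓡 n) x)) (p : ℕ) where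
  carrier : Set M
  isCompact : IsCompact carrier
  isSubmanifold : IsSubmanifold (𝓡 n) p carrier
  frame : Fin p → ∀ x : M, TangentSpace (𝓡 n) x
  isFraming : IsFraming g.inner carrier frame

variable {g : ContMDiffRiemannianMetric (𝓡 n) ∞ (EuclideanSpace ℝ (Fin n))
    (fun x : M => TangentSpace (𝓡 n) x)} {p : ℕ}

/-- Two compact framed submanifolds `N`, `N'` of `M` are framed cobordant: there are a compact
submanifold with boundary `X ⊆ M × [0,1]` of codimension `p`, which extends
`N × [0,ε) ∪ N' × (1-ε,1]`, has boundary `∂X = N × {0} ∪ N' × {1}` and meets `M × {0,1}` only in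
`∂X`, and a framing `u` of `X` which restricts to the given framings on
`N × [0,ε)` and `N' × (1-ε,1]`. (Here `M × [0,1]` is regarded as a subset of `M × ℝ`.) -/
def FramedCobordant (N N' : FramedSubmanifold g p) : Prop :=
  ∃ (X : Set (M × ℝ)) (u : Fin p → ∀ z : M × ℝ, TangentSpace ((𝓡 n).prod 𝓘(ℝ, ℝ)) z) (ε : ℝ),
    0 < ε ∧
    X ⊆ univ ×ˢ Icc (0 : ℝ) 1 ∧
    IsCompact X ∧
    IsSubmanifoldWithBoundary ((𝓡 n).prod 𝓘(ℝ, ℝ)) p X ∧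
    submanifoldBoundary ((𝓡 n).prod 𝓘(ℝ, ℝ)) p X =
      N.carrier ×ˢ {(0 : ℝ)} ∪ N'.carrier ×ˢ {(1 : ℝ)} ∧
    X ∩ univ ×ˢ {(0 : ℝ), 1} ⊆ submanifoldBoundary ((𝓡 n).prod 𝓘(ℝ, ℝ)) p X ∧
    N.carrier ×ˢ Ico (0 : ℝ) ε ∪ N'.carrier ×ˢ Ioc (1 - ε) 1 ⊆ X ∧
    IsFraming (prodMetric g) X u ∧
    (∀ i, ∀ x ∈ N.carrier, ∀ t ∈ Ico (0 : ℝ) ε, u i (x, t) = horizontal (N.frame i x) t) ∧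
    (∀ i, ∀ x ∈ N'.carrier, ∀ t ∈ Ioc (1 - ε) 1, u i (x, t) = horizontal (N'.frame i x) t)

variable (g p) in
/-- `Π^p_fr(M)`: compact framed submanifolds of codimension `p` up to framed cobordism. -/
def FramedCobordismClasses : Type _ := Quot (FramedCobordant (g := g) (p := p))

/-! ### Maps to spheres and their Pontryagin manifolds -/

/-- The unit sphere `S^p` in `ℝ^(p+1)`. -/
abbrev Sph (p : ℕ) : Type := Metric.sphere (0 : EuclideanSpace ℝ (Fin (p + 1))) 1

/-- Smooth homotopy of smooth maps `M → S^p`: a smooth map `M × [0,1] → S^p` from `f₀` to `f₁`. -/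
def SmoothHomotopic (f₀ f₁ : C^∞⟮𝓡 n, M; 𝓡 p, Sph p⟯) : Prop :=
  ∃ F : M × ℝ → Sph p,
    ContMDiffOn ((𝓡 n).prod 𝓘(ℝ, ℝ)) (𝓡 p) ∞ F (univ ×ˢ Icc (0 : ℝ) 1) ∧
    (∀ x, F (x, 0) = f₀ x) ∧ ∀ x, F (x, 1) = f₁ x

variable (n M p) in
/-- `[M, S^p]`: smooth maps `M → S^p` up to smooth homotopy. -/
def HomotopyClasses : Type _ := Quot (SmoothHomotopic (n := n) (M := M) (p := p))

/-- `y` is a regular value of `f`. -/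
def IsRegularValue (f : C^∞⟮𝓡 n, M; 𝓡 p, Sph p⟯) (y : Sph p) : Prop :=
  ∀ x, f x = y → Function.Surjective (mfderiv (𝓡 n) (𝓡 p) f x)

/-- `w` is a positively oriented basis of `T_y S^p`, for the standard orientation of `S^p` as the
boundary of the unit ball: `det (y, w¹, …, w^p) > 0`, where tangent vectors of `S^p` are viewed in
`ℝ^(p+1)` through the differential of the inclusion. -/
def IsPositiveBasis (y : Sph p) (w : Fin p → TangentSpace (𝓡 p) y) : Prop :=
  let v : Fin (p + 1) → EuclideanSpace ℝ (Fin (p + 1)) :=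
    Fin.cons (y : EuclideanSpace ℝ (Fin (p + 1))) (fun i =>
      mfderiv (𝓡 p) 𝓘(ℝ, EuclideanSpace ℝ (Fin (p + 1)))
        (Subtype.val : Sph p → EuclideanSpace ℝ (Fin (p + 1))) y (w i))
  0 < (Matrix.of fun i j => v i j).det

/-- `N` is the Pontryagin manifold `(f⁻¹(y), f^* w)` of `f` at the regular value `y` and the
positively oriented basis `w` of `T_y S^p`: its underlying set is `f⁻¹(y)`, and its `i`-th normal
vector at `x` is mapped to `wⁱ` by `df_x`. -/
structure IsPontryaginManifold (f : C^∞⟮𝓡 n, M; 𝓡 p, Sph p⟯) (y : Sph p)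
    (w : Fin p → TangentSpace (𝓡 p) y) (N : FramedSubmanifold g p) : Prop where
  isRegularValue : IsRegularValue f y
  isPositiveBasis : IsPositiveBasis y w
  carrier_eq : N.carrier = {x | f x = y}
  mfderiv_frame : ∀ (x : M) (hx : f x = y) (i : Fin p),
    mfderiv (𝓡 n) (𝓡 p) f x (N.frame i x) = hx.symm ▸ w i

end Closed

end Pontryagin

end

/-!
Everything is reduced to one kind of fibre. Write points of `S^p ⊆ ℝ × ℝ^p` as head and tail, and
let the north pole be `(1, 0)`. A framed submanifold `N` is a *standard fibre* of `f : M → S^p`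
(`IsStandardFibre`) if `N = f⁻¹(north pole)` and the differential of the tail of `f` sends the frame
of `N` to the standard basis of `ℝ^p`. A matrix of positive determinant, followed by
normalization, acts on maps to the sphere without changing their homotopy class, because such a
matrix is a product of transvections and of matrices joined to the identity by segments and quarter
turns (`PreservesHomotopyClass.of_det_pos`). A matrix that sends `y, w` to the standard basis turns
every Pontryagin manifold of `f` at `(y, w)` into a standard fibre of a map homotopic to `f`
(`IsPontryaginManifold.exists_isStandardFibre`). The following facts about standard fibres then
suffice.

* *Every framed submanifold is a standard fibre* (`exists_collapse`). Local equations of `N` are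
  normalized so that their differentials send the frame to the standard basis, and glued by a
  partition of unity (`exists_global_framedEquation`). The result is a map `k` to `ℝ^p`
  whose zeros near `N` are the points of `N`. With a function `b` that is `1` on `N` and `-1` away from `N`, the collapse
  map is the normalization of `(b, k)`. The construction is made on any manifold without boundary,
  so that it also applies to `M × ℝ`.
* *Maps with the same standard fibre are homotopic* (`IsStandardFibre.smoothHomotopic`). The tails
  of the two maps have the same differential along `N`, so the segments between them are nonzero
  off `N` in a neighbourhood of `N`. Once the heads are replaced by a function that is
  negative away from `N`, the segment between the tails gives the homotopy.
* *Homotopic maps have cobordant standard fibres* (`SmoothHomotopic.framedCobordant`). The pole need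
  not be a regular value of the homotopy, but by Sard's theorem some value near it is. The preimage
  of a point that stays at the pole near the ends of the time interval and at such a regular value
  in between is the cobordism.
* *Maps with cobordant standard fibres are homotopic* (`FramedCobordant.smoothHomotopic`). The
  cobordism is extended by cylinders to a framed submanifold of `M × ℝ` without boundary
  (`FramedCobordant.exists_extension`). Its collapse map is a homotopy between maps whose standard
  fibres are the two ends.

Framed cobordism is an equivalence relation because homotopy is: by the last two facts it is the
pullback of homotopy along `N ↦ collapse map of N`, so that cobordisms are never glued.

Two general tools are proved on the way. Sard's theorem is proved in the sense of Baire category,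
which is what the existence of many regular values needs: the critical values form a meagre set.
The induction on the dimension is the usual one (`sardInDimension`), but compact sets without
interior take the place of null sets, and flat points are handled by Hausdorff dimension, so that
Fubini's theorem is not needed. Framings orthogonal to a submanifold are found, and seen
to be smooth, by solving the linear system of Lagrange multipliers
(`IsSmoothMetric.exists_isFraming`).
-/

namespace Pontryagin

/-! ### Straightening a submersion between vector spaces -/

section Straightening

variable {E F : Type*} [NormedAddCommGroup E] [NormedSpace ℝ E] [FiniteDimensional ℝ E]
  [NormedAddCommGroup F] [NormedSpace ℝ F] [FiniteDimensional ℝ F]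

omit [FiniteDimensional ℝ E] in
theorem isOpen_setOf_surjective_continuousLinearMap :
    IsOpen {A : E →L[ℝ] F | Function.Surjective A} := by
  have := FiniteDimensional.complete ℝ F
  rw [isOpen_iff_mem_nhds]
  intro A hA
  obtain ⟨B, hB⟩ := A.exists_rightInverse_of_surjective (LinearMap.range_eq_top.2 hA)
  have hc : Continuous fun A' : E →L[ℝ] F => A'.comp B := by fun_prop
  have h1 : IsOpen {A' : E →L[ℝ] F | IsUnit (A'.comp B)} := Units.isOpen.preimage hc
  filter_upwards [h1.mem_nhds (show IsUnit (A.comp B) by rw [hB]; exact isUnit_one)] with A' hA'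
  obtain ⟨v, hv⟩ := hA'
  intro y
  refine ⟨B ((↑v⁻¹ : F →L[ℝ] F) y), ?_⟩
  have h2 : (A'.comp B) * (↑v⁻¹ : F →L[ℝ] F) = 1 := by rw [← hv]; exact v.mul_inv
  exact congrArg (fun L : F →L[ℝ] F => L y) h2

/-- **Straightening**: near a point where `dh` is onto, `h` is the first component of a smooth
coordinate system with values in `F × ker dh`. -/
theorem exists_straightening_vectorSpace {U : Set E} (hU : IsOpen U) {h : E → F}
    (hh : ContDiffOn ℝ ∞ h U) {x : E} (hx : x ∈ U)
    (hs : Function.Surjective (fderiv ℝ h x)) :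
    ∃ (K : Submodule ℝ E) (Ψ : OpenPartialHomeomorph E (F × K)),
      Module.finrank ℝ K + Module.finrank ℝ F = Module.finrank ℝ E ∧
      x ∈ Ψ.source ∧ Ψ.source ⊆ U ∧ (∀ z ∈ Ψ.source, (Ψ z).1 = h z) ∧
      ContDiffOn ℝ ∞ Ψ Ψ.source ∧ ContDiffOn ℝ ∞ Ψ.symm Ψ.target := by
  have := FiniteDimensional.complete ℝ E
  have := FiniteDimensional.complete ℝ F
  set A := fderiv ℝ h x with hA
  set K : Submodule ℝ E := LinearMap.ker (A : E →ₗ[ℝ] F) with hK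
  obtain ⟨P, hP⟩ := Submodule.ClosedComplemented.of_finiteDimensional K
  have hPs : LinearMap.range (P : E →ₗ[ℝ] K) = ⊤ :=
    LinearMap.range_eq_top.2 fun v => ⟨v, hP v⟩
  have hc : IsCompl (LinearMap.ker (A : E →ₗ[ℝ] F)) (LinearMap.ker (P : E →ₗ[ℝ] K)) := by
    exact LinearMap.isCompl_of_proj hP
  let e := A.equivProdOfSurjectiveOfIsCompl P (LinearMap.range_eq_top.2 hs) hPs hc
  let Φ : E → F × K := fun z => (h z, P z)
  have hΦ : ContDiffOn ℝ ∞ Φ U := hh.prodMk P.contDiff.contDiffOn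
  have hΦx : HasFDerivAt Φ (e : E →L[ℝ] F × K) x := by
    have h1 : HasFDerivAt h A x :=
      ((hh.contDiffAt (hU.mem_nhds hx)).differentiableAt (by simp)).hasFDerivAt
    exact h1.prodMk P.hasFDerivAt
  have hx1 : ContDiffAt ℝ ∞ Φ x := hΦ.contDiffAt (hU.mem_nhds hx)
  let Ψ₀ := hx1.toOpenPartialHomeomorph Φ hΦx (by simp)
  have hΨ₀ : ∀ z, Ψ₀ z = Φ z := fun z => rfl
  let V : Set E := U ∩ (fderiv ℝ Φ) ⁻¹' (range ((↑) : (E ≃L[ℝ] F × K) → (E →L[ℝ] F × K)))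
  have hV : IsOpen V :=
    (hΦ.continuousOn_fderiv_of_isOpen hU (by simp)).isOpen_inter_preimage hU
      ContinuousLinearEquiv.isOpen
  refine ⟨K, Ψ₀.restrOpen V hV, ?_, ⟨hx1.mem_toOpenPartialHomeomorph_source hΦx (by simp), hx, e,
    hΦx.fderiv.symm⟩, fun z hz => hz.2.1, fun z hz => rfl, ?_, ?_⟩
  · have := LinearMap.finrank_range_add_finrank_ker (A : E →ₗ[ℝ] F)
    rw [LinearMap.range_eq_top.2 hs, finrank_top, add_comm] at this
    exact this
  · exact hΦ.mono fun z hz => hz.2.1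
  · intro y hy
    have hy' := (Ψ₀.restrOpen V hV).map_target hy
    obtain ⟨e', he'⟩ := hy'.2.2
    refine (OpenPartialHomeomorph.contDiffAt_symm (f₀' := e') _ hy ?_ ?_).contDiffWithinAt
    · rw [he']
      exact ((hΦ.contDiffAt (hU.mem_nhds hy'.2.1)).differentiableAt (by simp)).hasFDerivAt
    · exact hΦ.contDiffAt (hU.mem_nhds hy'.2.1)

end Straightening

/-! ### Sard's theorem, in the sense of Baire category -/

section Sard

universe u v

/-- By Lindelöf, it suffices to show locally on the source that an image is meagre. -/
theorem isMeagre_image_of_locally {X Y : Type*} [TopologicalSpace X] [SecondCountableTopology X]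
    [TopologicalSpace Y] {f : X → Y} {S : Set X}
    (h : ∀ x ∈ S, ∃ V ∈ 𝓝 x, IsMeagre (f '' (S ∩ V))) : IsMeagre (f '' S) := by
  choose! V hV hm using h
  obtain ⟨t, ht, htc, hc⟩ := TopologicalSpace.countable_cover_nhdsWithin (f := V) (s := S)
    fun x hx => mem_nhdsWithin_of_mem_nhds (hV x hx)
  refine (isMeagre_biUnion htc fun x hx => hm x (ht hx)).mono ?_
  rintro _ ⟨x, hx, rfl⟩
  obtain ⟨y, hy, hxy⟩ := mem_iUnion₂.1 (hc hx)
  exact mem_iUnion₂.2 ⟨y, hy, x, ⟨hx, hxy⟩, rfl⟩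

/-- A regular level set of a function is locally the image of a smooth map from a vector space
whose dimension is one less. -/
theorem exists_parametrization_levelSet {E : Type*} [NormedAddCommGroup E] [NormedSpace ℝ E]
    [FiniteDimensional ℝ E] {U : Set E} (hU : IsOpen U) {w : E → ℝ} (hw : ContDiffOn ℝ ∞ w U)
    {x : E} (hx : x ∈ U) (hs : fderiv ℝ w x ≠ 0) :
    ∃ (K : Submodule ℝ E) (V : Set E) (O : Set K) (φ : K → E),
      Module.finrank ℝ K + 1 = Module.finrank ℝ E ∧ V ∈ 𝓝 x ∧ IsOpen O ∧ ContDiffOn ℝ ∞ φ O ∧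
      MapsTo φ O U ∧ (∀ z ∈ V, w z = w x → z ∈ φ '' O) ∧ ∀ q ∈ O, w (φ q) = w x := by
  have hsurj : Function.Surjective (fderiv ℝ w x) :=
    LinearMap.surjective (f := (fderiv ℝ w x : E →ₗ[ℝ] ℝ)) fun h => hs (by ext v; exact congrArg (· v) h)
  obtain ⟨K, Ψ, hK, hxs, hsU, hΨ, -, hsymm⟩ := exists_straightening_vectorSpace hU hw hx hsurj
  have hc : ContDiff ℝ ∞ fun q : K => ((w x, q) : ℝ × K) := contDiff_const.prodMk contDiff_id
  refine ⟨K, Ψ.source, (fun q => ((w x, q) : ℝ × K)) ⁻¹' Ψ.target, fun q => Ψ.symm (w x, q),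
    by simpa using hK, Ψ.open_source.mem_nhds hxs, Ψ.open_target.preimage hc.continuous,
    hsymm.comp hc.contDiffOn fun q hq => hq, fun q hq => hsU (Ψ.map_target hq), ?_, ?_⟩
  · intro z hz hzx
    have h1 : ((w x, (Ψ z).2) : ℝ × K) = Ψ z := Prod.ext ((hΨ z hz).trans hzx).symm rfl
    refine ⟨(Ψ z).2, ?_, ?_⟩
    · change ((w x, (Ψ z).2) : ℝ × K) ∈ Ψ.target
      rw [h1]; exact Ψ.map_source hz
    · simp only [h1]; exact Ψ.left_inv hz
  · intro q hq
    rw [← hΨ _ (Ψ.map_target hq), Ψ.right_inv hq]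

/-- Sard's theorem in dimension `m`: the critical values form a meagre set. -/
def SardInDimension (m : ℕ) : Prop :=
  ∀ (E : Type u) [NormedAddCommGroup E] [NormedSpace ℝ E] [FiniteDimensional ℝ E]
    (F : Type v) [NormedAddCommGroup F] [NormedSpace ℝ F] [FiniteDimensional ℝ F]
    (U : Set E) (f : E → F), Module.finrank ℝ E = m → IsOpen U → ContDiffOn ℝ ∞ f U →
    IsMeagre (f '' {x ∈ U | ¬ Function.Surjective (fderiv ℝ f x)})

variable {E : Type u} [NormedAddCommGroup E] [NormedSpace ℝ E] [FiniteDimensional ℝ E]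
  {F : Type v} [NormedAddCommGroup F] [NormedSpace ℝ F] [FiniteDimensional ℝ F]

/-- The part of `{df = 0}` lying on a hypersurface `{w = 0}`, `dw ≠ 0`: its points are critical for
the restriction of `f` to the hypersurface. -/
theorem isMeagre_image_fderiv_eq_zero_of_hypersurface [Nontrivial F] {G : Type*}
    [NormedAddCommGroup G] [NormedSpace ℝ G]
    (ih : ∀ m < Module.finrank ℝ E, SardInDimension.{u, v} m) {U : Set E} (hU : IsOpen U)
    {f : E → F} (hf : ContDiffOn ℝ ∞ f U) {w : E → G} (hw : ContDiffOn ℝ ∞ w U) :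
    IsMeagre (f '' {x ∈ U | fderiv ℝ f x = 0 ∧ w x = 0 ∧ fderiv ℝ w x ≠ 0}) := by
  refine isMeagre_image_of_locally ?_
  rintro x ⟨hx, hfx, hwx, hdw⟩
  have hwd : ∀ z ∈ U, DifferentiableAt ℝ w z := fun z hz =>
    (hw.contDiffAt (hU.mem_nhds hz)).differentiableAt (by simp)
  obtain ⟨v, hv⟩ : ∃ v, fderiv ℝ w x v ≠ 0 := by
    by_contra! h
    exact hdw (by ext v; exact h v)
  obtain ⟨ℓ, -, hℓ⟩ := exists_dual_vector ℝ _ (norm_ne_zero_iff.2 hv)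
  have hℓw : ContDiffOn ℝ ∞ (fun z => ℓ (w z)) U := ℓ.contDiff.comp_contDiffOn hw
  have hℓd : fderiv ℝ (fun z => ℓ (w z)) x ≠ 0 := by
    intro h0
    have h1 : fderiv ℝ (fun z => ℓ (w z)) x = ℓ.comp (fderiv ℝ w x) :=
      (ℓ.hasFDerivAt.comp x (hwd x hx).hasFDerivAt).fderiv
    rw [h1] at h0
    have h2 := congrArg (fun L : E →L[ℝ] ℝ => L v) h0
    simp only [ContinuousLinearMap.comp_apply, zero_apply] at h2
    rw [hℓ] at h2
    exact hv (by simpa using h2)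
  obtain ⟨K, V, O, φ, hK, hV, hO, hφ, hmap, hcov, -⟩ :=
    exists_parametrization_levelSet hU hℓw hx hℓd
  refine ⟨V, hV, (ih _ (by omega) K F O (f ∘ φ) rfl hO (hf.comp hφ hmap)).mono ?_⟩
  rintro _ ⟨z, ⟨⟨hz, hfz, hwz, -⟩, hzV⟩, rfl⟩
  obtain ⟨q, hq, rfl⟩ := hcov z hzV (by rw [hwz, hwx])
  refine ⟨q, ⟨hq, ?_⟩, rfl⟩
  have h1 : fderiv ℝ (f ∘ φ) q = (fderiv ℝ f (φ q)).comp (fderiv ℝ φ q) :=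
    fderiv_comp q ((hf.contDiffAt (hU.mem_nhds hz)).differentiableAt (by simp))
      ((hφ.contDiffAt (hO.mem_nhds hq)).differentiableAt (by simp))
  rw [h1, hfz]
  intro h2
  obtain ⟨y, hy⟩ := exists_ne (0 : F)
  obtain ⟨e, he⟩ := h2 y
  exact hy (by simpa using he.symm)

/-- Points with `df ≠ 0`. The critical values near such a point form a compact set whose slices by
the hyperplanes `{ℓ = c}` are critical values of the restrictions of `f` to the hypersurfaces
`{ℓ ∘ f = c}`, hence have no interior. -/
theorem isMeagre_image_critical_fderiv_ne_zero
    (ih : ∀ m < Module.finrank ℝ E, SardInDimension.{u, v} m) {U : Set E} (hU : IsOpen U)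
    {f : E → F} (hf : ContDiffOn ℝ ∞ f U) :
    IsMeagre (f '' {x ∈ U | ¬ Function.Surjective (fderiv ℝ f x) ∧ fderiv ℝ f x ≠ 0}) := by
  have := FiniteDimensional.complete ℝ F
  refine isMeagre_image_of_locally ?_
  rintro x ⟨hx, -, hdf⟩
  have hfd : ∀ z ∈ U, DifferentiableAt ℝ f z := fun z hz =>
    (hf.contDiffAt (hU.mem_nhds hz)).differentiableAt (by simp)
  have hdc : ContinuousOn (fderiv ℝ f) U := hf.continuousOn_fderiv_of_isOpen hU (by simp)
  obtain ⟨v, hv⟩ : ∃ v, fderiv ℝ f x v ≠ 0 := by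
    by_contra! h
    exact hdf (by ext v; exact h v)
  obtain ⟨ℓ, -, hℓ⟩ := exists_dual_vector ℝ _ (norm_ne_zero_iff.2 hv)
  have hℓx : ℓ (fderiv ℝ f x v) ≠ 0 := by rw [hℓ]; simpa using hv
  have hopen : IsOpen (U ∩ (fun z => ℓ (fderiv ℝ f z v)) ⁻¹' {0}ᶜ) := by
    refine ContinuousOn.isOpen_inter_preimage ?_ hU isOpen_compl_singleton
    exact ℓ.continuous.comp_continuousOn (hdc.clm_apply continuousOn_const)
  obtain ⟨r, hr, hball⟩ := Metric.nhds_basis_closedBall.mem_iff.1 (hopen.mem_nhds ⟨hx, hℓx⟩)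
  refine ⟨Metric.closedBall x r, Metric.closedBall_mem_nhds x hr, ?_⟩
  set B := Metric.closedBall x r
  have hBU : B ⊆ U := fun z hz => (hball hz).1
  set C : Set E := {z ∈ B | ¬ Function.Surjective (fderiv ℝ f z)} with hC
  have hCc : IsCompact C := by
    have h1 : IsClosed (B ∩ fderiv ℝ f ⁻¹' {A : E →L[ℝ] F | Function.Surjective A}ᶜ) :=
      (hdc.mono hBU).preimage_isClosed_of_isClosed Metric.isClosed_closedBall
        isOpen_setOf_surjective_continuousLinearMap.isClosed_compl
    exact (isCompact_closedBall x r).of_isClosed_subset h1 inter_subset_left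
  have hTc : IsClosed (f '' C) :=
    (hCc.image_of_continuousOn (hf.continuousOn.mono fun z hz => hBU hz.1)).isClosed
  have hsub : {x ∈ U | ¬ Function.Surjective (fderiv ℝ f x) ∧ fderiv ℝ f x ≠ 0} ∩ B ⊆ C :=
    fun z hz => ⟨hz.2, hz.1.2.1⟩
  refine (IsNowhereDense.isMeagre (s := f '' C) ?_).mono (image_mono hsub)
  rw [hTc.isNowhereDense_iff, eq_empty_iff_forall_notMem]
  intro c hc
  set F' : Submodule ℝ F := LinearMap.ker (ℓ : F →ₗ[ℝ] ℝ)
  obtain ⟨P, hP⟩ := Submodule.ClosedComplemented.of_finiteDimensional F'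
  set g : E → F' := fun z => P (f z - c) with hg
  set S : Set E := {z ∈ C | ℓ (f z) = ℓ c}
  -- The slice of `interior (f '' C)` by the hyperplane through `c` parallel to `ker ℓ`.
  have hslice : IsOpen ((fun v : F' => c + (v : F)) ⁻¹' interior (f '' C)) :=
    isOpen_interior.preimage (by fun_prop)
  have hne : ((fun v : F' => c + (v : F)) ⁻¹' interior (f '' C)).Nonempty :=
    ⟨0, by simpa using hc⟩
  refine not_isMeagre_of_isOpen hslice hne (IsMeagre.mono ?_
    (isMeagre_image_of_locally (f := g) (S := S) ?_))
  · intro v hv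
    obtain ⟨z, hz, hzv⟩ := interior_subset hv
    refine ⟨z, ⟨hz, ?_⟩, ?_⟩
    · have : ℓ (v : F) = 0 := v.2
      rw [hzv]; simp [this]
    · simp only [hg, hzv, add_sub_cancel_left]; exact hP v
  rintro z ⟨hz, hzc⟩
  have hℓf : ContDiffOn ℝ ∞ (fun z => ℓ (f z)) U := ℓ.contDiff.comp_contDiffOn hf
  have hℓd : fderiv ℝ (fun z => ℓ (f z)) z ≠ 0 := by
    intro h0
    have h1 : fderiv ℝ (fun z => ℓ (f z)) z = ℓ.comp (fderiv ℝ f z) :=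
      (ℓ.hasFDerivAt.comp z (hfd z (hBU hz.1)).hasFDerivAt).fderiv
    rw [h1] at h0
    exact (hball hz.1).2 (congrArg (fun L : E →L[ℝ] ℝ => L v) h0)
  obtain ⟨K, V, O, φ, hK, hV, hO, hφ, hmap, hcov, hval⟩ :=
    exists_parametrization_levelSet hU hℓf (hBU hz.1) hℓd
  have hgs : ContDiffOn ℝ ∞ g U := P.contDiff.comp_contDiffOn (hf.sub contDiffOn_const)
  refine ⟨V, hV, (ih _ (by omega) K F' O (g ∘ φ) rfl hO (hgs.comp hφ hmap)).mono ?_⟩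
  rintro _ ⟨y, ⟨⟨hy, hyc⟩, hyV⟩, rfl⟩
  obtain ⟨q, hq, rfl⟩ := hcov y hyV (by rw [hyc, hzc])
  refine ⟨q, ⟨hq, fun hsurj => hy.2 ?_⟩, rfl⟩
  have hφq : HasFDerivAt φ (fderiv ℝ φ q) q :=
    ((hφ.contDiffAt (hO.mem_nhds hq)).differentiableAt (by simp)).hasFDerivAt
  have hfq := (hfd _ (hBU hy.1)).hasFDerivAt.comp q hφq
  have h1 : fderiv ℝ (g ∘ φ) q = P.comp ((fderiv ℝ f (φ q)).comp (fderiv ℝ φ q)) := by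
    have := P.hasFDerivAt.comp q (hfq.sub_const c)
    exact this.fderiv
  have h2 : ℓ.comp ((fderiv ℝ f (φ q)).comp (fderiv ℝ φ q)) = 0 := by
    have h3 := (ℓ.hasFDerivAt (x := (f ∘ φ) q)).comp q hfq
    have h4 : (ℓ ∘ (f ∘ φ)) =ᶠ[𝓝 q] fun _ => ℓ (f z) := by
      filter_upwards [hO.mem_nhds hq] with q' hq'
      exact hval q' hq'
    exact h3.unique ((hasFDerivAt_const _ q).congr_of_eventuallyEq h4)
  have hker : ∀ y : F, ℓ y = 0 → ∃ e, fderiv ℝ f (φ q) e = y := by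
    intro y hy0
    obtain ⟨e, he⟩ := hsurj ⟨y, hy0⟩
    refine ⟨fderiv ℝ φ q e, ?_⟩
    have h5 : ℓ (fderiv ℝ f (φ q) (fderiv ℝ φ q e)) = 0 :=
      congrArg (fun L : K →L[ℝ] ℝ => L e) h2
    have h6 := hP ⟨_, h5⟩
    rw [h1] at he
    exact congrArg Subtype.val (h6.symm.trans he)
  have hne : ℓ (fderiv ℝ f (φ q) v) ≠ 0 := (hball hy.1).2
  intro y
  obtain ⟨e, he⟩ := hker (y - (ℓ y / ℓ (fderiv ℝ f (φ q) v)) • fderiv ℝ f (φ q) v) (by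
    simp [hne])
  exact ⟨e + (ℓ y / ℓ (fderiv ℝ f (φ q) v)) • v, by simp [he]⟩

omit [FiniteDimensional ℝ E] [FiniteDimensional ℝ F] in
/-- If the derivatives of `f` of orders `1, …, k` vanish at `z`, then `f` is Hölder of exponent
`k + 1` at `z`, uniformly for `z` in a compact convex set. -/
theorem exists_norm_sub_le_pow_of_iteratedFDeriv_eq_zero {U : Set E} (hU : IsOpen U) {f : E → F}
    (hf : ContDiffOn ℝ ∞ f U) {B : Set E} (hB : IsCompact B) (hBc : Convex ℝ B) (hBU : B ⊆ U)
    (k : ℕ) :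
    ∃ C : ℝ, 0 ≤ C ∧ ∀ z ∈ B, (∀ j, 1 ≤ j → j ≤ k → iteratedFDeriv ℝ j f z = 0) →
      ∀ y ∈ B, ‖f y - f z‖ ≤ C * ‖y - z‖ ^ (k + 1) := by
  have hfa : ∀ z ∈ U, ContDiffAt ℝ ∞ f z := fun z hz => hf.contDiffAt (hU.mem_nhds hz)
  have hd : ∀ j : ℕ, ∀ z ∈ U, ContDiffAt ℝ ∞ (iteratedFDeriv ℝ j f) z := fun j z hz =>
    (hfa z hz).iteratedFDeriv_right (by exact_mod_cast le_top)
  obtain ⟨C, hC⟩ := hB.exists_bound_of_continuousOn (f := iteratedFDeriv ℝ (k + 1) f)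
    fun z hz => (hd _ z (hBU hz)).continuousAt.continuousWithinAt
  refine ⟨max C 0, le_max_right _ _, fun z hz hflat y hy => ?_⟩
  have key : ∀ i : ℕ, i ≤ k → ∀ y ∈ B,
      ‖iteratedFDeriv ℝ (k + 1 - i) f y‖ ≤ max C 0 * ‖y - z‖ ^ i := by
    intro i
    induction i with
    | zero => intro _ y hy; simpa using Or.inl (hC y hy)
    | succ i ih =>
      intro hi y hy
      have h0 := hflat (k + 1 - (i + 1)) (by omega) (by omega)
      have hseg : segment ℝ z y ⊆ B := hBc.segment_subset hz hy
      have h1 := (convex_segment z y).norm_image_sub_le_of_norm_fderiv_le (𝕜 := ℝ)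
        (f := iteratedFDeriv ℝ (k + 1 - (i + 1)) f) (C := max C 0 * ‖y - z‖ ^ i)
        (fun a ha => (hd _ a (hBU (hseg ha))).differentiableAt (by simp))
        (fun a ha => ?_) (left_mem_segment ℝ z y) (right_mem_segment ℝ z y)
      · rw [h0, sub_zero] at h1
        rw [pow_succ, ← mul_assoc]; exact h1
      · rw [norm_fderiv_iteratedFDeriv, show k + 1 - (i + 1) + 1 = k + 1 - i by omega]
        refine (ih (by omega) a (hseg ha)).trans ?_
        gcongr
        exact norm_sub_le_of_mem_segment ha
  have hseg : segment ℝ z y ⊆ B := hBc.segment_subset hz hy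
  have h1 := (convex_segment z y).norm_image_sub_le_of_norm_fderiv_le (𝕜 := ℝ)
    (f := f) (C := max C 0 * ‖y - z‖ ^ k)
    (fun a ha => (hfa a (hBU (hseg ha))).differentiableAt (by simp))
    (fun a ha => ?_) (left_mem_segment ℝ z y) (right_mem_segment ℝ z y)
  · rw [pow_succ, ← mul_assoc]; exact h1
  · rw [← norm_iteratedFDeriv_one, show 1 = k + 1 - k by omega]
    refine (key k le_rfl a (hseg ha)).trans ?_
    gcongr
    exact norm_sub_le_of_mem_segment ha

/-- Points where all derivatives of orders `1, …, dim E` vanish: there `f` is Hölder of exponent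
`dim E + 1`, so that the image has Hausdorff dimension less than one. -/
theorem isMeagre_image_flat [Nontrivial F] {U : Set E} (hU : IsOpen U) {f : E → F}
    (hf : ContDiffOn ℝ ∞ f U) :
    IsMeagre (f '' {x ∈ U | ∀ j, 1 ≤ j → j ≤ Module.finrank ℝ E → iteratedFDeriv ℝ j f x = 0}) := by
  set k := Module.finrank ℝ E with hk
  refine isMeagre_image_of_locally ?_
  rintro x ⟨hx, -⟩
  obtain ⟨r, hr, hBU⟩ := Metric.nhds_basis_closedBall.mem_iff.1 (hU.mem_nhds hx)
  refine ⟨_, Metric.closedBall_mem_nhds x hr, ?_⟩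
  set B := Metric.closedBall x r
  set S : Set E := {z ∈ U | ∀ j, 1 ≤ j → j ≤ k → iteratedFDeriv ℝ j f z = 0} ∩ B
  have hB : IsCompact B := isCompact_closedBall x r
  have hSc : IsCompact S := by
    have h1 : S = B ∩ ⋂ j, ⋂ (_ : 1 ≤ j), ⋂ (_ : j ≤ k), B ∩ (iteratedFDeriv ℝ j f) ⁻¹' {0} := by
      ext z
      simp only [S, mem_inter_iff, mem_ofPred_eq, mem_iInter, mem_preimage, mem_singleton_iff]
      constructor
      · rintro ⟨⟨h1, h2⟩, h3⟩
        exact ⟨h3, fun j hj hjk => ⟨h3, h2 j hj hjk⟩⟩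
      · rintro ⟨h1, h2⟩
        exact ⟨⟨hBU h1, fun j hj hjk => (h2 j hj hjk).2⟩, h1⟩
    rw [h1]
    refine hB.inter_right (isClosed_iInter fun j => isClosed_iInter fun _ => isClosed_iInter
      fun _ => ContinuousOn.preimage_isClosed_of_isClosed (fun z hz => ?_)
        Metric.isClosed_closedBall isClosed_singleton)
    exact ((hf.contDiffAt (hU.mem_nhds (hBU hz))).iteratedFDeriv_right
      (m := 0) (by rw [zero_add]; exact_mod_cast le_top)).continuousAt.continuousWithinAt
  have hTc : IsClosed (f '' S) :=
    (hSc.image_of_continuousOn (hf.continuousOn.mono fun z hz => hz.1.1)).isClosed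
  refine IsNowhereDense.isMeagre ?_
  rw [hTc.isNowhereDense_iff]
  by_contra hne
  have hdim := Real.dimH_of_nonempty_interior (nonempty_iff_ne_empty.2 hne)
  obtain ⟨C, hC0, hC⟩ := exists_norm_sub_le_pow_of_iteratedFDeriv_eq_zero hU hf hB
    (convex_closedBall x r) hBU k
  have hhol : HolderOnWith C.toNNReal ((k : NNReal) + 1) f S := by
    intro y hy z hz
    have h1 := hC z hz.2 hz.1.2 y hy.2
    rw [edist_dist, edist_dist, dist_eq_norm, dist_eq_norm]
    have h2 : ((((k : NNReal) + 1 : NNReal) : ℝ)) = ((k + 1 : ℕ) : ℝ) := by push_cast; rfl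
    rw [h2, ENNReal.rpow_natCast, ← ENNReal.ofReal_pow (norm_nonneg _)]
    exact (ENNReal.ofReal_le_ofReal h1).trans (ENNReal.ofReal_mul hC0).le
  have h1 := hhol.dimH_image_le (by positivity)
  have h2 : dimH S ≤ k := (dimH_mono (subset_univ S)).trans (Real.dimH_univ_eq_finrank E).le
  have h3 : (1 : ENNReal) ≤ dimH (f '' S) := by
    rw [hdim]; exact_mod_cast Module.finrank_pos (R := ℝ) (M := F)
  have h4 : dimH S / (((k : NNReal) + 1 : NNReal) : ENNReal) < 1 := by
    refine (ENNReal.div_lt_iff (by left; simp) (by left; simp)).2 ?_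
    rw [one_mul]
    refine h2.trans_lt ?_
    have : ((k : ℕ) : ENNReal) < ((k + 1 : ℕ) : ENNReal) := by exact_mod_cast Nat.lt_succ_self k
    simpa using this
  exact lt_irrefl _ ((h3.trans h1).trans_lt h4)

/-- **Sard's theorem**. The critical points where some derivative of order at most `dim E` is nonzero
are reduced to hypersurfaces, to which the induction hypothesis applies; the remaining points are
flat. -/
theorem sardInDimension (m : ℕ) : SardInDimension.{u, v} m := by
  induction m using Nat.strong_induction_on with
  | _ m ih =>
  intro E _ _ _ F _ _ _ U f hm hU hf
  subst hm
  rcases subsingleton_or_nontrivial F with hF | hF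
  · convert IsMeagre.empty (X := F)
    rw [image_eq_empty, eq_empty_iff_forall_notMem]
    rintro x ⟨-, hx⟩
    exact hx fun y => ⟨0, Subsingleton.elim _ _⟩
  have hD : ∀ i : ℕ, ContDiffOn ℝ ∞ (iteratedFDeriv ℝ i f) U := fun i z hz =>
    ((hf.contDiffAt (hU.mem_nhds hz)).iteratedFDeriv_right (by exact_mod_cast le_top)).contDiffWithinAt
  refine (((isMeagre_image_critical_fderiv_ne_zero ih hU hf).union
    (isMeagre_image_flat hU hf)).union (isMeagre_iUnion fun i : ℕ =>
      isMeagre_image_fderiv_eq_zero_of_hypersurface ih hU hf (hD i))).mono ?_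
  rintro _ ⟨x, ⟨hx, hs⟩, rfl⟩
  by_cases h0 : fderiv ℝ f x = 0
  · by_cases hflat : ∀ j, 1 ≤ j → j ≤ Module.finrank ℝ E → iteratedFDeriv ℝ j f x = 0
    · exact Or.inl (Or.inr ⟨x, ⟨hx, hflat⟩, rfl⟩)
    · -- The first non-vanishing derivative has order at least two.
      have hex : ∃ j, 1 ≤ j ∧ iteratedFDeriv ℝ j f x ≠ 0 := by
        push Not at hflat
        obtain ⟨j, h1, -, h3⟩ := hflat
        exact ⟨j, h1, h3⟩
      classical
      have h1 := Nat.find_spec hex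
      set j := Nat.find hex with hj
      have hj1 : j ≠ 1 := by
        intro hj1
        refine h1.2 (norm_eq_zero.1 ?_)
        rw [hj1, norm_iteratedFDeriv_one, h0, norm_zero]
      obtain ⟨i, hi⟩ : ∃ i, j = i + 1 := ⟨j - 1, by omega⟩
      have h2 : iteratedFDeriv ℝ i f x = 0 := by
        by_contra h3
        have := Nat.find_min' hex ⟨by omega, h3⟩
        omega
      refine Or.inr (mem_iUnion.2 ⟨i, x, ⟨hx, h0, h2, ?_⟩, rfl⟩)
      intro h3
      refine h1.2 ?_
      rw [hi]
      ext m
      rw [iteratedFDeriv_succ_apply_left, h3]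
      rfl
  · exact Or.inl (Or.inl ⟨x, ⟨hx, hs, h0⟩, rfl⟩)

end Sard

/-! ### Smooth vector-space charts and straightening on a manifold -/

section Charts

variable {E : Type*} [NormedAddCommGroup E] [NormedSpace ℝ E]
  {H : Type*} [TopologicalSpace H] {I : ModelWithCorners ℝ E H}
  {W : Type*} [TopologicalSpace W] [ChartedSpace H W]
  {Q : Type*} [NormedAddCommGroup Q] [NormedSpace ℝ Q]
  {F : Type*} [NormedAddCommGroup F] [NormedSpace ℝ F]

variable (I) in
/-- The differential at `z` of a map from `W` to a vector space `F`, with values in `F` itself. -/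
noncomputable def diffl (φ : W → F) (z : W) : TangentSpace I z →L[ℝ] F := mfderiv I 𝓘(ℝ, F) φ z

variable (I) in
/-- `Ψ` is a diffeomorphism from an open subset of `W` to an open subset of the vector space `Q`. -/
structure IsSmoothChart (Ψ : OpenPartialHomeomorph W Q) : Prop where
  contMDiffOn : ContMDiffOn I 𝓘(ℝ, Q) ∞ Ψ Ψ.source
  contMDiffOn_symm : ContMDiffOn 𝓘(ℝ, Q) I ∞ Ψ.symm Ψ.target

variable (I) in
theorem exists_isSmoothChart [I.Boundaryless] [IsManifold I ∞ W] (x : W) :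
    ∃ C : OpenPartialHomeomorph W E, IsSmoothChart I C ∧ x ∈ C.source := by
  let C := (chartAt H x).trans I.toHomeomorph.toOpenPartialHomeomorph
  have hs : C.source = (chartAt H x).source := by simp [C]
  have ht : C.target = (extChartAt I x).target := by
    rw [extChartAt_target, I.range_eq_univ, inter_univ, OpenPartialHomeomorph.trans_target]
    exact univ_inter _
  refine ⟨C, ⟨?_, ?_⟩, by rw [hs]; exact mem_chart_source H x⟩
  · rw [hs]; exact contMDiffOn_extChartAt (I := I) (x := x)
  · rw [ht]; exact contMDiffOn_extChartAt_symm (I := I) x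

namespace IsSmoothChart

variable {Ψ : OpenPartialHomeomorph W Q} (hΨ : IsSmoothChart I Ψ)
include hΨ

theorem mdifferentiableAt {z : W} (hz : z ∈ Ψ.source) : MDifferentiableAt I 𝓘(ℝ, Q) Ψ z :=
  (hΨ.contMDiffOn.contMDiffAt (Ψ.open_source.mem_nhds hz)).mdifferentiableAt (by simp)

theorem contMDiffAt_symm {y : Q} (hy : y ∈ Ψ.target) : ContMDiffAt 𝓘(ℝ, Q) I ∞ Ψ.symm y :=
  hΨ.contMDiffOn_symm.contMDiffAt (Ψ.open_target.mem_nhds hy)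

theorem mdifferentiableAt_symm {y : Q} (hy : y ∈ Ψ.target) :
    MDifferentiableAt 𝓘(ℝ, Q) I Ψ.symm y :=
  (hΨ.contMDiffAt_symm hy).mdifferentiableAt (by simp)

/-- The differential of a smooth chart, as a linear isomorphism. -/
noncomputable def tangentEquiv {z : W} (hz : z ∈ Ψ.source) : TangentSpace I z ≃L[ℝ] Q :=
  let B : Q →L[ℝ] TangentSpace I (Ψ.symm (Ψ z)) := mfderiv 𝓘(ℝ, Q) I Ψ.symm (Ψ z)
  ContinuousLinearEquiv.equivOfInverse (diffl I Ψ z)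
    (show Q →L[ℝ] TangentSpace I z from B)
    (by
      intro v
      have h1 := mfderiv_comp z (hΨ.mdifferentiableAt_symm (Ψ.map_source hz))
        (hΨ.mdifferentiableAt hz)
      have h2 : (Ψ.symm ∘ Ψ) =ᶠ[𝓝 z] id := by
        filter_upwards [Ψ.open_source.mem_nhds hz] with y hy using Ψ.left_inv hy
      rw [h2.mfderiv_eq, mfderiv_id] at h1
      exact (congrArg (fun L : TangentSpace I z →L[ℝ] TangentSpace I z => L v) h1).symm)
    (by
      intro v
      have h0 := Ψ.left_inv hz
      have hz' : Ψ.symm (Ψ z) ∈ Ψ.source := by rwa [h0]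
      have h1 := mfderiv_comp (Ψ z) (hΨ.mdifferentiableAt hz')
        (hΨ.mdifferentiableAt_symm (Ψ.map_source hz))
      have h2 : (Ψ ∘ Ψ.symm) =ᶠ[𝓝 (Ψ z)] id := by
        filter_upwards [Ψ.open_target.mem_nhds (Ψ.map_source hz)] with y hy using Ψ.right_inv hy
      rw [h2.mfderiv_eq, mfderiv_id] at h1
      have h3 := (congrArg (fun L : Q →L[ℝ] Q => L v) h1).symm
      rw [h0] at h3
      exact h3)

/-- The differential of a map in terms of its expression in the chart. -/
theorem diffl_eq_fderiv {φ : W → F} {z : W} (hz : z ∈ Ψ.source)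
    (hφ : MDifferentiableAt I 𝓘(ℝ, F) φ z) (v : TangentSpace I z) :
    diffl I φ z v = fderiv ℝ (φ ∘ Ψ.symm) (Ψ z) (hΨ.tangentEquiv hz v) := by
  have h0 := Ψ.left_inv hz
  have hφ' : MDifferentiableAt I 𝓘(ℝ, F) φ (Ψ.symm (Ψ z)) := by rwa [h0]
  have h1 := mfderiv_comp (Ψ z) hφ' (hΨ.mdifferentiableAt_symm (Ψ.map_source hz))
  rw [h0] at h1
  have h2 := (hΨ.tangentEquiv hz).symm_apply_apply v
  have h3 : fderiv ℝ (φ ∘ Ψ.symm) (Ψ z) (hΨ.tangentEquiv hz v) =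
      diffl I φ z ((hΨ.tangentEquiv hz).symm (hΨ.tangentEquiv hz v)) := by
    rw [← _root_.mfderiv_eq_fderiv]
    exact congrArg (fun L : Q →L[ℝ] F => L (hΨ.tangentEquiv hz v)) h1
  rw [h3, h2]

theorem contDiffAt_comp_symm {φ : W → F} {z : W} (hz : z ∈ Ψ.source)
    (hφ : ContMDiffAt I 𝓘(ℝ, F) ∞ φ z) : ContDiffAt ℝ ∞ (φ ∘ Ψ.symm) (Ψ z) := by
  rw [← contMDiffAt_iff_contDiffAt]
  refine ContMDiffAt.comp (Ψ z) ?_ (hΨ.contMDiffAt_symm (Ψ.map_source hz))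
  rwa [Ψ.left_inv hz]

/-- The curve `s ↦ Ψ⁻¹ (Ψ z + s • dΨ v)` has velocity `v` at `z`. -/
theorem hasDerivAt_comp_curve {φ : W → F} {z : W} (hz : z ∈ Ψ.source)
    (hφ : MDifferentiableAt I 𝓘(ℝ, F) φ z) (v : TangentSpace I z) :
    HasDerivAt (fun s : ℝ => φ (Ψ.symm (Ψ z + s • hΨ.tangentEquiv hz v))) (diffl I φ z v) 0 := by
  rw [hΨ.diffl_eq_fderiv hz hφ]
  set w : Q := hΨ.tangentEquiv hz v
  have h0 : MDifferentiableAt 𝓘(ℝ, Q) 𝓘(ℝ, F) (φ ∘ Ψ.symm) (Ψ z) := by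
    refine MDifferentiableAt.comp (Ψ z) ?_ (hΨ.mdifferentiableAt_symm (Ψ.map_source hz))
    rwa [Ψ.left_inv hz]
  have h1 : HasFDerivAt (φ ∘ Ψ.symm) (fderiv ℝ (φ ∘ Ψ.symm) (Ψ z)) (Ψ z + (0 : ℝ) • w) := by
    rw [zero_smul, add_zero]
    exact (mdifferentiableAt_iff_differentiableAt.1 h0).hasFDerivAt
  have h2 : HasDerivAt (fun s : ℝ => Ψ z + s • w) w 0 := by
    simpa using ((hasDerivAt_id (0 : ℝ)).smul_const w).const_add (Ψ z)
  exact h1.comp_hasDerivAt (0 : ℝ) h2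

omit hΨ [NormedAddCommGroup E] [NormedSpace ℝ E] [TopologicalSpace H] [ChartedSpace H W] in
theorem tendsto_curve {z : W} (hz : z ∈ Ψ.source) (w : Q) :
    Tendsto (fun s : ℝ => Ψ.symm (Ψ z + s • w)) (𝓝 0) (𝓝 z) := by
  have h1 : Tendsto (fun s : ℝ => Ψ z + s • w) (𝓝 0) (𝓝 (Ψ z)) := by
    have : Continuous fun s : ℝ => Ψ z + s • w := by fun_prop
    simpa using this.tendsto 0
  exact (Ψ.tendsto_symm hz).comp h1

end IsSmoothChart

variable [FiniteDimensional ℝ E] [FiniteDimensional ℝ F]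

/-- **Straightening** on a manifold: near a point where `dh` is onto, `h` is the first component of
a smooth chart. -/
theorem exists_straightening [I.Boundaryless] [IsManifold I ∞ W] {U : Set W} (hU : IsOpen U)
    {h : W → F} (hh : ContMDiffOn I 𝓘(ℝ, F) ∞ h U) {x : W} (hx : x ∈ U)
    (hs : Function.Surjective (diffl I h x)) :
    ∃ (K : Submodule ℝ E) (Ψ : OpenPartialHomeomorph W (F × K)), IsSmoothChart I Ψ ∧
      x ∈ Ψ.source ∧ Ψ.source ⊆ U ∧ ∀ z ∈ Ψ.source, (Ψ z).1 = h z := by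
  obtain ⟨C, hC, hxC⟩ := exists_isSmoothChart I x
  have hU' : IsOpen (C.target ∩ C.symm ⁻¹' U) := C.symm.isOpen_inter_preimage hU
  have hsm : ContDiffOn ℝ ∞ (h ∘ C.symm) (C.target ∩ C.symm ⁻¹' U) := by
    rw [← contMDiffOn_iff_contDiffOn]
    exact hh.comp (hC.contMDiffOn_symm.mono inter_subset_left) fun z hz => hz.2
  have hxU' : C x ∈ C.target ∩ C.symm ⁻¹' U := ⟨C.map_source hxC, by
    change C.symm (C x) ∈ U
    rwa [C.left_inv hxC]⟩
  have hd : MDifferentiableAt I 𝓘(ℝ, F) h x :=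
    (hh.contMDiffAt (hU.mem_nhds hx)).mdifferentiableAt (by simp)
  have hsurj : Function.Surjective (fderiv ℝ (h ∘ C.symm) (C x)) := by
    intro y
    obtain ⟨v, hv⟩ := hs y
    exact ⟨_, (hC.diffl_eq_fderiv hxC hd v).symm.trans hv⟩
  obtain ⟨K, Ψ, -, hxs, hsU, h1, h2, h3⟩ :=
    exists_straightening_vectorSpace hU' hsm hxU' hsurj
  refine ⟨K, C.trans Ψ, ⟨?_, ?_⟩, by simp [hxC, hxs], ?_, ?_⟩
  · refine ContMDiffOn.comp (g := Ψ) (f := C) (contMDiffOn_iff_contDiffOn.2 h2)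
      (hC.contMDiffOn.mono ?_) ?_
    · intro z hz
      rw [OpenPartialHomeomorph.trans_source] at hz
      exact hz.1
    · intro z hz
      rw [OpenPartialHomeomorph.trans_source] at hz
      exact hz.2
  · refine ContMDiffOn.comp (g := C.symm) (f := Ψ.symm) hC.contMDiffOn_symm
      ((contMDiffOn_iff_contDiffOn.2 h3).mono ?_) ?_
    · intro z hz
      rw [OpenPartialHomeomorph.trans_target] at hz
      exact hz.1
    · intro z hz
      rw [OpenPartialHomeomorph.trans_target] at hz
      exact hz.2
  · intro z hz
    rw [OpenPartialHomeomorph.trans_source] at hz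
    have := (hsU hz.2).2
    change C.symm (C z) ∈ U at this
    rwa [C.left_inv hz.1] at this
  · intro z hz
    rw [OpenPartialHomeomorph.trans_source] at hz
    change (Ψ (C z)).1 = h z
    rw [h1 _ hz.2, Function.comp_apply, C.left_inv hz.1]

end Charts

/-! ### Sard's theorem on manifolds -/

section SardManifold

variable {E : Type*} [NormedAddCommGroup E] [NormedSpace ℝ E] [FiniteDimensional ℝ E]
  {H : Type*} [TopologicalSpace H] {I : ModelWithCorners ℝ E H} [I.Boundaryless]
  {W : Type*} [TopologicalSpace W] [ChartedSpace H W] [IsManifold I ∞ W]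
  {F : Type*} [NormedAddCommGroup F] [NormedSpace ℝ F] [FiniteDimensional ℝ F]

/-- **Sard's theorem**: the regular values of a smooth map to a vector space are dense. -/
theorem dense_setOf_regularValue [SigmaCompactSpace W] {f : W → F}
    (hf : ContMDiff I 𝓘(ℝ, F) ∞ f) :
    Dense {c | ∀ z, f z = c → Function.Surjective (diffl I f z)} := by
  have := FiniteDimensional.complete ℝ F
  choose C hC hxC using exists_isSmoothChart (W := W) I
  obtain ⟨t, htc, ht⟩ := countable_cover_nhds_of_sigmaCompact
    fun x : W => (C x).open_source.mem_nhds (hxC x)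
  have hm : IsMeagre (⋃ x ∈ t, (f ∘ (C x).symm) ''
      {y ∈ (C x).target | ¬ Function.Surjective (fderiv ℝ (f ∘ (C x).symm) y)}) := by
    refine isMeagre_biUnion htc fun x _ => sardInDimension _ E F _ _ rfl (C x).open_target ?_
    rw [← contMDiffOn_iff_contDiffOn]
    exact hf.comp_contMDiffOn (hC x).contMDiffOn_symm
  refine (dense_of_mem_residual hm).mono fun c hc z hz => ?_
  by_contra hs
  refine hc ?_
  obtain ⟨x, hx, hzx⟩ := mem_iUnion₂.1 (ht.symm ▸ mem_univ z : z ∈ ⋃ x ∈ t, (C x).source)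
  refine mem_iUnion₂.2 ⟨x, hx, C x z, ⟨(C x).map_source hzx, fun h => hs fun y => ?_⟩, ?_⟩
  · obtain ⟨v, hv⟩ := h y
    refine ⟨((hC x).tangentEquiv hzx).symm v, ?_⟩
    rw [(hC x).diffl_eq_fderiv hzx (hf.mdifferentiableAt (by simp)),
      ContinuousLinearEquiv.apply_symm_apply]
    exact hv
  · rw [Function.comp_apply, (C x).left_inv hzx, hz]

end SardManifold

/-! ### Local geometry of submanifolds -/

section LocalGeometry

variable {E : Type*} [NormedAddCommGroup E] [NormedSpace ℝ E]
  {H : Type*} [TopologicalSpace H] {I : ModelWithCorners ℝ E H}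
  {W : Type*} [TopologicalSpace W] [ChartedSpace H W]
  {F : Type*} [NormedAddCommGroup F] [NormedSpace ℝ F]
  {G : Type*} [NormedAddCommGroup G] [NormedSpace ℝ G]

theorem diffl_comp_continuousLinearMap {f : W → F} {z : W} (hf : MDifferentiableAt I 𝓘(ℝ, F) f z)
    (L : F →L[ℝ] G) (v : TangentSpace I z) :
    diffl I (fun z => L (f z)) z v = L (diffl I f z v) := by
  have h1 := mfderiv_comp z (L.differentiableAt (x := f z)).mdifferentiableAt hf
  have h2 : mfderiv 𝓘(ℝ, F) 𝓘(ℝ, G) L (f z) = L := by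
    rw [mfderiv_eq_fderiv]; exact L.fderiv
  rw [h2] at h1
  exact congrArg (fun A : TangentSpace I z →L[ℝ] G => A v) h1

theorem diffl_prodMk {f : W → F} {g : W → G} {z : W} (hf : MDifferentiableAt I 𝓘(ℝ, F) f z)
    (hg : MDifferentiableAt I 𝓘(ℝ, G) g z) (v : TangentSpace I z) :
    diffl I (fun z => (f z, g z)) z v = (diffl I f z v, diffl I g z v) := by
  have hfg : MDifferentiableAt I 𝓘(ℝ, F × G) (fun z => (f z, g z)) z := hf.prodMk_space hg
  refine Prod.ext ?_ ?_
  · exact (diffl_comp_continuousLinearMap hfg (ContinuousLinearMap.fst ℝ F G) v).symm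
  · exact (diffl_comp_continuousLinearMap hfg (ContinuousLinearMap.snd ℝ F G) v).symm

theorem diffl_congr {f g : W → F} {z : W} (h : f =ᶠ[𝓝 z] g) : diffl I f z = diffl I g z := by
  have := h.mfderiv_eq (I := I) (I' := 𝓘(ℝ, F))
  ext v
  exact congrArg (fun L : TangentSpace I z →L[ℝ] F => L v) this

variable [FiniteDimensional ℝ E] [I.Boundaryless] [IsManifold I ∞ W] [FiniteDimensional ℝ F]

/-- Along any vector there is a curve on which a submersion `h` is affine. It detects the
differential of every function. -/
theorem exists_curve_of_surjective {h : W → F} {U : Set W} (hU : IsOpen U)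
    (hh : ContMDiffOn I 𝓘(ℝ, F) ∞ h U) {x : W} (hx : x ∈ U)
    (hs : Function.Surjective (diffl I h x)) (v : TangentSpace I x) :
    ∃ c : ℝ → W, c 0 = x ∧ Tendsto c (𝓝 0) (𝓝 x) ∧
      (∀ᶠ s in 𝓝 (0 : ℝ), h (c s) = h x + s • diffl I h x v) ∧
      (∀ φ : W → G, MDifferentiableAt I 𝓘(ℝ, G) φ x →
        HasDerivAt (fun s => φ (c s)) (diffl I φ x v) 0) := by
  obtain ⟨K, Ψ, hΨ, hxΨ, -, hfst⟩ := exists_straightening hU hh hx hs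
  set w := hΨ.tangentEquiv hxΨ v with hw
  refine ⟨fun s => Ψ.symm (Ψ x + s • w), by simp [Ψ.left_inv hxΨ], IsSmoothChart.tendsto_curve hxΨ w, ?_,
    fun φ hφ => hΨ.hasDerivAt_comp_curve hxΨ hφ v⟩
  have hw1 : w.1 = diffl I h x v := by
    have h1 := diffl_comp_continuousLinearMap (hΨ.mdifferentiableAt hxΨ)
      (ContinuousLinearMap.fst ℝ F K) v
    have h2 : (fun z => ContinuousLinearMap.fst ℝ F K (Ψ z)) =ᶠ[𝓝 x] h := by
      filter_upwards [Ψ.open_source.mem_nhds hxΨ] with z hz using hfst z hz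
    rw [diffl_congr h2] at h1
    exact h1.symm
  have hc : Continuous fun s : ℝ => Ψ x + s • w := by fun_prop
  have ht : ∀ᶠ s in 𝓝 (0 : ℝ), Ψ x + s • w ∈ Ψ.target := by
    refine hc.continuousAt.eventually_mem (Ψ.open_target.mem_nhds ?_)
    simpa using Ψ.map_source hxΨ
  filter_upwards [ht] with s hs
  rw [← hfst _ (Ψ.map_target hs), Ψ.right_inv hs, ← hfst x hxΨ, ← hw1]
  rfl

/-- If `φ` vanishes near `x` on the preimage of `T` under a submersion `h`, its differential
vanishes on the vectors whose image under `dh` points into `T`. -/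
theorem diffl_eq_zero_of_preimage {h : W → F} {U : Set W} (hU : IsOpen U)
    (hh : ContMDiffOn I 𝓘(ℝ, F) ∞ h U) {x : W} (hx : x ∈ U)
    (hs : Function.Surjective (diffl I h x)) {T : Set F} {φ : W → G}
    (hφ : MDifferentiableAt I 𝓘(ℝ, G) φ x) (hT : ∀ᶠ z in 𝓝 x, h z ∈ T → φ z = 0)
    {v : TangentSpace I x} (hv : ∀ s : ℝ, 0 ≤ s → h x + s • diffl I h x v ∈ T) :
    diffl I φ x v = 0 := by
  obtain ⟨c, -, hc, hhc, hd⟩ := exists_curve_of_surjective (G := G) hU hh hx hs v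
  have h3 := (hd φ hφ).hasDerivWithinAt (s := Ici 0)
  have h : ∀ᶠ s : ℝ in 𝓝[≥] 0, φ (c s) = 0 := by
    filter_upwards [mem_nhdsWithin_of_mem_nhds hhc, mem_nhdsWithin_of_mem_nhds (hc hT),
      self_mem_nhdsWithin] with s h1 h2 h3
    refine h2 ?_
    rw [h1]
    exact hv s h3
  have h4 : HasDerivWithinAt (fun s => φ (c s)) 0 (Ici 0) 0 :=
    (hasDerivWithinAt_const (0 : ℝ) (Ici 0) (0 : G)).congr_of_eventuallyEq_of_mem h self_mem_Ici
  exact (uniqueDiffWithinAt_Ici (0 : ℝ)).eq_deriv _ h3 h4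

/-- A function that vanishes on a regular zero set of `h` near `x` has zero differential on the
kernel of `dh`: every vector there is the velocity of a curve in the zero set. -/
theorem diffl_eq_zero_of_zeroSet {h : W → F} {U : Set W} (hU : IsOpen U)
    (hh : ContMDiffOn I 𝓘(ℝ, F) ∞ h U) {x : W} (hx : x ∈ U) (hx0 : h x = 0)
    (hs : Function.Surjective (diffl I h x)) {φ : W → G}
    (hφ : MDifferentiableAt I 𝓘(ℝ, G) φ x) (hT : ∀ᶠ z in 𝓝 x, h z = 0 → φ z = 0)
    {v : TangentSpace I x} (hv : diffl I h x v = 0) : diffl I φ x v = 0 :=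
  diffl_eq_zero_of_preimage (T := {0}) hU hh hx hs hφ hT fun s _ => by simp [hx0, hv]

/-- At a boundary point, only the vectors pointing inwards are velocities of curves; the opposite
vectors follow by linearity. -/
theorem diffl_eq_zero_of_halfZeroSet {h : W → F} {ρ : W → ℝ} {U : Set W} (hU : IsOpen U)
    (hh : ContMDiffOn I 𝓘(ℝ, F) ∞ h U) (hρ : ContMDiffOn I 𝓘(ℝ, ℝ) ∞ ρ U)
    {x : W} (hx : x ∈ U) (hx0 : h x = 0) (hρ0 : ρ x = 0)
    (hs : Function.Surjective fun v => (diffl I h x v, diffl I ρ x v)) {φ : W → G}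
    (hφ : MDifferentiableAt I 𝓘(ℝ, G) φ x) (hT : ∀ᶠ z in 𝓝 x, h z = 0 → 0 ≤ ρ z → φ z = 0)
    {v : TangentSpace I x} (hv : diffl I h x v = 0) : diffl I φ x v = 0 := by
  have hd1 : MDifferentiableAt I 𝓘(ℝ, F) h x :=
    (hh.contMDiffAt (hU.mem_nhds hx)).mdifferentiableAt (by simp)
  have hd2 : MDifferentiableAt I 𝓘(ℝ, ℝ) ρ x :=
    (hρ.contMDiffAt (hU.mem_nhds hx)).mdifferentiableAt (by simp)
  have key : ∀ v : TangentSpace I x, diffl I h x v = 0 → 0 ≤ diffl I ρ x v →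
      diffl I φ x v = 0 := by
    intro v hv hv'
    refine diffl_eq_zero_of_preimage (h := fun z => (h z, ρ z)) (T := {y | y.1 = 0 ∧ 0 ≤ y.2}) hU
      (hh.prodMk_space hρ) hx ?_ hφ ?_ ?_
    · intro y
      obtain ⟨w, hw⟩ := hs y
      exact ⟨w, (diffl_prodMk hd1 hd2 w).trans hw⟩
    · filter_upwards [hT] with z hz h1 using hz h1.1 h1.2
    · intro s hs0
      rw [diffl_prodMk hd1 hd2]
      simp only [mem_ofPred_eq, Prod.fst_add, Prod.snd_add, Prod.smul_mk, hx0, hv, hρ0,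
        smul_zero, add_zero, zero_add, true_and, smul_eq_mul]
      exact mul_nonneg hs0 hv'
  rcases le_total 0 (diffl I ρ x v) with h0 | h0
  · exact key v hv h0
  · have := key (-v) (by rw [map_neg, hv, neg_zero]) (by rw [map_neg]; linarith)
    rwa [map_neg, neg_eq_zero] at this

variable (I) in
/-- `h = 0` is a local equation of `X` on the open set `U`, near the interior point `x` of `X`. -/
structure IsLocalEquation (p : ℕ) (X : Set W) (x : W) (U : Set W)
    (h : W → EuclideanSpace ℝ (Fin p)) : Prop where
  mem : x ∈ X
  isOpen : IsOpen U
  mem_open : x ∈ U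
  contMDiffOn : ContMDiffOn I (𝓡 p) ∞ h U
  surjective : Function.Surjective (diffl I h x)
  inter_eq : X ∩ U = {z ∈ U | h z = 0}

variable (I) in
/-- `h = 0`, `ρ ≥ 0` are local equations of `X` on the open set `U`, near the boundary point `x`
of `X`. -/
structure IsLocalHalfEquation (p : ℕ) (X : Set W) (x : W) (U : Set W)
    (h : W → EuclideanSpace ℝ (Fin p)) (ρ : W → ℝ) : Prop where
  mem : x ∈ X
  isOpen : IsOpen U
  mem_open : x ∈ U
  contMDiffOn : ContMDiffOn I (𝓡 p) ∞ h U
  contMDiffOn_rho : ContMDiffOn I 𝓘(ℝ, ℝ) ∞ ρ U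
  rho_eq : ρ x = 0
  surjective : Function.Surjective fun v => (diffl I h x v, diffl I ρ x v)
  inter_eq : X ∩ U = {z ∈ U | h z = 0 ∧ 0 ≤ ρ z}

variable {p : ℕ} {X : Set W} {x : W} {U : Set W} {h : W → EuclideanSpace ℝ (Fin p)} {ρ : W → ℝ}

omit [FiniteDimensional ℝ E] [I.Boundaryless] [IsManifold I ∞ W] in
theorem isInteriorPt_iff : IsInteriorPt I p X x ↔ ∃ U h, IsLocalEquation I p X x U h :=
  ⟨fun ⟨h1, U, h2, h3, h, h4, h5, h6⟩ => ⟨U, h, h1, h2, h3, h4, h5, h6⟩,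
    fun ⟨U, h, h1, h2, h3, h4, h5, h6⟩ => ⟨h1, U, h2, h3, h, h4, h5, h6⟩⟩

omit [FiniteDimensional ℝ E] [I.Boundaryless] [IsManifold I ∞ W] in
theorem isBoundaryPt_iff : IsBoundaryPt I p X x ↔ ∃ U h ρ, IsLocalHalfEquation I p X x U h ρ :=
  ⟨fun ⟨h1, U, h2, h3, h, ρ, h4, h5, h6, h7, h8⟩ => ⟨U, h, ρ, h1, h2, h3, h4, h5, h6, h7, h8⟩,
    fun ⟨U, h, ρ, h1, h2, h3, h4, h5, h6, h7, h8⟩ => ⟨h1, U, h2, h3, h, ρ, h4, h5, h6, h7, h8⟩⟩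

namespace IsLocalEquation

variable (hX : IsLocalEquation I p X x U h)
include hX

omit [FiniteDimensional ℝ E] [I.Boundaryless] [IsManifold I ∞ W] in
theorem mdifferentiableAt : MDifferentiableAt I (𝓡 p) h x :=
  (hX.contMDiffOn.contMDiffAt (hX.isOpen.mem_nhds hX.mem_open)).mdifferentiableAt (by simp)

omit [FiniteDimensional ℝ E] [I.Boundaryless] [IsManifold I ∞ W] in
theorem mem_iff {z : W} (hz : z ∈ U) : z ∈ X ↔ h z = 0 :=
  ⟨fun h1 => (hX.inter_eq.subset ⟨h1, hz⟩).2, fun h1 => (hX.inter_eq.superset ⟨hz, h1⟩).1⟩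

omit [FiniteDimensional ℝ E] [I.Boundaryless] [IsManifold I ∞ W] in
theorem apply_eq_zero : h x = 0 := (hX.mem_iff hX.mem_open).1 hX.mem

theorem diffl_eq_zero {φ : W → G} (hφ : MDifferentiableAt I 𝓘(ℝ, G) φ x)
    (hT : ∀ᶠ z in 𝓝 x, z ∈ X → φ z = 0) {v : TangentSpace I x} (hv : diffl I h x v = 0) :
    diffl I φ x v = 0 :=
  diffl_eq_zero_of_zeroSet hX.isOpen hX.contMDiffOn hX.mem_open hX.apply_eq_zero hX.surjective hφ
    (by
      filter_upwards [hT, hX.isOpen.mem_nhds hX.mem_open] with z h1 h2 h3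
      exact h1 ((hX.mem_iff h2).2 h3)) hv

end IsLocalEquation

namespace IsLocalHalfEquation

variable (hX : IsLocalHalfEquation I p X x U h ρ)
include hX

omit [FiniteDimensional ℝ E] [I.Boundaryless] [IsManifold I ∞ W] in
theorem mdifferentiableAt : MDifferentiableAt I (𝓡 p) h x :=
  (hX.contMDiffOn.contMDiffAt (hX.isOpen.mem_nhds hX.mem_open)).mdifferentiableAt (by simp)

omit [FiniteDimensional ℝ E] [I.Boundaryless] [IsManifold I ∞ W] in
theorem mem_iff {z : W} (hz : z ∈ U) : z ∈ X ↔ h z = 0 ∧ 0 ≤ ρ z :=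
  ⟨fun h1 => (hX.inter_eq.subset ⟨h1, hz⟩).2, fun h1 => (hX.inter_eq.superset ⟨hz, h1⟩).1⟩

omit [FiniteDimensional ℝ E] [I.Boundaryless] [IsManifold I ∞ W] in
theorem apply_eq_zero : h x = 0 := ((hX.mem_iff hX.mem_open).1 hX.mem).1

theorem diffl_eq_zero {φ : W → G} (hφ : MDifferentiableAt I 𝓘(ℝ, G) φ x)
    (hT : ∀ᶠ z in 𝓝 x, z ∈ X → φ z = 0) {v : TangentSpace I x} (hv : diffl I h x v = 0) :
    diffl I φ x v = 0 :=
  diffl_eq_zero_of_halfZeroSet hX.isOpen hX.contMDiffOn hX.contMDiffOn_rho hX.mem_open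
    hX.apply_eq_zero hX.rho_eq hX.surjective hφ
    (by
      filter_upwards [hT, hX.isOpen.mem_nhds hX.mem_open] with z h1 h2 h3 h4
      exact h1 ((hX.mem_iff h2).2 ⟨h3, h4⟩)) hv

end IsLocalHalfEquation

omit [FiniteDimensional ℝ E] [I.Boundaryless] [IsManifold I ∞ W] in
theorem mem_tangentSpaceOf_iff_of_diffl_eq_zero (hx : x ∈ U) (hU : IsOpen U)
    (hh : ContMDiffOn I (𝓡 p) ∞ h U) (h0 : ∀ z ∈ U, z ∈ X → h z = 0)
    (key : ∀ φ : W → ℝ, MDifferentiableAt I 𝓘(ℝ, ℝ) φ x → (∀ᶠ z in 𝓝 x, z ∈ X → φ z = 0) →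
      ∀ v : TangentSpace I x, diffl I h x v = 0 → diffl I φ x v = 0) (v : TangentSpace I x) :
    v ∈ tangentSpaceOf I X x ↔ diffl I h x v = 0 := by
  have hhx : ContMDiffAt I (𝓡 p) ∞ h x := hh.contMDiffAt (hU.mem_nhds hx)
  constructor
  · intro hv
    ext i
    let L : EuclideanSpace ℝ (Fin p) →L[ℝ] ℝ := EuclideanSpace.proj i
    have h1 := hv (fun z => L (h z)) (L.contDiff.contMDiff.contMDiffAt.comp x hhx) (by
      filter_upwards [self_mem_nhdsWithin, mem_nhdsWithin_of_mem_nhds (hU.mem_nhds hx)]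
        with z hz hzU
      rw [h0 z hzU hz, map_zero])
    exact (diffl_comp_continuousLinearMap (hhx.mdifferentiableAt (by simp)) L v).symm.trans h1
  · intro hv φ hφ hφ0
    exact key φ (hφ.mdifferentiableAt (by simp)) (eventually_nhdsWithin_iff.1 hφ0) v hv

theorem IsLocalEquation.mem_tangentSpaceOf_iff (hX : IsLocalEquation I p X x U h)
    (v : TangentSpace I x) : v ∈ tangentSpaceOf I X x ↔ diffl I h x v = 0 :=
  mem_tangentSpaceOf_iff_of_diffl_eq_zero hX.mem_open hX.isOpen hX.contMDiffOn
    (fun _ hz hzX => (hX.mem_iff hz).1 hzX) (fun _ hφ hT _ hv => hX.diffl_eq_zero hφ hT hv) v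

theorem IsLocalHalfEquation.mem_tangentSpaceOf_iff (hX : IsLocalHalfEquation I p X x U h ρ)
    (v : TangentSpace I x) : v ∈ tangentSpaceOf I X x ↔ diffl I h x v = 0 :=
  mem_tangentSpaceOf_iff_of_diffl_eq_zero hX.mem_open hX.isOpen hX.contMDiffOn
    (fun _ hz hzX => ((hX.mem_iff hz).1 hzX).1) (fun _ hφ hT _ hv => hX.diffl_eq_zero hφ hT hv) v

/-- A boundary point is not an interior point: a curve in `X` through an interior point, with
velocity pointing out of the half `ρ ≥ 0`, would leave `X`. -/
theorem IsBoundaryPt.not_isInteriorPt (hb : IsBoundaryPt I p X x) : ¬ IsInteriorPt I p X x := by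
  intro hi
  obtain ⟨U, k, hk⟩ := isInteriorPt_iff.1 hi
  obtain ⟨U', h, ρ, hh⟩ := isBoundaryPt_iff.1 hb
  obtain ⟨v, hv⟩ := hh.surjective (0, 1)
  have hv1 : diffl I h x v = 0 := congrArg Prod.fst hv
  have hv2 : diffl I ρ x v = 1 := congrArg Prod.snd hv
  have hkv : diffl I k x v = 0 := hh.diffl_eq_zero hk.mdifferentiableAt (by
    filter_upwards [hk.isOpen.mem_nhds hk.mem_open] with z h1 h2 using (hk.mem_iff h1).1 h2) hv1
  obtain ⟨c, hc0, hc, hkc, hd⟩ := exists_curve_of_surjective (G := ℝ) hk.isOpen hk.contMDiffOn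
    hk.mem_open hk.surjective v
  have hder := hd ρ ((hh.contMDiffOn_rho.contMDiffAt
    (hh.isOpen.mem_nhds hh.mem_open)).mdifferentiableAt (by simp))
  have hmin : IsLocalMin (fun s => ρ (c s)) 0 := by
    filter_upwards [hkc, hc (hk.isOpen.mem_nhds hk.mem_open),
      hc (hh.isOpen.mem_nhds hh.mem_open)] with s h1 h2 h3
    rw [hkv, smul_zero, add_zero, hk.apply_eq_zero] at h1
    rw [hc0, hh.rho_eq]
    exact ((hh.mem_iff h3).1 ((hk.mem_iff h2).2 h1)).2
  have := hmin.hasDerivAt_eq_zero hder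
  rw [hv2] at this
  exact one_ne_zero this

end LocalGeometry

/-! ### Global equations of framed submanifolds -/

section GlobalEquation

variable {E : Type*} [NormedAddCommGroup E] [NormedSpace ℝ E]
  {H : Type*} [TopologicalSpace H] {I : ModelWithCorners ℝ E H}
  {W : Type*} [TopologicalSpace W] [ChartedSpace H W]
  {F : Type*} [NormedAddCommGroup F] [NormedSpace ℝ F]
  {G : Type*} [NormedAddCommGroup G] [NormedSpace ℝ G]

theorem IsSmoothChart.diffl_fst_apply {h : W → F} {Ψ : OpenPartialHomeomorph W (F × G)}
    (hΨ : IsSmoothChart I Ψ) (hfst : ∀ z ∈ Ψ.source, (Ψ z).1 = h z) {z : W} (hz : z ∈ Ψ.source)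
    (v : TangentSpace I z) : diffl I h z v = (hΨ.tangentEquiv hz v).1 := by
  have h1 := diffl_comp_continuousLinearMap (hΨ.mdifferentiableAt hz)
    (ContinuousLinearMap.fst ℝ F G) v
  have h2 : (fun z => ContinuousLinearMap.fst ℝ F G (Ψ z)) =ᶠ[𝓝 z] h := by
    filter_upwards [Ψ.open_source.mem_nhds hz] with y hy using hfst y hy
  rw [diffl_congr h2] at h1
  exact h1

/-- Two submanifolds of the same codimension, one of which contains the other near a point, agree
near that point. In the coordinates `(h, q)` the function `k` vanishes for `h = 0`, and `∂k/∂h` is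
invertible, so that `k` does not vanish for small `h ≠ 0`. -/
theorem IsLocalEquation.eventually_mem_of_eq_zero [FiniteDimensional ℝ E] [I.Boundaryless]
    [IsManifold I ∞ W] {p : ℕ} {X : Set W} {x : W} {U : Set W} {h : W → EuclideanSpace ℝ (Fin p)}
    (hX : IsLocalEquation I p X x U h) {k : W → EuclideanSpace ℝ (Fin p)}
    (hk : ContMDiffAt I (𝓡 p) ∞ k x) (hk0 : ∀ᶠ z in 𝓝 x, z ∈ X → k z = 0)
    (hks : Function.Surjective (diffl I k x)) : ∀ᶠ z in 𝓝 x, k z = 0 → z ∈ X := by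
  obtain ⟨K, Ψ, hΨ, hxΨ, hΨU, hfst⟩ :=
    exists_straightening hX.isOpen hX.contMDiffOn hX.mem_open hX.surjective
  have hkd : MDifferentiableAt I (𝓡 p) k x := hk.mdifferentiableAt (by simp)
  set g := k ∘ Ψ.symm with hg
  have hgs : ContDiffAt ℝ ∞ g (Ψ x) := hΨ.contDiffAt_comp_symm hxΨ hk
  set A := fderiv ℝ g (Ψ x) with hA
  have hgA : HasStrictFDerivAt g A (Ψ x) := hgs.hasStrictFDerivAt (by simp)
  have hA0 : ∀ b : K, A (0, b) = 0 := by
    intro b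
    have h1 := hΨ.diffl_eq_fderiv hxΨ hkd ((hΨ.tangentEquiv hxΨ).symm (0, b))
    rw [ContinuousLinearEquiv.apply_symm_apply] at h1
    rw [hA, ← h1]
    refine hX.diffl_eq_zero hkd hk0 ?_
    rw [hΨ.diffl_fst_apply hfst hxΨ, ContinuousLinearEquiv.apply_symm_apply]
  set B : EuclideanSpace ℝ (Fin p) →ₗ[ℝ] EuclideanSpace ℝ (Fin p) :=
    (A : _ →ₗ[ℝ] _) ∘ₗ LinearMap.inl ℝ _ K with hB
  have hBs : Function.Surjective B := by
    intro y
    obtain ⟨v, hv⟩ := hks y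
    rw [hΨ.diffl_eq_fderiv hxΨ hkd] at hv
    refine ⟨(hΨ.tangentEquiv hxΨ v).1, ?_⟩
    have h1 : hΨ.tangentEquiv hxΨ v =
        ((hΨ.tangentEquiv hxΨ v).1, 0) + (0, (hΨ.tangentEquiv hxΨ v).2) := by simp
    rw [h1, map_add, ← hA, hA0, add_zero] at hv
    exact hv
  have hBi : Function.Injective B := LinearMap.injective_iff_surjective.2 hBs
  obtain ⟨c, hc, hcB⟩ := (LinearMap.toContinuousLinearMap B).exists_antilipschitzWith
    (LinearMap.ker_eq_bot.2 hBi)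
  have hcB' : ∀ a, ‖a‖ ≤ c * ‖A (a, 0)‖ := by
    intro a
    have := hcB.le_mul_norm_sub a 0
    rw [map_zero, add_zero, add_zero, norm_neg, norm_neg] at this
    exact this
  have hsm := hgA.isLittleO.def (c := (2 * (c : ℝ))⁻¹) (by positivity)
  -- compare `z` with the point of `X` that has the same second coordinate
  have hcont : Tendsto (fun z => ((0, (Ψ z).2) : EuclideanSpace ℝ (Fin p) × K)) (𝓝 x)
      (𝓝 (Ψ x)) := by
    have h1 : Ψ x = (0, (Ψ x).2) := Prod.ext ((hfst x hxΨ).trans hX.apply_eq_zero) rfl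
    conv_rhs => rw [h1]
    exact tendsto_const_nhds.prodMk_nhds
      ((continuous_snd.tendsto _).comp (Ψ.continuousAt hxΨ))
  have hcont2 : Tendsto (fun z => Ψ.symm (0, (Ψ z).2)) (𝓝 x) (𝓝 x) :=
    (Ψ.tendsto_symm hxΨ).comp hcont
  filter_upwards [((Ψ.continuousAt hxΨ).tendsto.prodMk_nhds hcont).eventually hsm,
    hcont2.eventually hk0, Ψ.open_source.mem_nhds hxΨ,
    hcont.eventually (Ψ.open_target.mem_nhds (Ψ.map_source hxΨ))] with z h1 h2 h3 h4 hkz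
  have h5 : Ψ.symm (0, (Ψ z).2) ∈ X := by
    refine (hX.mem_iff (hΨU (Ψ.map_target h4))).2 ?_
    rw [← hfst _ (Ψ.map_target h4), Ψ.right_inv h4]
  have h6 : g (Ψ z) = 0 := by rw [hg, Function.comp_apply, Ψ.left_inv h3, hkz]
  have h7 : g (0, (Ψ z).2) = 0 := h2 h5
  have h8 : Ψ z - (0, (Ψ z).2) = ((Ψ z).1, 0) := by ext <;> simp
  simp only [h6, h7, h8, sub_zero, zero_sub, norm_neg] at h1
  have h9 : ‖(((Ψ z).1, 0) : EuclideanSpace ℝ (Fin p) × K)‖ = ‖(Ψ z).1‖ := by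
    simp [Prod.norm_def]
  rw [h9] at h1
  have h10 := hcB' (Ψ z).1
  have hc' : (0 : ℝ) < c := hc
  have h11 : ‖(Ψ z).1‖ ≤ 2⁻¹ * ‖(Ψ z).1‖ := by
    refine h10.trans ((mul_le_mul_of_nonneg_left h1 hc'.le).trans_eq ?_)
    field_simp
  have h12 : (Ψ z).1 = 0 := norm_le_zero_iff.1 (by linarith [norm_nonneg (Ψ z).1])
  exact (hX.mem_iff (hΨU h3)).2 ((hfst z h3).symm.trans h12)

/-- Near each of its points a submanifold is a smooth retract. -/
theorem IsLocalEquation.exists_retraction [FiniteDimensional ℝ E] [I.Boundaryless]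
    [IsManifold I ∞ W] {p : ℕ} {X : Set W} {x : W} {U : Set W} {h : W → EuclideanSpace ℝ (Fin p)}
    (hX : IsLocalEquation I p X x U h) :
    ∃ (V : Set W) (r : W → W), IsOpen V ∧ x ∈ V ∧ V ⊆ U ∧ ContMDiffOn I I ∞ r V ∧
      ∀ z ∈ V, r z ∈ X ∧ r z ∈ U ∧ (z ∈ X → r z = z) := by
  obtain ⟨K, Ψ, hΨ, hxΨ, hΨU, hfst⟩ :=
    exists_straightening hX.isOpen hX.contMDiffOn hX.mem_open hX.surjective
  let P : EuclideanSpace ℝ (Fin p) × K →L[ℝ] EuclideanSpace ℝ (Fin p) × K :=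
    (0 : _ →L[ℝ] EuclideanSpace ℝ (Fin p)).prod (ContinuousLinearMap.snd ℝ _ K)
  have hP : ∀ y, P y = (0, y.2) := fun y => rfl
  have hr : ContMDiffOn I 𝓘(ℝ, EuclideanSpace ℝ (Fin p) × K) ∞ (fun z => P (Ψ z)) Ψ.source :=
    P.contDiff.contMDiff.comp_contMDiffOn hΨ.contMDiffOn
  have hXP : ∀ z ∈ Ψ.source, z ∈ X → P (Ψ z) = Ψ z := fun z hz hzX =>
    Prod.ext ((hfst z hz).trans ((hX.mem_iff (hΨU hz)).1 hzX)).symm rfl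
  refine ⟨Ψ.source ∩ (fun z => P (Ψ z)) ⁻¹' Ψ.target, fun z => Ψ.symm (P (Ψ z)),
    hr.continuousOn.isOpen_inter_preimage Ψ.open_source Ψ.open_target, ⟨hxΨ, ?_⟩,
    fun z hz => hΨU hz.1, ?_, fun z hz => ⟨?_, ?_, fun hzX => ?_⟩⟩
  · rw [mem_preimage, hXP x hxΨ hX.mem]
    exact Ψ.map_source hxΨ
  · exact hΨ.contMDiffOn_symm.comp (hr.mono inter_subset_left) fun z hz => hz.2
  · refine (hX.mem_iff (hΨU (Ψ.map_target hz.2))).2 ?_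
    rw [← hfst _ (Ψ.map_target hz.2), Ψ.right_inv hz.2]
    rfl
  · exact hΨU (Ψ.map_target hz.2)
  · change Ψ.symm (P (Ψ z)) = z
    rw [hXP z hz.1 hzX, Ψ.left_inv hz.1]

/-- The derivative of a smooth map along a smooth vector field over `σ` is smooth. -/
theorem contMDiffOn_diffl_section {E' : Type*} [NormedAddCommGroup E'] [NormedSpace ℝ E']
    {H' : Type*} [TopologicalSpace H'] {I' : ModelWithCorners ℝ E' H'}
    {W' : Type*} [TopologicalSpace W'] [ChartedSpace H' W'] [IsManifold I 1 W]
    {h : W → F} {U : Set W} (hU : IsOpen U) (hh : ContMDiffOn I 𝓘(ℝ, F) ∞ h U)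
    {V : Set W'} {σ : W' → W} {ξ : ∀ y, TangentSpace I (σ y)}
    (hξ : ContMDiffOn I' I.tangent ∞ (fun y => (⟨σ y, ξ y⟩ : TangentBundle I W)) V)
    (hσ : MapsTo σ V U) :
    ContMDiffOn I' 𝓘(ℝ, F) ∞ (fun y => diffl I h (σ y) (ξ y)) V := by
  have h1 := hh.contMDiffOn_tangentMapWithin (m := ∞) (by simp) hU.uniqueMDiffOn
  have h2 := (contMDiff_snd_tangentBundle_modelSpace F 𝓘(ℝ, F) (n := ∞)).comp_contMDiffOn
    (h1.comp hξ fun y hy => hσ hy)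
  refine h2.congr fun y hy => ?_
  have h3 : mfderivWithin I 𝓘(ℝ, F) h U (σ y) = mfderiv I 𝓘(ℝ, F) h (σ y) :=
    mfderivWithin_of_isOpen hU (hσ hy)
  exact (congrArg (fun L : TangentSpace I (σ y) →L[ℝ] F => L (ξ y)) h3).symm

/-- The Leibniz rule at a zero of the second factor. -/
theorem diffl_clm_apply_of_eq_zero [I.Boundaryless] [IsManifold I ∞ W] {L : W → F →L[ℝ] G}
    {h : W → F} {z : W} (hL : MDifferentiableAt I 𝓘(ℝ, F →L[ℝ] G) L z)
    (hh : MDifferentiableAt I 𝓘(ℝ, F) h z) (h0 : h z = 0) :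
    MDifferentiableAt I 𝓘(ℝ, G) (fun y => L y (h y)) z ∧
    ∀ v, diffl I (fun y => L y (h y)) z v = L z (diffl I h z v) := by
  obtain ⟨C, hC, hzC⟩ := exists_isSmoothChart I z
  have hm : MDifferentiableAt I 𝓘(ℝ, G) (fun y => L y (h y)) z := by
    have h1 : MDifferentiableAt I 𝓘(ℝ, (F →L[ℝ] G) × F) (fun y => (L y, h y)) z :=
      hL.prodMk_space hh
    have h2 : Differentiable ℝ fun q : (F →L[ℝ] G) × F => q.1 q.2 :=
      differentiable_fst.clm_apply differentiable_snd
    exact (h2 _).mdifferentiableAt.comp z h1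
  refine ⟨hm, fun v => ?_⟩
  rw [hC.diffl_eq_fderiv hzC hm, hC.diffl_eq_fderiv hzC hh]
  have hsymm := hC.mdifferentiableAt_symm (C.map_source hzC)
  have hL' : DifferentiableAt ℝ (L ∘ C.symm) (C z) := by
    rw [← mdifferentiableAt_iff_differentiableAt]
    refine MDifferentiableAt.comp (C z) ?_ hsymm
    rwa [C.left_inv hzC]
  have hh' : DifferentiableAt ℝ (h ∘ C.symm) (C z) := by
    rw [← mdifferentiableAt_iff_differentiableAt]
    refine MDifferentiableAt.comp (C z) ?_ hsymm
    rwa [C.left_inv hzC]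
  have h3 := hL'.hasFDerivAt.clm_apply hh'.hasFDerivAt
  have h4 : (fun y => L y (h y)) ∘ C.symm = fun y => (L ∘ C.symm) y ((h ∘ C.symm) y) := rfl
  rw [h4, h3.fderiv]
  simp [C.left_inv hzC, h0]

theorem diffl_sum {ι : Type*} (t : Finset ι) {f : ι → W → F} {z : W}
    (hf : ∀ i ∈ t, MDifferentiableAt I 𝓘(ℝ, F) (f i) z) :
    MDifferentiableAt I 𝓘(ℝ, F) (fun y => ∑ i ∈ t, f i y) z ∧
    ∀ v, diffl I (fun y => ∑ i ∈ t, f i y) z v = ∑ i ∈ t, diffl I (f i) z v := by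
  classical
  induction t using Finset.induction_on with
  | empty =>
    refine ⟨by simpa using mdifferentiableAt_const, fun v => ?_⟩
    simp only [Finset.sum_empty]
    have : mfderiv I 𝓘(ℝ, F) (fun _ : W => (0 : F)) z = 0 := mfderiv_const
    exact congrArg (fun L : TangentSpace I z →L[ℝ] F => L v) this
  | insert a t ha ih =>
    obtain ⟨ih1, ih2⟩ := ih fun i hi => hf i (Finset.mem_insert_of_mem hi)
    have h1 := hf a (Finset.mem_insert_self a t)
    simp only [Finset.sum_insert ha]
    refine ⟨h1.add ih1, fun v => ?_⟩
    rw [← ih2]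
    exact congrArg (fun L : TangentSpace I z →L[ℝ] F => L v) (mfderiv_add h1 ih1)

variable [FiniteDimensional ℝ E] [I.Boundaryless] [IsManifold I ∞ W] {p : ℕ}

/-- The fields `ν¹, …, ν^p` along `Z` are smooth and independent modulo the tangent spaces of `Z`:
a framing of `Z` without reference to a metric. -/
structure IsTransverseFraming (Z : Set W) (ν : Fin p → ∀ x : W, TangentSpace I x) : Prop where
  smooth : ∀ i, ContMDiffOn I I.tangent ∞ (fun x => (⟨x, ν i x⟩ : TangentBundle I W)) Z
  transverse : ∀ x ∈ Z, ∀ c : Fin p → ℝ, ∑ i, c i • ν i x ∈ tangentSpaceOf I Z x → c = 0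

/-- A framed submanifold has, near each of its points, an equation for which the framing is sent to
the standard basis. It is obtained from an arbitrary equation `h` by multiplication with the inverse
of the matrix `dh(ν)`, extended off the submanifold by a retraction. -/
theorem exists_local_framedEquation {Z : Set W} (hZ : IsSubmanifold I p Z)
    {ν : Fin p → ∀ x : W, TangentSpace I x} (hν : IsTransverseFraming Z ν) {x : W} (hx : x ∈ Z) :
    ∃ (V : Set W) (k : W → EuclideanSpace ℝ (Fin p)), IsOpen V ∧ x ∈ V ∧
      ContMDiffOn I (𝓡 p) ∞ k V ∧
      ∀ z ∈ Z ∩ V, k z = 0 ∧ ∀ i, diffl I k z (ν i z) = EuclideanSpace.single i 1 := by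
  obtain ⟨U, h, hX⟩ := isInteriorPt_iff.1 (hZ x hx)
  obtain ⟨V₀, r, hV₀, hxV₀, hV₀U, hr, hrV⟩ := hX.exists_retraction
  let M : W → EuclideanSpace ℝ (Fin p) →L[ℝ] EuclideanSpace ℝ (Fin p) := fun z =>
    ∑ i, (EuclideanSpace.proj (𝕜 := ℝ) i).smulRight (diffl I h (r z) (ν i (r z)))
  have hMapply : ∀ z i, M z (EuclideanSpace.single i 1) = diffl I h (r z) (ν i (r z)) := by
    intro z i
    simp [M, PiLp.single_apply]
  have hMs : ContMDiffOn I 𝓘(ℝ, EuclideanSpace ℝ (Fin p) →L[ℝ] EuclideanSpace ℝ (Fin p)) ∞ M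
      V₀ := by
    have h1 : ∀ i, ContMDiffOn I (𝓡 p) ∞ (fun z => diffl I h (r z) (ν i (r z))) V₀ := fun i =>
      contMDiffOn_diffl_section (ξ := fun z => ν i (r z)) hX.isOpen hX.contMDiffOn
        ((hν.smooth i).comp hr fun z hz => (hrV z hz).1) fun z hz => (hrV z hz).2.1
    refine contMDiffOn_finsetSum fun i _ => ?_
    exact (ContinuousLinearMap.smulRightL ℝ (EuclideanSpace ℝ (Fin p)) (EuclideanSpace ℝ (Fin p))
      (EuclideanSpace.proj (𝕜 := ℝ) i)).contDiff.contMDiff.comp_contMDiffOn (h1 i)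
  have hMx : (M x).IsInvertible := by
    have hrx : r x = x := (hrV x hxV₀).2.2 hx
    let M' : EuclideanSpace ℝ (Fin p) →ₗ[ℝ] EuclideanSpace ℝ (Fin p) := M x
    have hinj : Function.Injective M' := by
      rw [injective_iff_map_eq_zero]
      intro c hc
      have h1 : M x c = diffl I h x (∑ i, c i • ν i x) := by
        simp only [M]
        rw [hrx]
        simp [map_sum]
      have h2 := hν.transverse x hx (fun i => c i)
        ((hX.mem_tangentSpaceOf_iff _).2 (h1.symm.trans hc))
      ext i
      exact congrFun h2 i
    let e := LinearEquiv.ofBijective M' ⟨hinj, LinearMap.injective_iff_surjective.1 hinj⟩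
    exact ⟨e.toContinuousLinearEquiv, by ext v; rfl⟩
  let V : Set W := V₀ ∩ M ⁻¹' (range ((↑) : (EuclideanSpace ℝ (Fin p) ≃L[ℝ]
    EuclideanSpace ℝ (Fin p)) → (EuclideanSpace ℝ (Fin p) →L[ℝ] EuclideanSpace ℝ (Fin p))))
  have hV : IsOpen V :=
    hMs.continuousOn.isOpen_inter_preimage hV₀ ContinuousLinearEquiv.isOpen
  have hinv : ContMDiffOn I 𝓘(ℝ, EuclideanSpace ℝ (Fin p) →L[ℝ] EuclideanSpace ℝ (Fin p)) ∞
      (fun z => (M z).inverse) V := by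
    intro z hz
    have h1 : (M z).IsInvertible := hz.2
    exact h1.contDiffAt_map_inverse.contMDiffAt.comp_contMDiffWithinAt z
      ((hMs z hz.1).mono inter_subset_left)
  refine ⟨V, fun z => (M z).inverse (h z), hV, ⟨hxV₀, hMx⟩, ?_, ?_⟩
  · exact hinv.clm_apply (hX.contMDiffOn.mono fun z hz => hV₀U hz.1)
  · rintro z ⟨hzZ, hzV⟩
    have hh0 : h z = 0 := (hX.mem_iff (hV₀U hzV.1)).1 hzZ
    refine ⟨by simp [hh0], fun i => ?_⟩
    have hrz : r z = z := (hrV z hzV.1).2.2 hzZ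
    have hMi : (M z).IsInvertible := hzV.2
    rw [(diffl_clm_apply_of_eq_zero
      ((hinv.contMDiffAt (hV.mem_nhds hzV)).mdifferentiableAt (by simp))
      ((hX.contMDiffOn.contMDiffAt (hX.isOpen.mem_nhds (hV₀U hzV.1))).mdifferentiableAt (by simp))
      hh0).2]
    have h1 := hMapply z i
    rw [hrz] at h1
    rw [← h1]
    exact hMi.inverse_apply_self _

/-- The local equations of a closed framed submanifold add up, by a partition of unity, to a global
function that vanishes on it and sends the framing to the standard basis. -/
theorem exists_global_framedEquation [T2Space W] [SigmaCompactSpace W] {Z : Set W}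
    (hZc : IsClosed Z) (hZ : IsSubmanifold I p Z)
    {ν : Fin p → ∀ x : W, TangentSpace I x} (hν : IsTransverseFraming Z ν) :
    ∃ k : W → EuclideanSpace ℝ (Fin p), ContMDiff I (𝓡 p) ∞ k ∧
      ∀ z ∈ Z, k z = 0 ∧ ∀ i, diffl I k z (ν i z) = EuclideanSpace.single i 1 := by
  have hloc : ∀ x : Z, _ := fun x => exists_local_framedEquation hZ hν x.2
  choose V k hV hxV hk hkν using hloc
  obtain ⟨f, hf⟩ := SmoothPartitionOfUnity.exists_isSubordinate I hZc V hV
    fun x hx => mem_iUnion.2 ⟨⟨x, hx⟩, hxV ⟨x, hx⟩⟩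
  have hks : ∀ i, ∀ x ∈ tsupport (f i), ContMDiffAt I (𝓡 p) ∞ (k i) x := fun i x hx =>
    (hk i).contMDiffAt ((hV i).mem_nhds (hf i hx))
  refine ⟨fun x => ∑ᶠ i, f i x • k i x, f.contMDiff_finsum_smul (n := ⊤) hks, fun z hz => ?_⟩
  have hval : (fun x => ∑ᶠ i, f i x • k i x) =ᶠ[𝓝 z]
      fun x => ∑ i ∈ f.fintsupport z, f i x • k i x := by
    filter_upwards [f.eventually_finsupport_subset z] with y hy
    rw [← f.sum_finsupport_smul_eq_finsum]
    refine Finset.sum_subset hy fun i _ hi => ?_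
    have : f i y = 0 := by simpa [f.mem_finsupport] using hi
    rw [this, zero_smul]
  have hmem : ∀ i ∈ f.fintsupport z, z ∈ Z ∩ V i := fun i hi =>
    ⟨hz, hf i ((f.mem_fintsupport_iff z i).1 hi)⟩
  have hterm : ∀ i ∈ f.fintsupport z, MDifferentiableAt I (𝓡 p) (fun x => f i x • k i x) z ∧
      ∀ v, diffl I (fun x => f i x • k i x) z v = f i z • diffl I (k i) z v := by
    intro i hi
    have h1 : MDifferentiableAt I 𝓘(ℝ, ℝ) (f i) z := (f i).contMDiff.mdifferentiableAt (by simp)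
    let Λ : ℝ →L[ℝ] EuclideanSpace ℝ (Fin p) →L[ℝ] EuclideanSpace ℝ (Fin p) :=
      ContinuousLinearMap.lsmul ℝ ℝ
    have h2 : MDifferentiableAt I 𝓘(ℝ, EuclideanSpace ℝ (Fin p) →L[ℝ] EuclideanSpace ℝ (Fin p))
        (fun x => Λ (f i x)) z := (Λ.differentiableAt).mdifferentiableAt.comp z h1
    exact diffl_clm_apply_of_eq_zero h2 ((hks i z ((f.mem_fintsupport_iff z i).1 hi)).mdifferentiableAt
      (by simp)) (hkν i z (hmem i hi)).1
  constructor
  · rw [hval.self_of_nhds]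
    exact Finset.sum_eq_zero fun i hi => by rw [(hkν i z (hmem i hi)).1, smul_zero]
  · intro j
    rw [diffl_congr hval, (diffl_sum _ fun i hi => (hterm i hi).1).2,
      Finset.sum_congr rfl fun i hi => (hterm i hi).2 (ν j z),
      Finset.sum_congr rfl fun i hi => congrArg _ ((hkν i z (hmem i hi)).2 j), ← Finset.sum_smul,
      f.sum_finsupport' z hz (f.finsupport_subset_fintsupport z), one_smul]

theorem surjective_of_apply_eq_single {V : Type*} [AddCommGroup V] [Module ℝ V]
    [TopologicalSpace V] {A : V →L[ℝ] EuclideanSpace ℝ (Fin p)} {v : Fin p → V}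
    (h : ∀ i, A (v i) = EuclideanSpace.single i 1) : Function.Surjective A := by
  intro y
  refine ⟨∑ i, y i • v i, ?_⟩
  simp only [map_sum, map_smul, h]
  ext j
  simp [Pi.single_apply]

omit [I.Boundaryless] in
/-- A smooth function that equals `1` on `Z` and `-1` away from a neighbourhood `V` of `Z`. -/
theorem exists_contMDiff_one_neg_one [T2Space W] [SigmaCompactSpace W] {Z V : Set W}
    (hZ : IsClosed Z) (hV : IsOpen V) (hZV : Z ⊆ V) :
    ∃ b : W → ℝ, ContMDiff I 𝓘(ℝ, ℝ) ∞ b ∧ (∀ z ∈ Z, b z = 1) ∧ ∀ z ∉ V, b z = -1 := by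
  obtain ⟨f, hf0, hf1, -⟩ := exists_contMDiffMap_zero_one_of_isClosed I (n := ⊤) hZ
    hV.isClosed_compl (disjoint_compl_right_iff_subset.2 hZV)
  have hc : ContDiff ℝ ∞ fun s : ℝ => 1 - 2 * s := by fun_prop
  refine ⟨fun z => 1 - 2 * f z, hc.contMDiff.comp f.contMDiff, fun z hz => ?_, fun z hz => ?_⟩
  · simp [hf0 hz]
  · have : f z = 1 := hf1 hz
    simp only [this]; norm_num

/-- The zero set of a function as in `exists_global_framedEquation` is `Z` near `Z`. -/
theorem exists_isOpen_zeroSet_subset {Z : Set W} (hZ : IsSubmanifold I p Z)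
    {k : W → EuclideanSpace ℝ (Fin p)} (hk : ContMDiff I (𝓡 p) ∞ k) (hk0 : ∀ z ∈ Z, k z = 0)
    (hks : ∀ z ∈ Z, Function.Surjective (diffl I k z)) :
    ∃ V : Set W, IsOpen V ∧ Z ⊆ V ∧ ∀ z ∈ V, k z = 0 → z ∈ Z := by
  refine ⟨interior {z | k z = 0 → z ∈ Z}, isOpen_interior, fun z hz => ?_,
    fun z hz => interior_subset hz⟩
  obtain ⟨U, h, hX⟩ := isInteriorPt_iff.1 (hZ z hz)
  exact mem_interior_iff_mem_nhds.2
    (hX.eventually_mem_of_eq_zero hk.contMDiffAt (Eventually.of_forall hk0) (hks z hz))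

end GlobalEquation

/-! ### Normal framings -/

section NormalFraming

variable {E : Type*} [NormedAddCommGroup E] [NormedSpace ℝ E]
  {H : Type*} [TopologicalSpace H] {I : ModelWithCorners ℝ E H}
  {W : Type*} [TopologicalSpace W] [ChartedSpace H W] [IsManifold I ∞ W]
  {F : Type*} [NormedAddCommGroup F] [NormedSpace ℝ F]
  {G : Type*} [NormedAddCommGroup G] [NormedSpace ℝ G]

/-- A smooth positive definite family of bilinear forms on the tangent spaces of `W`; smoothness is
tested on smooth vector fields. -/
structure IsSmoothMetric (ip : ∀ x : W, TangentSpace I x →L[ℝ] TangentSpace I x →L[ℝ] ℝ) :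
    Prop where
  pos : ∀ x (v : TangentSpace I x), v ≠ 0 → 0 < ip x v v
  smooth : ∀ (x₀ : W) (σ τ : ∀ x : W, TangentSpace I x),
    ContMDiffAt I I.tangent ∞ (fun x => (⟨x, σ x⟩ : TangentBundle I W)) x₀ →
    ContMDiffAt I I.tangent ∞ (fun x => (⟨x, τ x⟩ : TangentBundle I W)) x₀ →
    ContMDiffAt I 𝓘(ℝ, ℝ) ∞ (fun x => ip x (σ x) (τ x)) x₀

omit [IsManifold I ∞ W] in
theorem contMDiffAt_clm_of_apply [FiniteDimensional ℝ F] {L : W → F →L[ℝ] G} {x : W}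
    (hL : ∀ v, ContMDiffAt I 𝓘(ℝ, G) ∞ (fun z => L z v) x) :
    ContMDiffAt I 𝓘(ℝ, F →L[ℝ] G) ∞ L x := by
  let b := Module.finBasis ℝ F
  let c : Fin (Module.finrank ℝ F) → F →L[ℝ] ℝ := fun i =>
    LinearMap.toContinuousLinearMap (b.coord i)
  have h1 : L = fun z => ∑ i, (c i).smulRight (L z (b i)) := by
    ext z v
    have h := congrArg (L z) (b.sum_repr v)
    rw [map_sum] at h
    simp only [map_smul] at h
    simpa [c] using h.symm
  rw [h1]
  refine ContMDiffAt.sum fun i _ => ?_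
  exact ((ContinuousLinearMap.smulRightL ℝ F G (c i)).contDiff.contMDiff.contMDiffAt).comp x
    (hL (b i))

variable {ip : ∀ x : W, TangentSpace I x →L[ℝ] TangentSpace I x →L[ℝ] ℝ}
  (hip : IsSmoothMetric ip)
include hip

/-- A vector orthogonal to the kernel of `dh` is determined by its image under `dh`. -/
theorem IsSmoothMetric.eq_of_normal {h : W → F} {z : W} {u u' : TangentSpace I z}
    (hu : ∀ v, diffl I h z v = 0 → ip z v u = 0) (hu' : ∀ v, diffl I h z v = 0 → ip z v u' = 0)
    (he : diffl I h z u = diffl I h z u') : u = u' := by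
  by_contra hne
  have h1 : diffl I h z (u - u') = 0 := by rw [map_sub, he, sub_self]
  have h2 := hip.pos z (u - u') (sub_ne_zero.2 hne)
  have h3 := map_sub (ip z (u - u')) u u'
  rw [hu _ h1, hu' _ h1, sub_zero] at h3
  exact h2.ne' h3

variable [FiniteDimensional ℝ E] [FiniteDimensional ℝ F]

/-- The vector field `u` orthogonal to `ker dh` with `dh(u) = b` solves, together with a Lagrange
multiplier `lam`, the linear system `⟨·, u⟩ = lam ∘ dh`, `dh(u) = b`; hence it is smooth. -/
theorem IsSmoothMetric.exists_local_normalLift {U : Set W} (hU : IsOpen U) {h : W → F}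
    (hh : ContMDiffOn I 𝓘(ℝ, F) ∞ h U) {x : W} (hx : x ∈ U)
    (hs : Function.Surjective (diffl I h x)) (b : F) :
    ∃ u : ∀ z : W, TangentSpace I z,
      ContMDiffAt I I.tangent ∞ (fun z => (⟨z, u z⟩ : TangentBundle I W)) x ∧
      ∀ᶠ z in 𝓝 x, diffl I h z (u z) = b ∧ ∀ v, diffl I h z v = 0 → ip z v (u z) = 0 := by
  let e := trivializationAt E (TangentSpace I : W → Type _) x
  have hxe : x ∈ e.baseSet := FiberBundle.mem_baseSet_trivializationAt' x
  let S : ∀ z : W, E →L[ℝ] TangentSpace I z := fun z => e.symmL ℝ z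
  have hSsurj : ∀ z ∈ e.baseSet, ∀ v : TangentSpace I z, ∃ w, S z w = v := fun z hz v =>
    ⟨e.continuousLinearMapAt ℝ z v, e.symmL_continuousLinearMapAt hz v⟩
  have hSinj : ∀ z ∈ e.baseSet, ∀ w, S z w = 0 → w = 0 := fun z hz w hw => by
    have := e.continuousLinearMapAt_symmL (R := ℝ) hz w
    rw [← this]
    change e.continuousLinearMapAt ℝ z (S z w) = 0
    rw [hw, map_zero]
  have hSc : ∀ c : W → E, ContMDiffAt I 𝓘(ℝ, E) ∞ c x →
      ContMDiffAt I I.tangent ∞ (fun z => (⟨z, S z (c z)⟩ : TangentBundle I W)) x := by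
    intro c hc
    refine (contMDiffAt_section x).2 (hc.congr_of_eventuallyEq ?_)
    filter_upwards [e.open_baseSet.mem_nhds hxe] with z hz
    have h1 : S z (c z) = e.symm z (c z) := e.symmL_apply hz (c z)
    change (e ⟨z, S z (c z)⟩).2 = c z
    rw [h1, e.apply_mk_symm hz]
  have hdiff : ∀ c : E, ContMDiffAt I 𝓘(ℝ, F) ∞ (fun z => diffl I h z (S z c)) x := by
    intro c
    have h1 := hSc (fun _ => c) contMDiffAt_const
    have h2 := hh.contMDiffOn_tangentMapWithin (m := ∞) (by simp) hU.uniqueMDiffOn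
    have h3 := (contMDiff_snd_tangentBundle_modelSpace F 𝓘(ℝ, F) (n := ∞)).comp_contMDiffOn h2
    have h4 := (h3.contMDiffAt (x := ⟨x, S x c⟩) ((hU.preimage
      (FiberBundle.continuous_proj E _)).mem_nhds hx)).comp x h1
    refine h4.congr_of_eventuallyEq ?_
    filter_upwards [hU.mem_nhds hx] with z hz
    have h5 : mfderivWithin I 𝓘(ℝ, F) h U z = mfderiv I 𝓘(ℝ, F) h z := mfderivWithin_of_isOpen hU hz
    exact (congrArg (fun L : TangentSpace I z →L[ℝ] F => L (S z c)) h5).symm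
  -- the linear system in the trivialization
  let D := E × (F →L[ℝ] ℝ)
  let T := (E →L[ℝ] ℝ) × F
  let ip' : W → E →L[ℝ] E →L[ℝ] ℝ := fun z =>
    (ContinuousLinearMap.precomp ℝ (S z)).comp ((ip z).comp (S z))
  let B : W → E →L[ℝ] E →L[ℝ] ℝ := fun z => (ip' z).flip
  have hB : ∀ z c w, B z c w = ip z (S z w) (S z c) := fun z c w => rfl
  let A : W → E →L[ℝ] F := fun z => (diffl I h z).comp (S z)
  let Λ : W → D →L[ℝ] T := fun z =>
    ((B z).comp (ContinuousLinearMap.fst ℝ _ _) -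
      ((ContinuousLinearMap.compL ℝ E F ℝ).flip (A z)).comp (ContinuousLinearMap.snd ℝ _ _)).prod
    ((A z).comp (ContinuousLinearMap.fst ℝ _ _))
  have hΛ : ∀ z c lam, Λ z (c, lam) = (B z c - lam.comp (A z), A z c) := fun z c lam => rfl
  have hΛs : ContMDiffAt I 𝓘(ℝ, D →L[ℝ] T) ∞ Λ x := by
    refine contMDiffAt_clm_of_apply fun ⟨c, lam⟩ => ?_
    simp only [hΛ]
    refine ContMDiffAt.prodMk_space (contMDiffAt_clm_of_apply fun w => ?_) (hdiff c)
    have h1 := hip.smooth x (fun z => S z w) (fun z => S z c) (hSc _ contMDiffAt_const)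
      (hSc _ contMDiffAt_const)
    exact h1.sub (lam.contDiff.contMDiff.contMDiffAt.comp x (hdiff w))
  have hΛx : (Λ x).IsInvertible := by
    let Λ' : D →ₗ[ℝ] T := Λ x
    have hinj : Function.Injective Λ' := by
      rw [injective_iff_map_eq_zero]
      rintro ⟨c, lam⟩ hc
      have hc1 : B x c - lam.comp (A x) = 0 := congrArg Prod.fst hc
      have hc2 : A x c = 0 := congrArg Prod.snd hc
      have hc3 : B x c c = 0 := by
        have := congrArg (fun L : E →L[ℝ] ℝ => L c) hc1
        simpa [hc2] using this
      have hc0 : c = 0 := by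
        refine hSinj x hxe c ?_
        by_contra hne
        exact (hip.pos x _ hne).ne' hc3
      have hlam : lam = 0 := by
        ext y
        obtain ⟨v, rfl⟩ := hs y
        obtain ⟨w, rfl⟩ := hSsurj x hxe v
        have := congrArg (fun L : E →L[ℝ] ℝ => L w) hc1
        simp only [hc0, map_zero, zero_sub] at this
        simpa [A] using this
      rw [hc0, hlam]; rfl
    have hdim : Module.finrank ℝ D = Module.finrank ℝ T := by
      have h1 : Module.finrank ℝ (E →L[ℝ] ℝ) = Module.finrank ℝ E := by
        rw [← (LinearMap.toContinuousLinearMap : (E →ₗ[ℝ] ℝ) ≃ₗ[ℝ] E →L[ℝ] ℝ).finrank_eq]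
        exact Subspace.dual_finrank_eq
      have h2 : Module.finrank ℝ (F →L[ℝ] ℝ) = Module.finrank ℝ F := by
        rw [← (LinearMap.toContinuousLinearMap : (F →ₗ[ℝ] ℝ) ≃ₗ[ℝ] F →L[ℝ] ℝ).finrank_eq]
        exact Subspace.dual_finrank_eq
      rw [Module.finrank_prod, Module.finrank_prod, h1, h2]
    let e' := LinearEquiv.ofInjectiveOfFinrankEq Λ' hinj hdim
    exact ⟨e'.toContinuousLinearEquiv, by ext v <;> rfl⟩
  have := FiniteDimensional.complete ℝ E
  have hinv : ContMDiffAt I 𝓘(ℝ, T →L[ℝ] D) ∞ (fun z => (Λ z).inverse) x :=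
    hΛx.contDiffAt_map_inverse.contMDiffAt.comp x hΛs
  let q : W → D := fun z => (Λ z).inverse (0, b)
  have hq : ContMDiffAt I 𝓘(ℝ, D) ∞ q x := hinv.clm_apply contMDiffAt_const
  refine ⟨fun z => S z (q z).1, hSc _
    ((ContinuousLinearMap.fst ℝ E (F →L[ℝ] ℝ)).contDiff.contMDiff.contMDiffAt.comp x hq), ?_⟩
  have hopen : ∀ᶠ z in 𝓝 x, (Λ z).IsInvertible := by
    have h1 : IsOpen (range ((↑) : (D ≃L[ℝ] T) → (D →L[ℝ] T))) := ContinuousLinearEquiv.isOpen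
    exact hΛs.continuousAt.eventually_mem (h1.mem_nhds hΛx)
  filter_upwards [hopen, e.open_baseSet.mem_nhds hxe] with z hz hze
  have h1 : Λ z ((q z).1, (q z).2) = (0, b) := hz.self_apply_inverse _
  rw [hΛ] at h1
  have h2 : B z (q z).1 - (q z).2.comp (A z) = 0 := congrArg Prod.fst h1
  have h3 : A z (q z).1 = b := congrArg Prod.snd h1
  refine ⟨h3, fun v hv => ?_⟩
  obtain ⟨w, rfl⟩ := hSsurj z hze v
  have h4 := congrArg (fun L : E →L[ℝ] ℝ => L w) h2
  have h5 : A z w = 0 := hv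
  simpa [h5, hB] using h4

/-- On a set where `dh` is onto, the normal lift of a vector `b` through `dh` is a smooth field. -/
theorem IsSmoothMetric.exists_normalLift {U : Set W} (hU : IsOpen U) {h : W → F}
    (hh : ContMDiffOn I 𝓘(ℝ, F) ∞ h U) {X : Set W} (hXU : X ⊆ U)
    (hs : ∀ x ∈ X, Function.Surjective (diffl I h x)) (b : F) :
    ∃ u : ∀ z : W, TangentSpace I z,
      (∀ x ∈ X, ContMDiffAt I I.tangent ∞ (fun z => (⟨z, u z⟩ : TangentBundle I W)) x) ∧
      ∀ x ∈ X, diffl I h x (u x) = b ∧ ∀ v, diffl I h x v = 0 → ip x v (u x) = 0 := by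
  classical
  let P : ∀ z : W, TangentSpace I z → Prop := fun z u =>
    diffl I h z u = b ∧ ∀ v, diffl I h z v = 0 → ip z v u = 0
  let u : ∀ z : W, TangentSpace I z := fun z => if hz : ∃ u, P z u then hz.choose else 0
  have hu : ∀ z (w : TangentSpace I z), P z w → u z = w := by
    intro z w hw
    have hz : ∃ u, P z u := ⟨w, hw⟩
    have h1 : u z = hz.choose := dif_pos hz
    rw [h1]
    exact hip.eq_of_normal hz.choose_spec.2 hw.2 (hz.choose_spec.1.trans hw.1.symm)
  refine ⟨u, fun x hx => ?_, fun x hx => ?_⟩ <;>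
    obtain ⟨u', hu', hP⟩ := hip.exists_local_normalLift hU hh (hXU hx) (hs x hx) b
  · refine hu'.congr_of_eventuallyEq ?_
    filter_upwards [hP] with z hz
    rw [hu z _ hz]
  · rw [hu x _ hP.self_of_nhds]
    exact hP.self_of_nhds

/-- If `X` has global equation `h` (in the sense that `ker dh` is its tangent space), then every
basis of `F` lifts to a framing of `X`. -/
theorem IsSmoothMetric.exists_isFraming {U : Set W} (hU : IsOpen U) {h : W → F}
    (hh : ContMDiffOn I 𝓘(ℝ, F) ∞ h U) {X : Set W} (hXU : X ⊆ U)
    (hs : ∀ x ∈ X, Function.Surjective (diffl I h x))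
    (htan : ∀ x ∈ X, ∀ v, v ∈ tangentSpaceOf I X x ↔ diffl I h x v = 0)
    {p : ℕ} (b : Module.Basis (Fin p) ℝ F) :
    ∃ ν : Fin p → ∀ z : W, TangentSpace I z, IsFraming ip X ν ∧
      ∀ x ∈ X, ∀ i, diffl I h x (ν i x) = b i := by
  choose ν hν1 hν2 using fun i => hip.exists_normalLift hU hh hXU hs (b i)
  refine ⟨ν, ⟨fun i x hx => (hν1 i x hx).contMDiffWithinAt, fun x hx => ?_, fun x hx => ?_⟩,
    fun x hx i => (hν2 i x hx).1⟩
  · refine LinearIndependent.of_comp (diffl I h x : TangentSpace I x →ₗ[ℝ] F) ?_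
    convert b.linearIndependent using 1
    ext i
    exact (hν2 i x hx).1
  · apply le_antisymm
    · rw [Submodule.span_le]
      rintro _ ⟨i, rfl⟩ v hv
      exact (hν2 i x hx).2 v ((htan x hx v).1 hv)
    · intro w hw
      have h1 : w = ∑ i, b.repr (diffl I h x w) i • ν i x := by
        refine hip.eq_of_normal (h := h) (fun v hv => hw v ((htan x hx v).2 hv)) ?_ ?_
        · intro v hv
          simp only [map_sum, map_smul]
          exact Finset.sum_eq_zero fun i _ => by rw [(hν2 i x hx).2 v hv, smul_zero]
        · simp only [map_sum, map_smul, (hν2 _ x hx).1]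
          exact (b.sum_repr _).symm
      rw [h1]
      exact Submodule.sum_mem _ fun i _ =>
        Submodule.smul_mem _ _ (Submodule.subset_span ⟨i, rfl⟩)

omit [FiniteDimensional ℝ E] in
theorem IsFraming.sum_smul_eq_zero {X : Set W} {p : ℕ} {ν : Fin p → ∀ z : W, TangentSpace I z}
    (hν : IsFraming ip X ν) {x : W} (hx : x ∈ X) {c : Fin p → ℝ}
    (hc : ∑ i, c i • ν i x ∈ tangentSpaceOf I X x) : c = 0 := by
  have h1 : ∑ i, c i • ν i x ∈ normalSpace ip X x := by
    rw [← hν.span_eq x hx]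
    exact Submodule.sum_mem _ fun i _ =>
      Submodule.smul_mem _ _ (Submodule.subset_span ⟨i, rfl⟩)
  have h2 : ∑ i, c i • ν i x = 0 := by
    by_contra hne
    exact (hip.pos x _ hne).ne' (h1 _ hc)
  exact funext fun i => Fintype.linearIndependent_iff.1 (hν.linearIndependent x hx) c h2 i

omit [FiniteDimensional ℝ E] in
theorem IsFraming.isTransverseFraming {X : Set W} {p : ℕ}
    {ν : Fin p → ∀ z : W, TangentSpace I z} (hν : IsFraming ip X ν) : IsTransverseFraming X ν :=
  ⟨hν.smooth, fun _ hx _ hc => hν.sum_smul_eq_zero hip hx hc⟩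

end NormalFraming

/-! ### The metrics of `M` and of `M × ℝ` -/

section Metrics

variable {n : ℕ} {M : Type*} [TopologicalSpace M] [ChartedSpace (EuclideanSpace ℝ (Fin n)) M]
  [IsManifold (𝓡 n) ∞ M] (g : ContMDiffRiemannianMetric (𝓡 n) ∞ (EuclideanSpace ℝ (Fin n))
      (fun x : M => TangentSpace (𝓡 n) x))

theorem contMDiffAt_inner_along {E' : Type*} [NormedAddCommGroup E'] [NormedSpace ℝ E']
    {H' : Type*} [TopologicalSpace H'] {I' : ModelWithCorners ℝ E' H'}
    {W' : Type*} [TopologicalSpace W'] [ChartedSpace H' W'] {b : W' → M} {x₀ : W'}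
    {σ τ : ∀ y : W', TangentSpace (𝓡 n) (b y)}
    (hσ : ContMDiffAt I' (𝓡 n).tangent ∞ (fun y => (⟨b y, σ y⟩ : TangentBundle (𝓡 n) M)) x₀)
    (hτ : ContMDiffAt I' (𝓡 n).tangent ∞ (fun y => (⟨b y, τ y⟩ : TangentBundle (𝓡 n) M)) x₀) :
    ContMDiffAt I' 𝓘(ℝ, ℝ) ∞ (fun y => g.inner (b y) (σ y) (τ y)) x₀ := by
  have hb : ContMDiffAt I' (𝓡 n) ∞ b x₀ :=
    (contMDiff_proj (TangentSpace (𝓡 n) : M → Type _)).contMDiffAt.comp x₀ hσ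
  have h1 : ContMDiffAt I' ((𝓡 n).prod 𝓘(ℝ, EuclideanSpace ℝ (Fin n) →L[ℝ]
      EuclideanSpace ℝ (Fin n) →L[ℝ] ℝ)) ∞
      (fun y => TotalSpace.mk' (EuclideanSpace ℝ (Fin n) →L[ℝ] EuclideanSpace ℝ (Fin n) →L[ℝ] ℝ)
        (E := fun x : M => TangentSpace (𝓡 n) x →L[ℝ] TangentSpace (𝓡 n) x →L[ℝ] ℝ)
        (b y) (g.inner (b y))) x₀ :=
    g.contMDiff.contMDiffAt.comp x₀ hb
  have h2 := ContMDiffAt.clm_bundle_apply₂ (F₃ := ℝ) (E₃ := Bundle.Trivial M ℝ) h1 hσ hτ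
  exact (contMDiffAt_totalSpace.1 h2).2

theorem isSmoothMetric_inner : IsSmoothMetric (I := 𝓡 n) g.inner :=
  ⟨fun x v hv => g.pos x v hv, fun _ _ _ hσ hτ => contMDiffAt_inner_along g hσ hτ⟩

theorem prodMetric_apply (z : M × ℝ) (v w : TangentSpace ((𝓡 n).prod 𝓘(ℝ, ℝ)) z) :
    prodMetric g z v w = g.inner z.1 (show EuclideanSpace ℝ (Fin n) × ℝ from v).1
        (show EuclideanSpace ℝ (Fin n) × ℝ from w).1 +
      (show EuclideanSpace ℝ (Fin n) × ℝ from v).2 *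
        (show EuclideanSpace ℝ (Fin n) × ℝ from w).2 := rfl

theorem isSmoothMetric_prodMetric : IsSmoothMetric (prodMetric g) := by
  constructor
  · intro z v hv
    rw [prodMetric_apply]
    set a := (show EuclideanSpace ℝ (Fin n) × ℝ from v).1
    set s := (show EuclideanSpace ℝ (Fin n) × ℝ from v).2
    have ha : 0 ≤ g.inner z.1 a a := by
      rcases eq_or_ne a 0 with h | h
      · exact (congrArg (fun L : EuclideanSpace ℝ (Fin n) →L[ℝ] ℝ => L a)
          ((congrArg (g.inner z.1) h).trans (map_zero (g.inner z.1)))).ge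
      · exact (g.pos z.1 a h).le
    rcases eq_or_ne a 0 with h | h
    · have hs : s ≠ 0 := fun hs => hv (Prod.ext h hs)
      have : 0 < s * s := mul_self_pos.2 hs
      linarith
    · have := g.pos z.1 a h
      have := mul_self_nonneg s
      linarith
  · intro z₀ σ τ hσ hτ
    have hfst : ∀ σ : ∀ z : M × ℝ, TangentSpace ((𝓡 n).prod 𝓘(ℝ, ℝ)) z,
        ContMDiffAt ((𝓡 n).prod 𝓘(ℝ, ℝ)) ((𝓡 n).prod 𝓘(ℝ, ℝ)).tangent ∞
          (fun z => (⟨z, σ z⟩ : TangentBundle ((𝓡 n).prod 𝓘(ℝ, ℝ)) (M × ℝ))) z₀ →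
        ContMDiffAt ((𝓡 n).prod 𝓘(ℝ, ℝ)) (𝓡 n).tangent ∞ (fun z : M × ℝ => (⟨z.1,
          (show EuclideanSpace ℝ (Fin n) × ℝ from σ z).1⟩ : TangentBundle (𝓡 n) M)) z₀ := by
      intro σ hσ
      have h1 : ContMDiff ((𝓡 n).prod 𝓘(ℝ, ℝ)).tangent (𝓡 n).tangent ∞
          (tangentMap ((𝓡 n).prod 𝓘(ℝ, ℝ)) (𝓡 n) (Prod.fst : M × ℝ → M)) :=
        contMDiff_fst.contMDiff_tangentMap (n := ∞) (by simp)
      refine (h1.contMDiffAt.comp z₀ hσ).congr_of_eventuallyEq (Eventually.of_forall fun z => ?_)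
      have h2 : mfderiv ((𝓡 n).prod 𝓘(ℝ, ℝ)) (𝓡 n) (Prod.fst : M × ℝ → M) z =
        ContinuousLinearMap.fst ℝ (TangentSpace (𝓡 n) z.1) (TangentSpace 𝓘(ℝ, ℝ) z.2) :=
        mfderiv_fst
      exact congrArg (fun w : TangentSpace (𝓡 n) z.1 => (⟨z.1, w⟩ : TangentBundle (𝓡 n) M))
        (congrArg (fun L : EuclideanSpace ℝ (Fin n) × ℝ →L[ℝ] EuclideanSpace ℝ (Fin n) =>
          L (σ z)) h2).symm
    have hsnd : ∀ σ : ∀ z : M × ℝ, TangentSpace ((𝓡 n).prod 𝓘(ℝ, ℝ)) z,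
        ContMDiffAt ((𝓡 n).prod 𝓘(ℝ, ℝ)) ((𝓡 n).prod 𝓘(ℝ, ℝ)).tangent ∞
          (fun z => (⟨z, σ z⟩ : TangentBundle ((𝓡 n).prod 𝓘(ℝ, ℝ)) (M × ℝ))) z₀ →
        ContMDiffAt ((𝓡 n).prod 𝓘(ℝ, ℝ)) 𝓘(ℝ, ℝ) ∞
          (fun z : M × ℝ => (show EuclideanSpace ℝ (Fin n) × ℝ from σ z).2) z₀ := by
      intro σ hσ
      have h1 : ContMDiff ((𝓡 n).prod 𝓘(ℝ, ℝ)).tangent (𝓘(ℝ, ℝ)).tangent ∞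
          (tangentMap ((𝓡 n).prod 𝓘(ℝ, ℝ)) 𝓘(ℝ, ℝ) (Prod.snd : M × ℝ → ℝ)) :=
        contMDiff_snd.contMDiff_tangentMap (n := ∞) (by simp)
      refine (((contMDiff_snd_tangentBundle_modelSpace ℝ 𝓘(ℝ, ℝ) (n := ∞)).comp
        h1).contMDiffAt.comp z₀ hσ).congr_of_eventuallyEq (Eventually.of_forall fun z => ?_)
      have h2 : mfderiv ((𝓡 n).prod 𝓘(ℝ, ℝ)) 𝓘(ℝ, ℝ) (Prod.snd : M × ℝ → ℝ) z =
        ContinuousLinearMap.snd ℝ (TangentSpace (𝓡 n) z.1) (TangentSpace 𝓘(ℝ, ℝ) z.2) :=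
        mfderiv_snd
      exact (congrArg (fun L : EuclideanSpace ℝ (Fin n) × ℝ →L[ℝ] ℝ => L (σ z)) h2).symm
    simp only [prodMetric_apply]
    exact (contMDiffAt_inner_along g (hfst σ hσ) (hfst τ hτ)).add
      ((hsnd σ hσ).mul (hsnd τ hτ))

end Metrics

/-! ### Coordinates on the sphere -/

section Sphere

variable {p : ℕ}

/-- The projection `(v⁰, v¹, …, v^p) ↦ (v¹, …, v^p)`. -/
noncomputable def tailL (p : ℕ) :
    EuclideanSpace ℝ (Fin (p + 1)) →L[ℝ] EuclideanSpace ℝ (Fin p) :=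
  LinearMap.toContinuousLinearMap
    { toFun := fun v => WithLp.toLp 2 fun i => v i.succ
      map_add' := fun _ _ => rfl
      map_smul' := fun _ _ => rfl }

/-- The vector `(b, π¹, …, π^p)`. -/
noncomputable def consL (p : ℕ) :
    ℝ × EuclideanSpace ℝ (Fin p) →L[ℝ] EuclideanSpace ℝ (Fin (p + 1)) :=
  LinearMap.toContinuousLinearMap
    { toFun := fun q => WithLp.toLp 2 (Fin.cons q.1 q.2)
      map_add' := fun a b => by
        ext i
        refine Fin.cases ?_ (fun i => ?_) i <;> simp
      map_smul' := fun c a => by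
        ext i
        refine Fin.cases ?_ (fun i => ?_) i <;> simp }

@[simp] theorem tailL_apply (v : EuclideanSpace ℝ (Fin (p + 1))) (i : Fin p) :
    tailL p v i = v i.succ := rfl

@[simp] theorem consL_zero (b : ℝ) (q : EuclideanSpace ℝ (Fin p)) : consL p (b, q) 0 = b := rfl

@[simp] theorem tailL_consL (b : ℝ) (q : EuclideanSpace ℝ (Fin p)) :
    tailL p (consL p (b, q)) = q := by
  ext i
  rfl

theorem consL_head_tail (v : EuclideanSpace ℝ (Fin (p + 1))) : consL p (v 0, tailL p v) = v := by
  ext i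
  refine Fin.cases ?_ (fun i => ?_) i <;> rfl

theorem ext_head_tail {v w : EuclideanSpace ℝ (Fin (p + 1))} (h0 : v 0 = w 0)
    (ht : tailL p v = tailL p w) : v = w := by
  rw [← consL_head_tail v, ← consL_head_tail w, h0, ht]

theorem norm_sq_eq_head_tail (v : EuclideanSpace ℝ (Fin (p + 1))) :
    ‖v‖ ^ 2 = v 0 ^ 2 + ‖tailL p v‖ ^ 2 := by
  rw [EuclideanSpace.real_norm_sq_eq, EuclideanSpace.real_norm_sq_eq, Fin.sum_univ_succ]
  rfl

@[simp] theorem tailL_single_zero : tailL p (EuclideanSpace.single 0 1) = 0 := by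
  ext i
  simp

@[simp] theorem tailL_single_succ (i : Fin p) :
    tailL p (EuclideanSpace.single i.succ 1) = EuclideanSpace.single i 1 := by
  ext j
  simp

/-- The point `(1, 0, …, 0)` of `S^p`. -/
noncomputable def north (p : ℕ) : Sph p := ⟨EuclideanSpace.single 0 1, by simp⟩

theorem Sph.norm_eq (y : Sph p) : ‖(y : EuclideanSpace ℝ (Fin (p + 1)))‖ = 1 := by
  simp

theorem Sph.ne_zero (y : Sph p) : (y : EuclideanSpace ℝ (Fin (p + 1))) ≠ 0 := by
  intro h
  have := y.norm_eq
  simp [h] at this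

/-- The radial projection `v ↦ v / |v|` to the sphere, with an irrelevant value at `0`. -/
noncomputable def normalize (v : EuclideanSpace ℝ (Fin (p + 1))) : Sph p :=
  if h : v = 0 then north p else ⟨‖v‖⁻¹ • v, by simp [norm_smul, h]⟩

theorem coe_normalize {v : EuclideanSpace ℝ (Fin (p + 1))} (h : v ≠ 0) :
    (normalize v : EuclideanSpace ℝ (Fin (p + 1))) = ‖v‖⁻¹ • v := by
  rw [normalize, dif_neg h]

theorem normalize_coe (y : Sph p) : normalize (y : EuclideanSpace ℝ (Fin (p + 1))) = y := by
  apply Subtype.ext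
  rw [coe_normalize y.ne_zero, y.norm_eq, inv_one, one_smul]

theorem normalize_smul {v : EuclideanSpace ℝ (Fin (p + 1))} {c : ℝ} (hc : 0 < c) :
    normalize (c • v) = normalize v := by
  rcases eq_or_ne v 0 with rfl | h
  · simp
  · apply Subtype.ext
    rw [coe_normalize (smul_ne_zero hc.ne' h), coe_normalize h, norm_smul, Real.norm_of_nonneg hc.le,
      smul_smul]
    congr 1
    have : ‖v‖ ≠ 0 := norm_ne_zero_iff.2 h
    field_simp

theorem normalize_eq_north_iff {v : EuclideanSpace ℝ (Fin (p + 1))} (h : v ≠ 0) :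
    normalize v = north p ↔ tailL p v = 0 ∧ 0 < v 0 := by
  have hn : 0 < ‖v‖ := norm_pos_iff.2 h
  constructor
  · intro hv
    have h1 : v = ‖v‖ • EuclideanSpace.single 0 1 := by
      have h2 := coe_normalize h
      rw [hv] at h2
      change EuclideanSpace.single 0 1 = _ at h2
      rw [h2, smul_smul, mul_inv_cancel₀ hn.ne', one_smul]
    constructor
    · rw [h1, map_smul, tailL_single_zero, smul_zero]
    · rw [h1]
      simpa using h
  · rintro ⟨h1, h2⟩
    have h3 : v = v 0 • EuclideanSpace.single 0 1 :=
      ext_head_tail (by simp) (by rw [h1, map_smul, tailL_single_zero, smul_zero])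
    rw [h3, normalize_smul h2]
    exact normalize_coe (north p)

theorem eq_north_iff {y : Sph p} :
    y = north p ↔ tailL p (y : EuclideanSpace ℝ (Fin (p + 1))) = 0 ∧
      0 < (y : EuclideanSpace ℝ (Fin (p + 1))) 0 := by
  rw [← normalize_eq_north_iff y.ne_zero, normalize_coe]

variable {E : Type*} [NormedAddCommGroup E] [NormedSpace ℝ E]
  {H : Type*} [TopologicalSpace H] {I : ModelWithCorners ℝ E H}
  {W : Type*} [TopologicalSpace W] [ChartedSpace H W]

theorem contMDiff_coe_comp {G : W → Sph p} (hG : ContMDiff I (𝓡 p) ∞ G) :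
    ContMDiff I 𝓘(ℝ, EuclideanSpace ℝ (Fin (p + 1))) ∞
      fun z => (G z : EuclideanSpace ℝ (Fin (p + 1))) := by
  have : Fact (Module.finrank ℝ (EuclideanSpace ℝ (Fin (p + 1))) = p + 1) := ⟨by simp⟩
  exact contMDiff_coe_sphere.comp hG

theorem contMDiff_normalize [IsManifold I ∞ W] {G : W → EuclideanSpace ℝ (Fin (p + 1))}
    (hG : ContMDiff I 𝓘(ℝ, EuclideanSpace ℝ (Fin (p + 1))) ∞ G) (h0 : ∀ z, G z ≠ 0) :
    ContMDiff I (𝓡 p) ∞ fun z => normalize (G z) := by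
  have h1 : ContMDiff I 𝓘(ℝ, EuclideanSpace ℝ (Fin (p + 1))) ∞ fun z => ‖G z‖⁻¹ • G z := by
    intro z
    have h2 : ContDiffAt ℝ ∞ (fun v : EuclideanSpace ℝ (Fin (p + 1)) => ‖v‖⁻¹ • v) (G z) :=
      ((contDiffAt_norm ℝ (h0 z)).inv (norm_ne_zero_iff.2 (h0 z))).smul contDiffAt_id
    exact h2.contMDiffAt.comp z (hG z)
  have : Fact (Module.finrank ℝ (EuclideanSpace ℝ (Fin (p + 1))) = p + 1) := ⟨by simp⟩
  have h3 := h1.codRestrict_sphere (n := p) fun z => by simp [norm_smul, h0 z]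
  have h4 : (fun z => normalize (G z)) = codRestrict (fun z => ‖G z‖⁻¹ • G z) _
      fun z => by simp [norm_smul, h0 z] := funext fun z => Subtype.ext (coe_normalize (h0 z))
  rw [h4]
  exact h3

/-- Normalization does not change the derivative of the tail at a point where the tail vanishes and
the vector has length one. -/
theorem diffl_tail_normalize [FiniteDimensional ℝ E] [I.Boundaryless] [IsManifold I ∞ W]
    {G : W → EuclideanSpace ℝ (Fin (p + 1))}
    (hG : ContMDiff I 𝓘(ℝ, EuclideanSpace ℝ (Fin (p + 1))) ∞ G) (h0 : ∀ z, G z ≠ 0) {z : W}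
    (hz : tailL p (G z) = 0) (hn : ‖G z‖ = 1) (v : TangentSpace I z) :
    diffl I (fun z => tailL p (normalize (G z) : EuclideanSpace ℝ (Fin (p + 1)))) z v =
      diffl I (fun z => tailL p (G z)) z v := by
  let L : W → EuclideanSpace ℝ (Fin p) →L[ℝ] EuclideanSpace ℝ (Fin p) := fun z =>
    ‖G z‖⁻¹ • ContinuousLinearMap.id ℝ _
  have hL : MDifferentiableAt I 𝓘(ℝ, EuclideanSpace ℝ (Fin p) →L[ℝ] EuclideanSpace ℝ (Fin p)) L z := by
    have h2 : DifferentiableAt ℝ (fun v : EuclideanSpace ℝ (Fin (p + 1)) =>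
        ‖v‖⁻¹ • ContinuousLinearMap.id ℝ (EuclideanSpace ℝ (Fin p))) (G z) :=
      (((contDiffAt_norm ℝ (h0 z)).differentiableAt (n := ∞) (by simp)).inv
        (norm_ne_zero_iff.2 (h0 z))).smul_const _
    exact h2.mdifferentiableAt.comp z ((hG z).mdifferentiableAt (by simp))
  have ht : MDifferentiableAt I (𝓡 p) (fun z => tailL p (G z)) z :=
    ((tailL p).contDiff.contMDiff.comp hG z).mdifferentiableAt (by simp)
  have h1 := (diffl_clm_apply_of_eq_zero hL ht hz).2 v
  have h2 : (fun y => L y (tailL p (G y))) =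
      fun z => tailL p (normalize (G z) : EuclideanSpace ℝ (Fin (p + 1))) := by
    funext y
    rw [coe_normalize (h0 y), map_smul]
    rfl
  rw [h2] at h1
  rw [h1]
  simp [L, hn]

end Sphere

/-! ### Smooth homotopies -/

section Homotopy

variable {n : ℕ} {M : Type*} [TopologicalSpace M] [ChartedSpace (EuclideanSpace ℝ (Fin n)) M]
  {p : ℕ}

local notation "IR" => ModelWithCorners.prod (𝓡 n) 𝓘(ℝ, ℝ)

theorem contMDiff_prod_reparam {c : ℝ → ℝ} (hc : ContDiff ℝ ∞ c) :
    ContMDiff IR IR ∞ fun z : M × ℝ => (z.1, c z.2) :=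
  contMDiff_fst.prodMk (hc.contMDiff.comp contMDiff_snd)

theorem contMDiff_slice (t : ℝ) : ContMDiff (𝓡 n) IR ∞ fun x : M => (x, t) :=
  contMDiff_id.prodMk contMDiff_const

/-- A smooth homotopy may be assumed to be defined for all times and to be constant near its ends. -/
theorem SmoothHomotopic.exists_extension {f₀ f₁ : C^∞⟮𝓡 n, M; 𝓡 p, Sph p⟯}
    (h : SmoothHomotopic f₀ f₁) : ∃ F : M × ℝ → Sph p, ContMDiff IR (𝓡 p) ∞ F ∧
      (∀ x, ∀ t ≤ 1 / 3, F (x, t) = f₀ x) ∧ ∀ x, ∀ t ≥ 2 / 3, F (x, t) = f₁ x := by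
  obtain ⟨F, hF, h0, h1⟩ := h
  let c : ℝ → ℝ := fun t => Real.smoothTransition (3 * t - 1)
  have hc : ContDiff ℝ ∞ c := Real.smoothTransition.contDiff.comp (by fun_prop)
  refine ⟨fun z => F (z.1, c z.2), ?_, fun x t ht => ?_, fun x t ht => ?_⟩
  · exact contMDiffOn_univ.1 (hF.comp (contMDiff_prod_reparam hc).contMDiffOn fun z _ =>
      ⟨mem_univ _, Real.smoothTransition.nonneg _, Real.smoothTransition.le_one _⟩)
  · have : c t = 0 := Real.smoothTransition.zero_of_nonpos (by linarith)
    simp only [this, h0]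
  · have : c t = 1 := Real.smoothTransition.one_of_one_le (by linarith)
    simp only [this, h1]

theorem SmoothHomotopic.refl (f : C^∞⟮𝓡 n, M; 𝓡 p, Sph p⟯) : SmoothHomotopic f f :=
  ⟨fun z => f z.1, (f.contMDiff.comp contMDiff_fst).contMDiffOn, fun _ => rfl, fun _ => rfl⟩

theorem SmoothHomotopic.symm {f₀ f₁ : C^∞⟮𝓡 n, M; 𝓡 p, Sph p⟯} (h : SmoothHomotopic f₀ f₁) :
    SmoothHomotopic f₁ f₀ := by
  obtain ⟨F, hF, h0, h1⟩ := h.exists_extension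
  have hc : ContDiff ℝ ∞ fun t : ℝ => 1 - t := by fun_prop
  refine ⟨fun z => F (z.1, 1 - z.2), (hF.comp (contMDiff_prod_reparam hc)).contMDiffOn,
    fun x => h1 x _ (by norm_num), fun x => h0 x _ (by norm_num)⟩

theorem SmoothHomotopic.trans {f₀ f₁ f₂ : C^∞⟮𝓡 n, M; 𝓡 p, Sph p⟯} (h : SmoothHomotopic f₀ f₁)
    (h' : SmoothHomotopic f₁ f₂) : SmoothHomotopic f₀ f₂ := by
  obtain ⟨F, hF, hF0, hF1⟩ := h.exists_extension
  obtain ⟨F', hF', hF0', hF1'⟩ := h'.exists_extension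
  have hc : ContDiff ℝ ∞ fun t : ℝ => 2 * t := by fun_prop
  have hc' : ContDiff ℝ ∞ fun t : ℝ => 2 * t - 1 := by fun_prop
  have h1 := hF.comp (contMDiff_prod_reparam (n := n) (M := M) hc)
  have h2 := hF'.comp (contMDiff_prod_reparam (n := n) (M := M) hc')
  let K : M × ℝ → Sph p := fun z => if z.2 ≤ 1 / 2 then F (z.1, 2 * z.2) else F' (z.1, 2 * z.2 - 1)
  have hK1 : ∀ z : M × ℝ, z.2 < 2 / 3 → K z = F (z.1, 2 * z.2) := by
    intro z hz
    by_cases h : z.2 ≤ 1 / 2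
    · exact if_pos h
    · simp only [K, if_neg h]
      rw [hF0' _ _ (by linarith), hF1 _ _ (by linarith)]
  have hK2 : ∀ z : M × ℝ, 1 / 3 < z.2 → K z = F' (z.1, 2 * z.2 - 1) := by
    intro z hz
    by_cases h : z.2 ≤ 1 / 2
    · simp only [K, if_pos h]
      rw [hF0' _ _ (by linarith), hF1 _ _ (by linarith)]
    · exact if_neg h
  refine ⟨K, ?_, fun x => ?_, fun x => ?_⟩
  · refine ContMDiff.contMDiffOn fun z => ?_
    rcases lt_or_ge z.2 (2 / 3) with hz | hz
    · refine (h1 z).congr_of_eventuallyEq ?_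
      filter_upwards [continuous_snd.continuousAt.eventually_lt_const hz] with y hy using hK1 y hy
    · refine (h2 z).congr_of_eventuallyEq ?_
      filter_upwards [continuous_snd.continuousAt.eventually_const_lt
        (show (1 / 3 : ℝ) < z.2 by linarith)] with y hy using hK2 y hy
  · rw [hK1 _ (by norm_num)]; exact hF0 _ _ (by norm_num)
  · rw [hK2 _ (by norm_num)]; exact hF1' _ _ (by norm_num)

theorem equivalence_smoothHomotopic :
    Equivalence (SmoothHomotopic (n := n) (M := M) (p := p)) :=
  ⟨.refl, .symm, .trans⟩

variable [IsManifold (𝓡 n) ∞ M]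

/-- A homotopy of maps to `ℝ^(p+1) \ {0}` yields a homotopy of maps to the sphere. -/
theorem smoothHomotopic_of_normalize {G : M × ℝ → EuclideanSpace ℝ (Fin (p + 1))}
    (hG : ContMDiff IR 𝓘(ℝ, EuclideanSpace ℝ (Fin (p + 1))) ∞ G)
    (h0 : ∀ x, ∀ t ∈ Icc (0 : ℝ) 1, G (x, t) ≠ 0) {f₀ f₁ : C^∞⟮𝓡 n, M; 𝓡 p, Sph p⟯}
    (hf₀ : ∀ x, f₀ x = normalize (G (x, 0))) (hf₁ : ∀ x, f₁ x = normalize (G (x, 1))) :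
    SmoothHomotopic f₀ f₁ := by
  have hs : ContDiff ℝ ∞ Real.smoothTransition := Real.smoothTransition.contDiff
  refine ⟨fun z => normalize (G (z.1, Real.smoothTransition z.2)),
    (contMDiff_normalize (hG.comp (contMDiff_prod_reparam hs)) fun z => h0 _ _
      ⟨Real.smoothTransition.nonneg _, Real.smoothTransition.le_one _⟩).contMDiffOn,
    fun x => ?_, fun x => ?_⟩
  · simp [hf₀]
  · simp [hf₁]

/-- Nowhere opposite maps to `ℝ^(p+1) \ {0}` are homotopic. -/
theorem smoothHomotopic_of_segment {G₀ G₁ : M → EuclideanSpace ℝ (Fin (p + 1))}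
    (hG₀ : ContMDiff (𝓡 n) 𝓘(ℝ, EuclideanSpace ℝ (Fin (p + 1))) ∞ G₀)
    (hG₁ : ContMDiff (𝓡 n) 𝓘(ℝ, EuclideanSpace ℝ (Fin (p + 1))) ∞ G₁)
    (h0 : ∀ x, ∀ t ∈ Icc (0 : ℝ) 1, (1 - t) • G₀ x + t • G₁ x ≠ 0)
    {f₀ f₁ : C^∞⟮𝓡 n, M; 𝓡 p, Sph p⟯}
    (hf₀ : ∀ x, f₀ x = normalize (G₀ x)) (hf₁ : ∀ x, f₁ x = normalize (G₁ x)) :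
    SmoothHomotopic f₀ f₁ := by
  have hc : ContDiff ℝ ∞ fun t : ℝ => 1 - t := by fun_prop
  refine smoothHomotopic_of_normalize (G := fun z => (1 - z.2) • G₀ z.1 + z.2 • G₁ z.1) ?_ h0
    (fun x => by simp [hf₀]) fun x => by simp [hf₁]
  exact ((hc.contMDiff.comp contMDiff_snd).smul (hG₀.comp contMDiff_fst)).add
    (contMDiff_snd.smul (hG₁.comp contMDiff_fst))

end Homotopy

/-! ### Submanifolds and differentials in a product with a line -/

section ProductLine

variable {n : ℕ} {M : Type*} [TopologicalSpace M] [ChartedSpace (EuclideanSpace ℝ (Fin n)) M]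
  {F : Type*} [NormedAddCommGroup F] [NormedSpace ℝ F] {p : ℕ}

local notation "IR" => ModelWithCorners.prod (𝓡 n) 𝓘(ℝ, ℝ)

theorem diffl_comp_fst {φ : M → F} {z : M × ℝ} (hφ : MDifferentiableAt (𝓡 n) 𝓘(ℝ, F) φ z.1)
    (v : TangentSpace IR z) :
    diffl IR (fun y : M × ℝ => φ y.1) z v =
      diffl (𝓡 n) φ z.1 (show EuclideanSpace ℝ (Fin n) × ℝ from v).1 := by
  have h1 := mfderiv_comp_apply z hφ (mdifferentiableAt_fst (I := 𝓡 n) (I' := 𝓘(ℝ, ℝ))) v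
  refine h1.trans ?_
  rw [mfderiv_fst]
  rfl

theorem diffl_snd (z : M × ℝ) (v : TangentSpace IR z) :
    diffl IR (fun y : M × ℝ => y.2) z v = (show EuclideanSpace ℝ (Fin n) × ℝ from v).2 := by
  have h2 : mfderiv IR 𝓘(ℝ, ℝ) (Prod.snd : M × ℝ → ℝ) z =
    ContinuousLinearMap.snd ℝ (TangentSpace (𝓡 n) z.1) (TangentSpace 𝓘(ℝ, ℝ) z.2) := mfderiv_snd
  exact congrArg (fun L : EuclideanSpace ℝ (Fin n) × ℝ →L[ℝ] ℝ => L v) h2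

theorem diffl_horizontal {φ : M × ℝ → F} {x : M} {t : ℝ}
    (hφ : MDifferentiableAt IR 𝓘(ℝ, F) φ (x, t)) (v : TangentSpace (𝓡 n) x) :
    diffl IR φ (x, t) (horizontal v t) = diffl (𝓡 n) (fun y => φ (y, t)) x v := by
  have h0 : MDifferentiableAt (𝓡 n) IR (fun y : M => (y, t)) x :=
    (contMDiff_slice (n := n) t x).mdifferentiableAt (by simp)
  have h1 := mfderiv_comp_apply x hφ h0 v
  have h2 : mfderiv (𝓡 n) IR (fun y : M => (y, t)) x =
    ContinuousLinearMap.inl ℝ (TangentSpace (𝓡 n) x) (TangentSpace 𝓘(ℝ, ℝ) t) := mfderiv_prod_left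
  refine Eq.trans ?_ h1.symm
  exact congrArg (fun w : EuclideanSpace ℝ (Fin n) × ℝ => diffl IR φ (x, t) w)
    (congrArg (fun L : EuclideanSpace ℝ (Fin n) →L[ℝ] EuclideanSpace ℝ (Fin n) × ℝ => L v) h2).symm

theorem IsLocalEquation.prod_line {X : Set M} {x : M} {U : Set M}
    {h : M → EuclideanSpace ℝ (Fin p)} (hX : IsLocalEquation (𝓡 n) p X x U h) (t : ℝ) :
    IsLocalEquation IR p (X ×ˢ (univ : Set ℝ)) (x, t) (U ×ˢ univ) fun z => h z.1 where
  mem := ⟨hX.mem, mem_univ _⟩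
  isOpen := hX.isOpen.prod isOpen_univ
  mem_open := ⟨hX.mem_open, mem_univ _⟩
  contMDiffOn := hX.contMDiffOn.comp contMDiffOn_fst fun z hz => hz.1
  surjective := by
    intro c
    obtain ⟨v, hv⟩ := hX.surjective c
    refine ⟨horizontal v t, ?_⟩
    rw [diffl_comp_fst hX.mdifferentiableAt]
    exact hv
  inter_eq := by
    ext z
    have := congrArg (z.1 ∈ ·) hX.inter_eq
    simpa using this

end ProductLine

/-! ### The collapse map of a framed submanifold -/

section Collapse

variable {E : Type*} [NormedAddCommGroup E] [NormedSpace ℝ E] [FiniteDimensional ℝ E]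
  {H : Type*} [TopologicalSpace H] {I : ModelWithCorners ℝ E H} [I.Boundaryless]
  {W : Type*} [TopologicalSpace W] [ChartedSpace H W] [IsManifold I ∞ W] {p : ℕ}

/-- The Pontryagin–Thom collapse: normalize `(b, k)`, where `k` is a global framed equation of `Z`
and `b` is a function that is `1` on `Z` and `-1` away from `Z`. -/
theorem exists_collapse [T2Space W] [SigmaCompactSpace W] {Z : Set W}
    (hZc : IsClosed Z) (hZ : IsSubmanifold I p Z)
    {ν : Fin p → ∀ x : W, TangentSpace I x} (hν : IsTransverseFraming Z ν) :
    ∃ G : W → Sph p, ContMDiff I (𝓡 p) ∞ G ∧ (∀ z, G z = north p ↔ z ∈ Z) ∧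
      ∀ z ∈ Z, ∀ i, diffl I (fun z => tailL p (G z)) z (ν i z) = EuclideanSpace.single i 1 := by
  obtain ⟨k, hk, hkZ⟩ := exists_global_framedEquation hZc hZ hν
  obtain ⟨V, hV, hZV, hkV⟩ := exists_isOpen_zeroSet_subset hZ hk (fun z hz => (hkZ z hz).1)
    fun z hz => surjective_of_apply_eq_single (hkZ z hz).2
  obtain ⟨b, hb, hb1, hbV⟩ := exists_contMDiff_one_neg_one (I := I) hZc hV hZV
  let G : W → EuclideanSpace ℝ (Fin (p + 1)) := fun z => consL p (b z, k z)
  have hG : ContMDiff I 𝓘(ℝ, EuclideanSpace ℝ (Fin (p + 1))) ∞ G :=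
    (consL p).contDiff.contMDiff.comp (hb.prodMk_space hk)
  have hmem : ∀ z, k z = 0 → b z ≠ -1 → z ∈ Z := fun z hz hbz => by
    by_contra h
    by_cases hzV : z ∈ V
    · exact h (hkV z hzV hz)
    · exact hbz (hbV z hzV)
  have h0 : ∀ z, G z ≠ 0 := by
    intro z hz
    have h1 : k z = 0 := by
      rw [← tailL_consL (b z) (k z)]
      exact (congrArg (tailL p) hz).trans (map_zero _)
    have h2 : b z = 0 := congrArg (fun v : EuclideanSpace ℝ (Fin (p + 1)) => v 0) hz
    have h3 := hb1 z (hmem z h1 (by rw [h2]; norm_num))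
    rw [h2] at h3
    norm_num at h3
  refine ⟨fun z => normalize (G z), contMDiff_normalize hG h0, fun z => ?_, fun z hz i => ?_⟩
  · rw [normalize_eq_north_iff (h0 z), tailL_consL, consL_zero]
    refine ⟨fun h => hmem z h.1 (by linarith [h.2]), fun h => ⟨(hkZ z h).1, ?_⟩⟩
    rw [hb1 z h]
    norm_num
  · have h1 : tailL p (G z) = 0 := (tailL_consL _ _).trans (hkZ z hz).1
    have h2 : G z 0 = 1 := hb1 z hz
    have h3 : ‖G z‖ = 1 := by
      have := norm_sq_eq_head_tail (G z)
      rw [h1, h2, norm_zero] at this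
      exact (sq_eq_sq₀ (norm_nonneg _) zero_le_one).1 (by linarith)
    rw [diffl_tail_normalize hG h0 h1 h3]
    have h4 : (fun z => tailL p (G z)) = k := funext fun z => tailL_consL _ _
    rw [h4]
    exact (hkZ z hz).2 i

end Collapse

/-! ### Maps with the same framed fibre are homotopic -/

section Uniqueness

variable {n : ℕ} {M : Type*} [TopologicalSpace M] [ChartedSpace (EuclideanSpace ℝ (Fin n)) M]
  [IsManifold (𝓡 n) ∞ M] {p : ℕ} {g : ContMDiffRiemannianMetric (𝓡 n) ∞ (EuclideanSpace ℝ (Fin n))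
      (fun x : M => TangentSpace (𝓡 n) x)}

/-- `N` is the framed fibre of `f` over `(1, 0, …, 0)`, for the basis of the tangent space given by
the coordinate directions `1, …, p`. -/
structure IsStandardFibre (f : C^∞⟮𝓡 n, M; 𝓡 p, Sph p⟯) (N : FramedSubmanifold g p) : Prop where
  mem_iff : ∀ x, x ∈ N.carrier ↔ f x = north p
  diffl_frame : ∀ x ∈ N.carrier, ∀ i,
    diffl (𝓡 n) (fun x => tailL p (f x)) x (N.frame i x) = EuclideanSpace.single i 1

omit [IsManifold (𝓡 n) ∞ M] in
theorem contMDiff_coe (f : C^∞⟮𝓡 n, M; 𝓡 p, Sph p⟯) :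
    ContMDiff (𝓡 n) 𝓘(ℝ, EuclideanSpace ℝ (Fin (p + 1))) ∞
      fun x => (f x : EuclideanSpace ℝ (Fin (p + 1))) :=
  contMDiff_coe_comp f.contMDiff

omit [IsManifold (𝓡 n) ∞ M] in
theorem contMDiff_tail (f : C^∞⟮𝓡 n, M; 𝓡 p, Sph p⟯) :
    ContMDiff (𝓡 n) (𝓡 p) ∞ fun x => tailL p (f x : EuclideanSpace ℝ (Fin (p + 1))) :=
  (tailL p).contDiff.contMDiff.comp (contMDiff_coe f)

omit [IsManifold (𝓡 n) ∞ M] in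
theorem contMDiff_head (f : C^∞⟮𝓡 n, M; 𝓡 p, Sph p⟯) :
    ContMDiff (𝓡 n) 𝓘(ℝ, ℝ) ∞ fun x => (f x : EuclideanSpace ℝ (Fin (p + 1))) 0 :=
  (EuclideanSpace.proj (𝕜 := ℝ) (0 : Fin (p + 1))).contDiff.contMDiff.comp (contMDiff_coe f)

/-- The first coordinate of a map can be replaced by any function that has the same sign where the
other coordinates vanish. -/
theorem smoothHomotopic_change_head {b b' : M → ℝ} {k : M → EuclideanSpace ℝ (Fin p)}
    (hb : ContMDiff (𝓡 n) 𝓘(ℝ, ℝ) ∞ b) (hb' : ContMDiff (𝓡 n) 𝓘(ℝ, ℝ) ∞ b')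
    (hk : ContMDiff (𝓡 n) (𝓡 p) ∞ k) (h : ∀ x, k x = 0 → 0 < b x * b' x)
    {f₀ f₁ : C^∞⟮𝓡 n, M; 𝓡 p, Sph p⟯} (hf₀ : ∀ x, f₀ x = normalize (consL p (b x, k x)))
    (hf₁ : ∀ x, f₁ x = normalize (consL p (b' x, k x))) : SmoothHomotopic f₀ f₁ := by
  refine smoothHomotopic_of_segment ((consL p).contDiff.contMDiff.comp (hb.prodMk_space hk))
    ((consL p).contDiff.contMDiff.comp (hb'.prodMk_space hk)) (fun x t ht h0 => ?_) hf₀ hf₁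
  have h1 : k x = 0 := by
    have := congrArg (tailL p) h0
    simp only [Function.comp_apply, map_add, map_smul, tailL_consL, map_zero] at this
    rw [← add_smul] at this
    simpa using this
  have h2 : (1 - t) * b x + t * b' x = 0 :=
    congrArg (fun v : EuclideanSpace ℝ (Fin (p + 1)) => v 0) h0
  have h3 := h x h1
  have hb0 : b x ≠ 0 := left_ne_zero_of_mul h3.ne'
  have h4 : (1 - t) * (b x * b x) + t * (b x * b' x) = 0 := by
    linear_combination b x * h2
  have h5 := mul_self_pos.2 hb0
  rcases ht.1.eq_or_lt with h6 | h6
  · rw [← h6] at h4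
    linarith
  · have := mul_pos h6 h3
    have := mul_nonneg (sub_nonneg.2 ht.2) h5.le
    linarith

/-- Two maps with the same standard framed fibre `N` are homotopic: the linear path between their
tails has no zeros near `N` outside `N`, so that with a first coordinate that is negative away
from `N` it defines a homotopy. -/
theorem IsStandardFibre.smoothHomotopic [T2Space M] [SigmaCompactSpace M]
    {f f' : C^∞⟮𝓡 n, M; 𝓡 p, Sph p⟯} {N : FramedSubmanifold g p}
    (hf : IsStandardFibre f N) (hf' : IsStandardFibre f' N) : SmoothHomotopic f f' := by
  let k : M → EuclideanSpace ℝ (Fin p) := fun x => tailL p (f x)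
  let k' : M → EuclideanSpace ℝ (Fin p) := fun x => tailL p (f' x)
  have hk : ContMDiff (𝓡 n) (𝓡 p) ∞ k := contMDiff_tail f
  have hk' : ContMDiff (𝓡 n) (𝓡 p) ∞ k' := contMDiff_tail f'
  let K : M × ℝ → EuclideanSpace ℝ (Fin p) := fun z => (1 - z.2) • k z.1 + z.2 • k' z.1
  have hc : ContDiff ℝ ∞ fun t : ℝ => 1 - t := by fun_prop
  have hKs : ContMDiff ((𝓡 n).prod 𝓘(ℝ, ℝ)) (𝓡 p) ∞ K :=
    ((hc.contMDiff.comp contMDiff_snd).smul (hk.comp contMDiff_fst)).add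
      (contMDiff_snd.smul (hk'.comp contMDiff_fst))
  have hkN : ∀ x ∈ N.carrier, k x = 0 := fun x hx => (eq_north_iff.1 ((hf.mem_iff x).1 hx)).1
  have hkN' : ∀ x ∈ N.carrier, k' x = 0 := fun x hx => (eq_north_iff.1 ((hf'.mem_iff x).1 hx)).1
  have hslice : ∀ x (t : ℝ) v, diffl (𝓡 n) (fun y => K (y, t)) x v =
      (1 - t) • diffl (𝓡 n) k x v + t • diffl (𝓡 n) k' x v := by
    intro x t v
    have h1 : MDifferentiableAt (𝓡 n) (𝓡 p) k x := (hk x).mdifferentiableAt (by simp)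
    have h2 : MDifferentiableAt (𝓡 n) (𝓡 p) k' x := (hk' x).mdifferentiableAt (by simp)
    let L : EuclideanSpace ℝ (Fin p) × EuclideanSpace ℝ (Fin p) →L[ℝ] EuclideanSpace ℝ (Fin p) :=
      (1 - t) • ContinuousLinearMap.fst ℝ _ _ + t • ContinuousLinearMap.snd ℝ _ _
    have h3 := diffl_comp_continuousLinearMap (h1.prodMk_space h2) L v
    rw [diffl_prodMk h1 h2] at h3
    exact h3
  obtain ⟨V, hV, hNV, hVN⟩ : ∃ V : Set M, IsOpen V ∧ N.carrier ⊆ V ∧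
      ∀ x ∈ V, ∀ t ∈ Icc (0 : ℝ) 1, K (x, t) = 0 → x ∈ N.carrier := by
    refine ⟨interior {x | ∀ t ∈ Icc (0 : ℝ) 1, K (x, t) = 0 → x ∈ N.carrier}, isOpen_interior,
      fun x hx => ?_, fun x hx => interior_subset hx⟩
    rw [mem_interior_iff_mem_nhds]
    refine isCompact_Icc.eventually_forall_of_forall_eventually fun t _ => ?_
    obtain ⟨U, h, hX⟩ := isInteriorPt_iff.1 (N.isSubmanifold x hx)
    have h1 := (hX.prod_line t).eventually_mem_of_eq_zero hKs.contMDiffAt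
      (Eventually.of_forall fun z hz => by simp [K, hkN _ hz.1, hkN' _ hz.1])
      (surjective_of_apply_eq_single (v := fun i => horizontal (N.frame i x) t) fun i => by
        have h2 : MDifferentiableAt ((𝓡 n).prod 𝓘(ℝ, ℝ)) (𝓡 p) K (x, t) :=
          hKs.contMDiffAt.mdifferentiableAt (by simp)
        rw [diffl_horizontal h2, hslice, hf.diffl_frame x hx, hf'.diffl_frame x hx, ← add_smul]
        simp)
    exact h1.mono fun z hz h => (hz h).1
  obtain ⟨b, hb, hb1, hbV⟩ := exists_contMDiff_one_neg_one (I := 𝓡 n) N.isCompact.isClosed hV hNV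
  have hbpos : ∀ x, b x ≠ -1 → x ∈ V := fun x hx => by
    by_contra h
    exact hx (hbV x h)
  have hnz : ∀ x, ∀ t ∈ Icc (0 : ℝ) 1, consL p (b x, K (x, t)) ≠ 0 := by
    intro x t ht h0
    have h1 : K (x, t) = 0 := by
      rw [← tailL_consL (b x) (K (x, t)), h0, map_zero]
    have h2 : b x = 0 := congrArg (fun v : EuclideanSpace ℝ (Fin (p + 1)) => v 0) h0
    have h3 := hb1 x (hVN x (hbpos x (by rw [h2]; norm_num)) t ht h1)
    rw [h2] at h3
    norm_num at h3
  -- the first coordinates of `f` and `f'` have the sign of `b` where the tails vanish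
  have hsign : ∀ f : C^∞⟮𝓡 n, M; 𝓡 p, Sph p⟯, IsStandardFibre f N →
      (∀ x ∈ V, tailL p (f x) = 0 → x ∈ N.carrier) → ∀ x, tailL p (f x) = 0 →
      0 < (f x : EuclideanSpace ℝ (Fin (p + 1))) 0 * b x := by
    intro f hf hfV x hx
    by_cases hxN : x ∈ N.carrier
    · rw [hb1 x hxN, mul_one]
      exact (eq_north_iff.1 ((hf.mem_iff x).1 hxN)).2
    · rw [hbV x fun h => hxN (hfV x h hx), mul_neg_one, neg_pos]
      refine lt_of_le_of_ne (not_lt.1 fun h => hxN ((hf.mem_iff x).2 (eq_north_iff.2 ⟨hx, h⟩))) ?_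
      intro h
      exact (f x).ne_zero (ext_head_tail (by simpa using h) (by simpa using hx))
  have hfam : ∀ t : ℝ, ContMDiff (𝓡 n) 𝓘(ℝ, EuclideanSpace ℝ (Fin (p + 1))) ∞
      fun x => consL p (b x, K (x, t)) := fun t =>
    (consL p).contDiff.contMDiff.comp (hb.prodMk_space (hKs.comp (contMDiff_slice t)))
  let f₁ : C^∞⟮𝓡 n, M; 𝓡 p, Sph p⟯ := ⟨fun x => normalize (consL p (b x, K (x, 0))),
    contMDiff_normalize (hfam 0) fun x => hnz x 0 ⟨le_rfl, zero_le_one⟩⟩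
  let f₂ : C^∞⟮𝓡 n, M; 𝓡 p, Sph p⟯ := ⟨fun x => normalize (consL p (b x, K (x, 1))),
    contMDiff_normalize (hfam 1) fun x => hnz x 1 ⟨zero_le_one, le_rfl⟩⟩
  have h0 : ∀ x, K (x, 0) = k x := fun x => by simp [K]
  have h1 : ∀ x, K (x, 1) = k' x := fun x => by simp [K]
  have s1 : SmoothHomotopic f f₁ := by
    refine smoothHomotopic_change_head (contMDiff_head f) hb hk (hsign f hf fun x hx h =>
      hVN x hx 0 ⟨le_rfl, zero_le_one⟩ ((h0 x).trans h)) (fun x => ?_) fun x => ?_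
    · rw [consL_head_tail, normalize_coe]
    · rw [← h0]; rfl
  have s2 : SmoothHomotopic f₁ f₂ :=
    smoothHomotopic_of_normalize (G := fun z => consL p (b z.1, K z))
      ((consL p).contDiff.contMDiff.comp ((hb.comp contMDiff_fst).prodMk_space hKs)) hnz
      (fun _ => rfl) fun _ => rfl
  have s3 : SmoothHomotopic f' f₂ := by
    refine smoothHomotopic_change_head (contMDiff_head f') hb hk' (hsign f' hf' fun x hx h =>
      hVN x hx 1 ⟨zero_le_one, le_rfl⟩ ((h1 x).trans h)) (fun x => ?_) fun x => ?_
    · rw [consL_head_tail, normalize_coe]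
    · rw [← h1]; rfl
  exact s1.trans (s2.trans s3.symm)

end Uniqueness

/-! ### Linear maps of positive determinant -/

section Linear

variable {n : ℕ} {M : Type*} [TopologicalSpace M] [ChartedSpace (EuclideanSpace ℝ (Fin n)) M]
  [IsManifold (𝓡 n) ∞ M] {p : ℕ}

/-- The matrix `A` as a linear map of Euclidean space. -/
noncomputable abbrev matL (A : Matrix (Fin (p + 1)) (Fin (p + 1)) ℝ) :
    EuclideanSpace ℝ (Fin (p + 1)) →L[ℝ] EuclideanSpace ℝ (Fin (p + 1)) :=
  Matrix.toEuclideanCLM (n := Fin (p + 1)) (𝕜 := ℝ) A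

variable (n M) in
/-- `A` is invertible and composition with `A` does not change the homotopy class of a map
`M → ℝ^(p+1) \ {0}`. -/
structure PreservesHomotopyClass (A : Matrix (Fin (p + 1)) (Fin (p + 1)) ℝ) : Prop where
  ne_zero : ∀ v, v ≠ 0 → matL A v ≠ 0
  smoothHomotopic : ∀ G : M → EuclideanSpace ℝ (Fin (p + 1)),
    ContMDiff (𝓡 n) 𝓘(ℝ, EuclideanSpace ℝ (Fin (p + 1))) ∞ G → (∀ x, G x ≠ 0) →
    ∀ f₀ f₁ : C^∞⟮𝓡 n, M; 𝓡 p, Sph p⟯, (∀ x, f₀ x = normalize (G x)) →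
      (∀ x, f₁ x = normalize (matL A (G x))) → SmoothHomotopic f₀ f₁

theorem PreservesHomotopyClass.of_segment {A : Matrix (Fin (p + 1)) (Fin (p + 1)) ℝ}
    (h : ∀ v : Fin (p + 1) → ℝ, ∀ t ∈ Icc (0 : ℝ) 1,
      (∀ i, (1 - t) * v i + t * A.mulVec v i = 0) → v = 0) :
    PreservesHomotopyClass n M A := by
  have h' : ∀ v : EuclideanSpace ℝ (Fin (p + 1)), v ≠ 0 → ∀ t ∈ Icc (0 : ℝ) 1,
      (1 - t) • v + t • matL A v ≠ 0 := by
    intro v hv t ht h0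
    have h1 := h v.ofLp t ht fun i =>
      congrArg (fun w : EuclideanSpace ℝ (Fin (p + 1)) => w i) h0
    exact hv (by ext i; exact congrFun h1 i)
  refine ⟨fun v hv => ?_, fun G hG hG0 f₀ f₁ h₀ h₁ => ?_⟩
  · have := h' v hv 1 ⟨zero_le_one, le_rfl⟩
    simpa using this
  · exact smoothHomotopic_of_segment hG ((matL A).contDiff.contMDiff.comp hG)
      (fun x t ht => h' _ (hG0 x) t ht) h₀ h₁

theorem PreservesHomotopyClass.mul {A B : Matrix (Fin (p + 1)) (Fin (p + 1)) ℝ}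
    (hA : PreservesHomotopyClass n M A) (hB : PreservesHomotopyClass n M B) :
    PreservesHomotopyClass n M (A * B) := by
  have h : ∀ v, matL (A * B) v = matL A (matL B v) := fun v => by
    rw [matL, map_mul]
    rfl
  refine ⟨fun v hv => ?_, fun G hG hG0 f₀ f₁ h₀ h₁ => ?_⟩
  · rw [h]
    exact hA.ne_zero _ (hB.ne_zero _ hv)
  · have hBG : ContMDiff (𝓡 n) 𝓘(ℝ, EuclideanSpace ℝ (Fin (p + 1))) ∞ fun x => matL B (G x) :=
      (matL B).contDiff.contMDiff.comp hG
    have hBG0 : ∀ x, matL B (G x) ≠ 0 := fun x => hB.ne_zero _ (hG0 x)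
    let f : C^∞⟮𝓡 n, M; 𝓡 p, Sph p⟯ :=
      ⟨fun x => normalize (matL B (G x)), contMDiff_normalize hBG hBG0⟩
    refine (hB.smoothHomotopic G hG hG0 f₀ f h₀ fun _ => rfl).trans
      (hA.smoothHomotopic _ hBG hBG0 f f₁ (fun _ => rfl) fun x => ?_)
    rw [h₁, h]

theorem PreservesHomotopyClass.one :
    PreservesHomotopyClass n M (1 : Matrix (Fin (p + 1)) (Fin (p + 1)) ℝ) := by
  refine .of_segment fun v t _ h => funext fun i => ?_
  have := h i
  rw [Matrix.one_mulVec] at this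
  rw [Pi.zero_apply]
  linarith

theorem PreservesHomotopyClass.transvection {i j : Fin (p + 1)} (hij : i ≠ j) (c : ℝ) :
    PreservesHomotopyClass n M (Matrix.transvection i j c) := by
  refine .of_segment fun v t _ h => ?_
  have h1 : ∀ k, v k + t * (if k = i then c * v j else 0) = 0 := by
    intro k
    have h2 := h k
    rw [Matrix.transvection, Matrix.add_mulVec, Matrix.one_mulVec] at h2
    have h3 : (Matrix.single i j c).mulVec v k = if k = i then c * v j else 0 := by
      rw [Matrix.single_mulVec]
      simp [Function.update_apply]
    rw [Pi.add_apply, h3] at h2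
    linarith
  have hj : v j = 0 := by
    have := h1 j
    rwa [if_neg hij.symm, mul_zero, add_zero] at this
  funext k
  have := h1 k
  simpa [hj] using this

theorem PreservesHomotopyClass.list_prod
    (L : List (Matrix.TransvectionStruct (Fin (p + 1)) ℝ)) :
    PreservesHomotopyClass n M (L.map Matrix.TransvectionStruct.toMatrix).prod := by
  induction L with
  | nil => exact .one
  | cons t L ih =>
    rw [List.map_cons, List.prod_cons]
    exact (PreservesHomotopyClass.transvection t.hij t.c).mul ih

/-- The rotation by a right angle in the plane of the coordinates `i` and `j`. -/
def quarterTurn (i j : Fin (p + 1)) : Matrix (Fin (p + 1)) (Fin (p + 1)) ℝ :=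
  Matrix.of fun a =>
    if a = i then Pi.single j (-1) else if a = j then Pi.single i 1 else Pi.single a 1

theorem quarterTurn_mulVec (i j : Fin (p + 1)) (v : Fin (p + 1) → ℝ) (a : Fin (p + 1)) :
    (quarterTurn i j).mulVec v a = if a = i then -v j else if a = j then v i else v a := by
  change (if a = i then Pi.single j (-1) else if a = j then Pi.single i 1 else Pi.single a 1 :
    Fin (p + 1) → ℝ) ⬝ᵥ v = _
  split_ifs <;> simp

theorem PreservesHomotopyClass.quarterTurn {i j : Fin (p + 1)} (hij : i ≠ j) :
    PreservesHomotopyClass n M (quarterTurn i j) := by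
  refine .of_segment fun v t _ h => ?_
  simp only [quarterTurn_mulVec] at h
  have hi := h i
  have hj := h j
  rw [if_pos rfl] at hi
  rw [if_neg hij.symm, if_pos rfl] at hj
  have h1 : 0 < (1 - t) ^ 2 + t ^ 2 := by nlinarith [sq_nonneg (2 * t - 1)]
  have hvi : v i = 0 := by
    have : ((1 - t) ^ 2 + t ^ 2) * v i = 0 := by linear_combination (1 - t) * hi + t * hj
    exact (mul_eq_zero.1 this).resolve_left h1.ne'
  have hvj : v j = 0 := by
    have : ((1 - t) ^ 2 + t ^ 2) * v j = 0 := by linear_combination (1 - t) * hj - t * hi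
    exact (mul_eq_zero.1 this).resolve_left h1.ne'
  funext a
  rcases eq_or_ne a i with rfl | hai
  · exact hvi
  rcases eq_or_ne a j with rfl | haj
  · exact hvj
  have := h a
  rw [if_neg hai, if_neg haj] at this
  rw [Pi.zero_apply]
  linarith

/-- Diagonal matrices: the negative entries cancel in pairs, a pair of signs being the square of a
quarter turn. -/
theorem PreservesHomotopyClass.diagonal (m : ℕ) (d : Fin (p + 1) → ℝ) (hd : 0 < ∏ a, d a)
    (hm : (Finset.univ.filter fun a => d a < 0).card = m) :
    PreservesHomotopyClass n M (Matrix.diagonal d) := by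
  induction m using Nat.strong_induction_on generalizing d with
  | _ m ih =>
  have hd0 : ∀ a, d a ≠ 0 := fun a h => hd.ne' (Finset.prod_eq_zero (Finset.mem_univ a) h)
  by_cases hneg : ∃ i, d i < 0
  · obtain ⟨i, hi⟩ := hneg
    obtain ⟨j, hij, hj⟩ : ∃ j, i ≠ j ∧ d j < 0 := by
      by_contra! hcon
      have h1 : 0 < ∏ a ∈ Finset.univ.erase i, d a := Finset.prod_pos fun a ha =>
        lt_of_le_of_ne (hcon a (Finset.ne_of_mem_erase ha).symm) (hd0 a).symm
      rw [← Finset.mul_prod_erase _ _ (Finset.mem_univ i)] at hd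
      exact (mul_neg_of_neg_of_pos hi h1).not_gt hd
    let d' : Fin (p + 1) → ℝ := fun a => d a * ((if a = i then -1 else 1) * (if a = j then -1 else 1))
    have hd' : 0 < ∏ a, d' a := by
      simp only [d', Finset.prod_mul_distrib, Finset.prod_ite_eq', Finset.mem_univ, if_true]
      simpa using hd
    have hlt : (Finset.univ.filter fun a => d' a < 0).card < m := by
      rw [← hm]
      refine Finset.card_lt_card ⟨fun a ha => ?_, fun hsub => ?_⟩
      · rw [Finset.mem_filter] at ha ⊢
        refine ⟨ha.1, ?_⟩
        by_cases hai : a = i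
        · rw [hai]; exact hi
        by_cases haj : a = j
        · rw [haj]; exact hj
        simpa [d', hai, haj] using ha.2
      · have h1 := (Finset.mem_filter.1 (hsub (Finset.mem_filter.2 ⟨Finset.mem_univ i, hi⟩))).2
        simp only [d', if_true, if_neg hij] at h1
        linarith
    have heq : Matrix.diagonal d = Pontryagin.quarterTurn i j * (Pontryagin.quarterTurn i j *
        Matrix.diagonal d') := by
      refine Matrix.ext_of_mulVec_single fun b => ?_
      generalize (Pi.single b 1 : Fin (p + 1) → ℝ) = v
      funext a
      rw [← Matrix.mulVec_mulVec, ← Matrix.mulVec_mulVec]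
      simp only [quarterTurn_mulVec, Matrix.mulVec_diagonal, d']
      by_cases hai : a = i
      · subst hai
        simp [hij, hij.symm]
      by_cases haj : a = j
      · subst haj
        simp [hij.symm]
      simp [hai, haj]
    rw [heq]
    exact (PreservesHomotopyClass.quarterTurn hij).mul
      ((PreservesHomotopyClass.quarterTurn hij).mul (ih _ hlt d' hd' rfl))
  · push Not at hneg
    refine .of_segment fun v t ht h => funext fun a => ?_
    have h1 := h a
    rw [Matrix.mulVec_diagonal] at h1
    have h2 : 0 < d a := lt_of_le_of_ne (hneg a) (hd0 a).symm
    have h3 : 0 < (1 - t) + t * d a := by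
      rcases ht.1.eq_or_lt with h6 | h6
      · rw [← h6]; norm_num
      · have := mul_pos h6 h2
        linarith [ht.2]
    have h4 : ((1 - t) + t * d a) * v a = 0 := by linear_combination h1
    exact (mul_eq_zero.1 h4).resolve_left h3.ne'

/-- The group `GL⁺` is connected: it is generated by transvections and diagonal matrices. -/
theorem PreservesHomotopyClass.of_det_pos {A : Matrix (Fin (p + 1)) (Fin (p + 1)) ℝ}
    (hA : 0 < A.det) : PreservesHomotopyClass n M A := by
  obtain ⟨L, L', D, h⟩ := Matrix.Pivot.exists_list_transvec_mul_diagonal_mul_list_transvec A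
  rw [h] at hA ⊢
  rw [Matrix.det_mul, Matrix.det_mul, Matrix.TransvectionStruct.det_toMatrix_prod,
    Matrix.TransvectionStruct.det_toMatrix_prod, Matrix.det_diagonal, one_mul, mul_one] at hA
  exact ((PreservesHomotopyClass.list_prod L).mul (.diagonal _ D hA rfl)).mul (.list_prod L')

/-- A positively oriented basis is sent to the standard basis by a matrix of positive determinant. -/
theorem exists_matL_eq_single {v : Fin (p + 1) → EuclideanSpace ℝ (Fin (p + 1))}
    (hv : 0 < (Matrix.of fun i j => v i j).det) :
    ∃ A : Matrix (Fin (p + 1)) (Fin (p + 1)) ℝ, 0 < A.det ∧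
      ∀ i, matL A (v i) = EuclideanSpace.single i 1 := by
  let V : Matrix (Fin (p + 1)) (Fin (p + 1)) ℝ := (Matrix.of fun i j => v i j).transpose
  have hV : 0 < V.det := by rwa [Matrix.det_transpose]
  have hVu : IsUnit V.det := hV.ne'.isUnit
  refine ⟨V⁻¹, ?_, fun i => ?_⟩
  · rw [Matrix.det_nonsing_inv, Ring.inverse_eq_inv']
    exact inv_pos.2 hV
  · have h1 : V.mulVec (Pi.single i 1) = (v i).ofLp := by
      ext a
      simp [V]
    have h2 : V⁻¹.mulVec (v i).ofLp = Pi.single i 1 := by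
      rw [← h1, Matrix.mulVec_mulVec, Matrix.nonsing_inv_mul V hVu, Matrix.one_mulVec]
    ext a
    change V⁻¹.mulVec (v i).ofLp a = _
    rw [h2]
    simp [Pi.single_apply]

end Linear

/-! ### Pontryagin manifolds -/

section PontryaginManifold

variable {p : ℕ}

/-- The inclusion of the tangent space `T_y S^p` into `ℝ^(p+1)`. -/
noncomputable def incl (y : Sph p) :
    TangentSpace (𝓡 p) y →L[ℝ] EuclideanSpace ℝ (Fin (p + 1)) :=
  diffl (𝓡 p) (Subtype.val : Sph p → EuclideanSpace ℝ (Fin (p + 1))) y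

theorem incl_injective (y : Sph p) : Function.Injective (incl y) := by
  have : Fact (Module.finrank ℝ (EuclideanSpace ℝ (Fin (p + 1))) = p + 1) := ⟨by simp⟩
  exact injective_mvfderiv_subtypeVal_sphere (n := p) y

theorem range_incl (y : Sph p) : (incl y).range =
    (Submodule.span ℝ {(y : EuclideanSpace ℝ (Fin (p + 1)))})ᗮ := by
  have : Fact (Module.finrank ℝ (EuclideanSpace ℝ (Fin (p + 1))) = p + 1) := ⟨by simp⟩
  exact range_mvfderiv_subtypeVal (n := p) y

/-- A map from `T_y S^p` to `ℝ^p` which is onto is injective, and conversely. -/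
theorem injective_iff_surjective_tangent {y : Sph p}
    (B : TangentSpace (𝓡 p) y →L[ℝ] EuclideanSpace ℝ (Fin p)) :
    Function.Injective B ↔ Function.Surjective B :=
  LinearMap.injective_iff_surjective_of_finrank_eq_finrank
    (V := EuclideanSpace ℝ (Fin p)) (V₂ := EuclideanSpace ℝ (Fin p))
    (f := (show EuclideanSpace ℝ (Fin p) →L[ℝ] EuclideanSpace ℝ (Fin p) from B).toLinearMap) rfl

variable {n : ℕ} {M : Type*} [TopologicalSpace M] [ChartedSpace (EuclideanSpace ℝ (Fin n)) M]

theorem diffl_coe (f : C^∞⟮𝓡 n, M; 𝓡 p, Sph p⟯) (x : M) (v : TangentSpace (𝓡 n) x) :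
    diffl (𝓡 n) (fun x => (f x : EuclideanSpace ℝ (Fin (p + 1)))) x v =
      incl (f x) (mfderiv (𝓡 n) (𝓡 p) f x v) := by
  have h1 : MDifferentiableAt (𝓡 p) 𝓘(ℝ, EuclideanSpace ℝ (Fin (p + 1)))
      (Subtype.val : Sph p → EuclideanSpace ℝ (Fin (p + 1))) (f x) :=
    (contMDiff_coe_comp (I := 𝓡 p) (W := Sph p) (contMDiff_id (n := ∞)) _).mdifferentiableAt
      (by simp)
  have h2 : MDifferentiableAt (𝓡 n) (𝓡 p) f x := (f.contMDiff x).mdifferentiableAt (by simp)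
  exact mfderiv_comp_apply x h1 h2 v

theorem diffl_linear_coe (f : C^∞⟮𝓡 n, M; 𝓡 p, Sph p⟯)
    (A : EuclideanSpace ℝ (Fin (p + 1)) →L[ℝ] EuclideanSpace ℝ (Fin p)) {x : M} {y : Sph p}
    (hx : f x = y) (v : TangentSpace (𝓡 n) x) :
    diffl (𝓡 n) (fun x => A (f x)) x v =
      (A.comp (incl y)) (hx ▸ mfderiv (𝓡 n) (𝓡 p) f x v : TangentSpace (𝓡 p) y) := by
  subst hx
  rw [diffl_comp_continuousLinearMap ((contMDiff_coe f x).mdifferentiableAt (by simp)), diffl_coe]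
  rfl

/-- `A` is a linear automorphism of `ℝ^(p+1)` that carries `(y, w)` to the standard point of the
sphere and the standard basis of its tangent space. -/
structure IsAdapted (A : EuclideanSpace ℝ (Fin (p + 1)) →L[ℝ] EuclideanSpace ℝ (Fin (p + 1)))
    (y : Sph p) (w : Fin p → TangentSpace (𝓡 p) y) : Prop where
  ne_zero : ∀ v, v ≠ 0 → A v ≠ 0
  map_point : A y = EuclideanSpace.single 0 1
  map_basis : ∀ i, A (incl y (w i)) = EuclideanSpace.single i.succ 1

namespace IsAdapted

variable {A : EuclideanSpace ℝ (Fin (p + 1)) →L[ℝ] EuclideanSpace ℝ (Fin (p + 1))}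
  {y : Sph p} {w : Fin p → TangentSpace (𝓡 p) y} (hA : IsAdapted A y w)
include hA

theorem tail_basis (i : Fin p) :
    (((tailL p).comp A).comp (incl y)) (w i) = EuclideanSpace.single i 1 := by
  change tailL p (A (incl y (w i))) = _
  rw [hA.map_basis, tailL_single_succ]

theorem bijective : Function.Bijective (((tailL p).comp A).comp (incl y)) := by
  have h : Function.Surjective (((tailL p).comp A).comp (incl y)) :=
    surjective_of_apply_eq_single (V := EuclideanSpace ℝ (Fin p)) (v := w) hA.tail_basis
  exact ⟨(injective_iff_surjective_tangent _).2 h, h⟩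

theorem eq_iff (z : Sph p) : z = y ↔ tailL p (A z) = 0 ∧ 0 < (A z) 0 := by
  constructor
  · rintro rfl
    rw [hA.map_point]
    simp
  · rintro ⟨h1, h2⟩
    set c := (A z) 0
    have h3 : A z = A (c • (y : EuclideanSpace ℝ (Fin (p + 1)))) := by
      rw [map_smul, hA.map_point]
      refine ext_head_tail (by simp [c]) ?_
      rw [h1, map_smul, tailL_single_zero, smul_zero]
    have h4 : (z : EuclideanSpace ℝ (Fin (p + 1))) = c • (y : EuclideanSpace ℝ (Fin (p + 1))) := by
      by_contra hne
      exact hA.ne_zero _ (sub_ne_zero.2 hne) (by rw [map_sub, h3, sub_self])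
    have h5 := normalize_coe z
    rw [h4, normalize_smul h2, normalize_coe] at h5
    exact h5.symm

variable [IsManifold (𝓡 n) ∞ M] {g : ContMDiffRiemannianMetric (𝓡 n) ∞ (EuclideanSpace ℝ (Fin n))
      (fun x : M => TangentSpace (𝓡 n) x)} {f : C^∞⟮𝓡 n, M; 𝓡 p, Sph p⟯}

/-- In coordinates adapted to `(y, w)`, the Pontryagin manifold is the framed zero set of the
last `p` coordinates of the map. -/
theorem isPontryaginManifold_iff (hw : IsPositiveBasis y w) {N : FramedSubmanifold g p} :
    IsPontryaginManifold f y w N ↔ N.carrier = {x | f x = y} ∧ ∀ x, f x = y → ∀ i,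
      diffl (𝓡 n) (fun x => tailL p (A (f x))) x (N.frame i x) = EuclideanSpace.single i 1 := by
  constructor
  · intro h
    refine ⟨h.carrier_eq, fun x hx i => ?_⟩
    refine (diffl_linear_coe f ((tailL p).comp A) hx _).trans ?_
    rw [h.mfderiv_frame x hx i, ← hA.tail_basis i]
    subst hx
    rfl
  · rintro ⟨h1, h2⟩
    refine ⟨fun x hx => ?_, hw, h1, fun x hx i => ?_⟩
    · have h3 : Function.Surjective (diffl (𝓡 n) (fun x => tailL p (A (f x))) x) :=
        surjective_of_apply_eq_single (h2 x hx)
      intro u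
      subst hx
      obtain ⟨v, hv⟩ := h3 ((((tailL p).comp A).comp (incl (f x))) u)
      exact ⟨v, hA.bijective.1 ((diffl_linear_coe f ((tailL p).comp A) rfl v).symm.trans hv)⟩
    · have h3 := h2 x hx i
      subst hx
      exact hA.bijective.1 (((diffl_linear_coe f ((tailL p).comp A) rfl _).symm.trans h3).trans
        (hA.tail_basis i).symm)

omit [IsManifold (𝓡 n) ∞ M] in
theorem surjective_diffl (hf : IsRegularValue f y) {x : M} (hx : f x = y) :
    Function.Surjective (diffl (𝓡 n) (fun x => tailL p (A (f x))) x) := by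
  subst hx
  intro c
  obtain ⟨u, hu⟩ := hA.bijective.2 c
  obtain ⟨v, rfl⟩ := hf x rfl u
  exact ⟨v, (diffl_linear_coe f ((tailL p).comp A) rfl v).trans hu⟩

omit [IsManifold (𝓡 n) ∞ M] in
theorem isLocalEquation (hf : IsRegularValue f y) {x : M} (hx : f x = y) :
    IsLocalEquation (𝓡 n) p {x | f x = y} x
      {x | 0 < (A (f x)) 0} fun x => tailL p (A (f x)) where
  mem := hx
  isOpen := by
    have h : Continuous fun x => (A (f x)) 0 :=
      ((EuclideanSpace.proj (𝕜 := ℝ) (0 : Fin (p + 1))).comp A).continuous.comp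
        (contMDiff_coe f).continuous
    exact isOpen_lt continuous_const h
  mem_open := ((hA.eq_iff _).1 hx).2
  contMDiffOn := (((tailL p).comp A).contDiff.contMDiff.comp (contMDiff_coe f)).contMDiffOn
  surjective := hA.surjective_diffl hf hx
  inter_eq := by
    ext z
    have := hA.eq_iff (f z)
    simp only [mem_inter_iff, mem_ofPred_eq]
    tauto

theorem exists_isPontryaginManifold [T2Space M] [CompactSpace M]
    (hw : IsPositiveBasis y w) (hf : IsRegularValue f y) :
    ∃ N : FramedSubmanifold g p, IsPontryaginManifold f y w N := by
  obtain ⟨ν, hν, hνe⟩ := (isSmoothMetric_inner g).exists_isFraming isOpen_univ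
    (h := fun x => tailL p (A (f x))) (X := {x | f x = y})
    (((tailL p).comp A).contDiff.contMDiff.comp (contMDiff_coe f)).contMDiffOn (subset_univ _)
    (fun x hx => hA.surjective_diffl hf hx)
    (fun x hx v => (hA.isLocalEquation hf hx).mem_tangentSpaceOf_iff v)
    (EuclideanSpace.basisFun (Fin p) ℝ).toBasis
  refine ⟨⟨{x | f x = y}, ?_, fun x hx => isInteriorPt_iff.2 ⟨_, _, hA.isLocalEquation hf hx⟩, ν,
    hν⟩, (hA.isPontryaginManifold_iff hw).2 ⟨rfl, fun x hx i => ?_⟩⟩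
  · exact (isClosed_singleton.preimage f.contMDiff.continuous).isCompact
  · rw [hνe x hx i]
    simp

/-- The fibre over `y` and the frame that is sent to `w` are unique. -/
theorem frame_eq (hw : IsPositiveBasis y w) {N N' : FramedSubmanifold g p}
    (h : IsPontryaginManifold f y w N) (h' : IsPontryaginManifold f y w N') :
    N'.carrier = N.carrier ∧ ∀ x ∈ N.carrier, ∀ i, N'.frame i x = N.frame i x := by
  refine ⟨h'.carrier_eq.trans h.carrier_eq.symm, fun x hx i => ?_⟩
  have hx' : x ∈ N'.carrier := by rwa [h'.carrier_eq.trans h.carrier_eq.symm]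
  have hfx : f x = y := by
    rw [h.carrier_eq] at hx
    exact hx
  have hnormal : ∀ N : FramedSubmanifold g p, IsPontryaginManifold f y w N → x ∈ N.carrier →
      ∀ v, diffl (𝓡 n) (fun x => tailL p (A (f x))) x v = 0 → g.inner x v (N.frame i x) = 0 := by
    intro N hN hx v hv
    have h1 : N.frame i x ∈ normalSpace g.inner N.carrier x := by
      rw [← N.isFraming.span_eq x hx]
      exact Submodule.subset_span ⟨i, rfl⟩
    refine h1 v ?_
    rw [hN.carrier_eq]
    exact ((hA.isLocalEquation hN.isRegularValue hfx).mem_tangentSpaceOf_iff v).2 hv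
  refine (isSmoothMetric_inner g).eq_of_normal (hnormal N' h' hx') (hnormal N h hx) ?_
  rw [((hA.isPontryaginManifold_iff hw).1 h).2 x hfx i,
    ((hA.isPontryaginManifold_iff hw).1 h').2 x hfx i]

end IsAdapted

/-- Positivity of the basis provides a linear map of positive determinant adapted to `(y, w)`. -/
theorem IsPositiveBasis.exists_isAdapted {y : Sph p} {w : Fin p → TangentSpace (𝓡 p) y}
    (hw : IsPositiveBasis y w) :
    ∃ A : Matrix (Fin (p + 1)) (Fin (p + 1)) ℝ, 0 < A.det ∧ IsAdapted (matL A) y w := by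
  obtain ⟨A, hA, hv⟩ := exists_matL_eq_single hw
  exact ⟨A, hA, (PreservesHomotopyClass.of_det_pos (n := 0) (M := EuclideanSpace ℝ (Fin 0)) hA).ne_zero,
    hv 0, fun i => hv i.succ⟩

variable [IsManifold (𝓡 n) ∞ M] {g : ContMDiffRiemannianMetric (𝓡 n) ∞ (EuclideanSpace ℝ (Fin n))
      (fun x : M => TangentSpace (𝓡 n) x)}

/-- Every Pontryagin manifold of `f` is the standard fibre of a map homotopic to `f`. -/
theorem IsPontryaginManifold.exists_isStandardFibre {f : C^∞⟮𝓡 n, M; 𝓡 p, Sph p⟯} {y : Sph p}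
    {w : Fin p → TangentSpace (𝓡 p) y} {N : FramedSubmanifold g p}
    (h : IsPontryaginManifold f y w N) :
    ∃ f' : C^∞⟮𝓡 n, M; 𝓡 p, Sph p⟯, SmoothHomotopic f f' ∧ IsStandardFibre f' N := by
  obtain ⟨A, hdet, hA⟩ := h.isPositiveBasis.exists_isAdapted
  have hG : ContMDiff (𝓡 n) 𝓘(ℝ, EuclideanSpace ℝ (Fin (p + 1))) ∞ fun x => matL A (f x) :=
    (matL A).contDiff.contMDiff.comp (contMDiff_coe f)
  have hG0 : ∀ x, matL A (f x) ≠ 0 := fun x => hA.ne_zero _ (f x).ne_zero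
  refine ⟨⟨fun x => normalize (matL A (f x)), contMDiff_normalize hG hG0⟩, ?_, ?_, ?_⟩
  · exact (PreservesHomotopyClass.of_det_pos hdet).smoothHomotopic _ (contMDiff_coe f)
      (fun x => (f x).ne_zero) _ _ (fun x => (normalize_coe _).symm) fun _ => rfl
  · intro x
    rw [h.carrier_eq]
    exact (hA.eq_iff (f x)).trans (normalize_eq_north_iff (hG0 x)).symm
  · intro x hx i
    rw [h.carrier_eq] at hx
    have hx' : f x = y := hx
    refine (diffl_tail_normalize hG hG0 ((hA.eq_iff (f x)).1 hx').1 ?_ _).trans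
      (((hA.isPontryaginManifold_iff h.isPositiveBasis).1 h).2 x hx' i)
    rw [hx', hA.map_point]
    simp

theorem exists_standard_isAdapted : ∃ w : Fin p → TangentSpace (𝓡 p) (north p),
    IsPositiveBasis (north p) w ∧ IsAdapted (ContinuousLinearMap.id ℝ _) (north p) w := by
  have h : ∀ i : Fin p, ∃ w, incl (north p) w = EuclideanSpace.single i.succ 1 := by
    intro i
    have h1 : EuclideanSpace.single i.succ 1 ∈ (incl (north p)).range := by
      rw [range_incl, Submodule.mem_orthogonal_singleton_iff_inner_right]
      simp [north, EuclideanSpace.inner_single_left]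
    exact h1
  choose w hw using h
  refine ⟨w, ?_, fun _ h => h, rfl, hw⟩
  have h1 : (Matrix.of fun i j => (Fin.cons (north p : EuclideanSpace ℝ (Fin (p + 1)))
      (fun i => incl (north p) (w i)) : Fin (p + 1) → EuclideanSpace ℝ (Fin (p + 1))) i j) =
      (1 : Matrix (Fin (p + 1)) (Fin (p + 1)) ℝ) := by
    ext i j
    refine Fin.cases ?_ (fun i => ?_) i
    · simp [north, Matrix.one_apply, eq_comm]
    · simp [hw, Matrix.one_apply, eq_comm]
  have h2 : (0 : ℝ) < (1 : Matrix (Fin (p + 1)) (Fin (p + 1)) ℝ).det := by simp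
  rw [← h1] at h2
  exact h2

/-- A standard fibre is a Pontryagin manifold. -/
theorem IsStandardFibre.exists_isPontryaginManifold {f : C^∞⟮𝓡 n, M; 𝓡 p, Sph p⟯}
    {N : FramedSubmanifold g p} (h : IsStandardFibre f N) :
    ∃ (y : Sph p) (w : Fin p → TangentSpace (𝓡 p) y), IsPontryaginManifold f y w N := by
  obtain ⟨w, hw, hA⟩ := exists_standard_isAdapted (p := p)
  exact ⟨north p, w, (hA.isPontryaginManifold_iff hw).2
    ⟨Set.ext h.mem_iff, fun x hx i => h.diffl_frame x ((h.mem_iff x).2 hx) i⟩⟩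

/-- Every compact framed submanifold is the standard fibre of some map. -/
theorem FramedSubmanifold.exists_isStandardFibre [T2Space M] [SigmaCompactSpace M]
    (N : FramedSubmanifold g p) : ∃ f : C^∞⟮𝓡 n, M; 𝓡 p, Sph p⟯, IsStandardFibre f N := by
  obtain ⟨G, hG, hGN, hGd⟩ := exists_collapse N.isCompact.isClosed N.isSubmanifold
    (N.isFraming.isTransverseFraming (isSmoothMetric_inner g))
  exact ⟨⟨G, hG⟩, fun x => (hGN x).symm, hGd⟩

/-- The regular values of `f` are found by Sard's theorem for the last `p` coordinates of `f`. -/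
theorem exists_isRegularValue [SigmaCompactSpace M] (f : C^∞⟮𝓡 n, M; 𝓡 p, Sph p⟯) :
    ∃ y, IsRegularValue f y := by
  obtain ⟨c, hc, hc1⟩ := (dense_setOf_regularValue (contMDiff_tail f)).exists_mem_open
    (Metric.isOpen_ball (x := (0 : EuclideanSpace ℝ (Fin p))) (ε := 1)) ⟨0, by simp⟩
  have hc2 : ‖c‖ < 1 := by simpa using hc1
  have h1 : 0 < 1 - ‖c‖ ^ 2 := by nlinarith [norm_nonneg c]
  let v : EuclideanSpace ℝ (Fin (p + 1)) := consL p (√(1 - ‖c‖ ^ 2), c)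
  have hv : ‖v‖ = 1 := by
    have h2 := norm_sq_eq_head_tail v
    rw [tailL_consL, consL_zero, Real.sq_sqrt h1.le] at h2
    refine (sq_eq_sq₀ (norm_nonneg _) zero_le_one).1 ?_
    linarith
  let y : Sph p := ⟨v, by simp [hv]⟩
  refine ⟨y, fun x hx => ?_⟩
  have h2 : tailL p (f x : EuclideanSpace ℝ (Fin (p + 1))) = c := by
    rw [hx]
    exact tailL_consL _ _
  have h3 := hc x h2
  have h4 : Function.Surjective ((tailL p).comp (incl (f x))) := by
    intro b
    obtain ⟨u, rfl⟩ := h3 b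
    exact ⟨_, (diffl_linear_coe f (tailL p) rfl u).symm⟩
  have h5 := (injective_iff_surjective_tangent _).2 h4
  intro u
  obtain ⟨u', hu'⟩ := h3 ((tailL p).comp (incl (f x)) u)
  exact ⟨u', h5 ((diffl_linear_coe f (tailL p) rfl u').symm.trans hu')⟩

/-- A vector outside a hyperplane is completed by a basis of the hyperplane to a positively oriented
basis. As `1 ≤ p`, a vector of the basis can be replaced by its negative to correct the sign. -/
theorem exists_det_pos (hp : 1 ≤ p) (L : EuclideanSpace ℝ (Fin p) →L[ℝ]
      EuclideanSpace ℝ (Fin (p + 1))) (hL : Function.Injective L)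
    {y : EuclideanSpace ℝ (Fin (p + 1))} (hy : y ∉ L.range) :
    ∃ w : Fin p → EuclideanSpace ℝ (Fin p), 0 < (Matrix.of fun i j => (Fin.cons y
      (fun i => L (w i)) : Fin (p + 1) → EuclideanSpace ℝ (Fin (p + 1))) i j).det := by
  let V : (Fin p → EuclideanSpace ℝ (Fin p)) → Matrix (Fin (p + 1)) (Fin (p + 1)) ℝ := fun w =>
    Matrix.of fun i j => (Fin.cons y
      (fun i => L (w i)) : Fin (p + 1) → EuclideanSpace ℝ (Fin (p + 1))) i j
  let b : Fin p → EuclideanSpace ℝ (Fin p) := EuclideanSpace.basisFun (Fin p) ℝ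
  have hb : LinearIndependent ℝ b := (EuclideanSpace.basisFun (Fin p) ℝ).orthonormal.linearIndependent
  have hdet : (V b).det ≠ 0 := by
    have h1 : LinearIndependent ℝ (Fin.cons y
        (fun i => L (b i)) : Fin (p + 1) → EuclideanSpace ℝ (Fin (p + 1))) := by
      rw [linearIndependent_finCons]
      refine ⟨hb.map' L.toLinearMap (LinearMap.ker_eq_bot.2 hL), fun hmem => hy ?_⟩
      refine Submodule.span_le.2 ?_ hmem
      rintro _ ⟨i, rfl⟩
      exact ⟨b i, rfl⟩
    have h2 : LinearIndependent ℝ (V b).row :=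
      h1.map' (WithLp.linearEquiv 2 ℝ (Fin (p + 1) → ℝ)).toLinearMap (LinearEquiv.ker _)
    rw [Matrix.linearIndependent_rows_iff_isUnit, Matrix.isUnit_iff_isUnit_det] at h2
    exact h2.ne_zero
  rcases lt_or_gt_of_ne hdet with h | h
  · -- reverse the orientation by negating one vector
    let i₀ : Fin p := ⟨0, hp⟩
    refine ⟨Function.update b i₀ (-b i₀), ?_⟩
    have h1 : V (Function.update b i₀ (-b i₀)) =
        (V b).updateRow i₀.succ ((-1 : ℝ) • (V b) i₀.succ) := by
      ext i j
      refine Fin.cases ?_ (fun i => ?_) i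
      · rw [Matrix.updateRow_ne (Fin.succ_ne_zero _).symm]
        rfl
      · rcases eq_or_ne i i₀ with rfl | hi
        · rw [Matrix.updateRow_self]
          simp [V]
        · rw [Matrix.updateRow_ne (by simpa using hi)]
          simp [V, hi]
    have h2 : 0 < (V (Function.update b i₀ (-b i₀))).det := by
      rw [h1, Matrix.det_updateRow_smul, Matrix.updateRow_eq_self]
      linarith
    exact h2
  · exact ⟨b, h⟩

theorem exists_isPositiveBasis (hp : 1 ≤ p) (y : Sph p) :
    ∃ w : Fin p → TangentSpace (𝓡 p) y, IsPositiveBasis y w := by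
  refine exists_det_pos hp (incl y) (incl_injective y) fun h => ?_
  have h' : (y : EuclideanSpace ℝ (Fin (p + 1))) ∈ (incl y).range := h
  rw [range_incl, Submodule.mem_orthogonal_singleton_iff_inner_right] at h'
  exact y.ne_zero (inner_self_eq_zero.1 h')

end PontryaginManifold

/-! ### Homotopic maps have cobordant fibres -/

section HomotopyToCobordism

variable {n : ℕ} {M : Type*} [TopologicalSpace M] [ChartedSpace (EuclideanSpace ℝ (Fin n)) M]
  {p : ℕ}

local notation "IR" => ModelWithCorners.prod (𝓡 n) 𝓘(ℝ, ℝ)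

theorem diffl_sub_const {E : Type*} [NormedAddCommGroup E] [NormedSpace ℝ E]
    {H : Type*} [TopologicalSpace H] {I : ModelWithCorners ℝ E H}
    {W : Type*} [TopologicalSpace W] [ChartedSpace H W]
    {F : Type*} [NormedAddCommGroup F] [NormedSpace ℝ F] {f : W → F} {z : W}
    (hf : MDifferentiableAt I 𝓘(ℝ, F) f z) (c : F) (v : TangentSpace I z) :
    diffl I (fun y => f y - c) z v = diffl I f z v := by
  have h1 : HasMFDerivAt 𝓘(ℝ, F) 𝓘(ℝ, F) (fun y : F => y - c) (f z)
      (ContinuousLinearMap.id ℝ F) := ((hasFDerivAt_id (f z)).sub_const c).hasMFDerivAt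
  have h2 := (h1.comp z hf.hasMFDerivAt).mfderiv
  exact congrArg (fun L : TangentSpace I z →L[ℝ] F => L v) h2

theorem isOpen_setOf_surjective_diffl [IsManifold (𝓡 n) ∞ M] {h : M → EuclideanSpace ℝ (Fin p)}
    (hh : ContMDiff (𝓡 n) (𝓡 p) ∞ h) : IsOpen {x | Function.Surjective (diffl (𝓡 n) h x)} := by
  rw [isOpen_iff_mem_nhds]
  intro x hx
  obtain ⟨K, Ψ, hΨ, hxΨ, -, hfst⟩ :=
    exists_straightening isOpen_univ hh.contMDiffOn (mem_univ x) hx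
  filter_upwards [Ψ.open_source.mem_nhds hxΨ] with z hz c
  obtain ⟨v, hv⟩ := (hΨ.tangentEquiv hz).surjective (c, 0)
  exact ⟨v, (hΨ.diffl_fst_apply hfst hz v).trans (by rw [hv])⟩

theorem dist_north_sq_le {y : Sph p} (hy : 0 < (y : EuclideanSpace ℝ (Fin (p + 1))) 0) :
    dist y (north p) ^ 2 ≤ 2 * ‖tailL p (y : EuclideanSpace ℝ (Fin (p + 1)))‖ ^ 2 := by
  have h1 := norm_sq_eq_head_tail (y : EuclideanSpace ℝ (Fin (p + 1)))
  have h2 := norm_sq_eq_head_tail ((y : EuclideanSpace ℝ (Fin (p + 1))) - EuclideanSpace.single 0 1)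
  rw [Subtype.dist_eq, dist_eq_norm]
  change ‖(y : EuclideanSpace ℝ (Fin (p + 1))) - EuclideanSpace.single 0 1‖ ^ 2 ≤ _
  rw [h2, map_sub, tailL_single_zero, sub_zero]
  rw [y.norm_eq] at h1
  have h3 : ((y : EuclideanSpace ℝ (Fin (p + 1))) - EuclideanSpace.single 0 1 :
      EuclideanSpace ℝ (Fin (p + 1))) 0 = (y : EuclideanSpace ℝ (Fin (p + 1))) 0 - 1 := by simp
  rw [h3]
  nlinarith

variable [IsManifold (𝓡 n) ∞ M] {g : ContMDiffRiemannianMetric (𝓡 n) ∞ (EuclideanSpace ℝ (Fin n))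
      (fun x : M => TangentSpace (𝓡 n) x)}

namespace IsStandardFibre

variable {f : C^∞⟮𝓡 n, M; 𝓡 p, Sph p⟯} {N : FramedSubmanifold g p} (hf : IsStandardFibre f N)
include hf

theorem mem_tangentSpaceOf_iff {x : M} (hx : x ∈ N.carrier) (v : TangentSpace (𝓡 n) x) :
    v ∈ tangentSpaceOf (𝓡 n) N.carrier x ↔ diffl (𝓡 n) (fun x => tailL p (f x)) x v = 0 := by
  obtain ⟨w, hw, hA⟩ := exists_standard_isAdapted (p := p)
  have h := (hA.isPontryaginManifold_iff (f := f) (N := N) hw).2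
    ⟨Set.ext hf.mem_iff, fun x hx i => hf.diffl_frame x ((hf.mem_iff x).2 hx) i⟩
  rw [h.carrier_eq]
  exact (hA.isLocalEquation h.isRegularValue ((hf.mem_iff x).1 hx)).mem_tangentSpaceOf_iff v

/-- If a framed submanifold of `M × ℝ` is given near `(x, t)` by the equation `tail (f x) = 0`, its
framing is the horizontal one. -/
theorem eq_horizontal {x : M} (hx : x ∈ N.carrier) {t : ℝ}
    {h : M × ℝ → EuclideanSpace ℝ (Fin p)} (hh : h =ᶠ[𝓝 (x, t)] fun z => tailL p (f z.1))
    {u : TangentSpace IR (x, t)} {i : Fin p} (hu : ∀ v, diffl IR h (x, t) v = 0 → prodMetric g (x, t) v u = 0)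
    (hui : diffl IR h (x, t) u = EuclideanSpace.single i 1) :
    u = horizontal (N.frame i x) t := by
  have hd : MDifferentiableAt (𝓡 n) (𝓡 p) (fun x => tailL p (f x)) x :=
    (contMDiff_tail f x).mdifferentiableAt (by simp)
  have hv : ∀ v : TangentSpace IR (x, t), diffl IR h (x, t) v =
      diffl (𝓡 n) (fun x => tailL p (f x)) x (show EuclideanSpace ℝ (Fin n) × ℝ from v).1 := by
    intro v
    rw [diffl_congr hh]
    exact diffl_comp_fst (φ := fun x => tailL p (f x)) (z := (x, t)) hd v
  refine (isSmoothMetric_prodMetric g).eq_of_normal hu (fun v hv0 => ?_) ?_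
  · rw [hv] at hv0
    have h1 : N.frame i x ∈ normalSpace g.inner N.carrier x := by
      rw [← N.isFraming.span_eq x hx]
      exact Submodule.subset_span ⟨i, rfl⟩
    have h2 := h1 _ ((hf.mem_tangentSpaceOf_iff hx _).2 hv0)
    rw [prodMetric_apply]
    change g.inner x _ (N.frame i x) + _ * (0 : ℝ) = 0
    rw [mul_zero, add_zero]
    exact h2
  · rw [hui, hv]
    exact (hf.diffl_frame x hx i).symm

/-- Near `(1, 0, …, 0)`, all values of `f` are regular. -/
theorem exists_surjective_of_norm_lt [T2Space M] [CompactSpace M] :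
    ∃ δ > 0, ∀ x, ‖tailL p (f x : EuclideanSpace ℝ (Fin (p + 1)))‖ < δ →
      0 < (f x : EuclideanSpace ℝ (Fin (p + 1))) 0 →
      Function.Surjective (diffl (𝓡 n) (fun x => tailL p (f x)) x) := by
  let C := {x | Function.Surjective (diffl (𝓡 n) (fun x => tailL p (f x)) x)}ᶜ
  have hC : IsCompact (f '' C) :=
    (isOpen_setOf_surjective_diffl (contMDiff_tail f)).isClosed_compl.isCompact.image
      f.contMDiff.continuous
  have hN : north p ∉ f '' C := by
    rintro ⟨x, hx, hxN⟩
    exact hx (surjective_of_apply_eq_single (hf.diffl_frame x ((hf.mem_iff x).2 hxN)))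
  obtain ⟨r, hr, hrC⟩ := Metric.isOpen_iff.1 hC.isClosed.isOpen_compl _ hN
  refine ⟨r / 2, half_pos hr, fun x hx h0 => ?_⟩
  by_contra hs
  refine hrC (Metric.mem_ball.2 ?_) ⟨x, hs, rfl⟩
  have h1 := dist_north_sq_le h0
  have h2 := norm_nonneg (tailL p (f x : EuclideanSpace ℝ (Fin (p + 1))))
  refine lt_of_pow_lt_pow_left₀ 2 hr.le ?_
  nlinarith

end IsStandardFibre

variable [T2Space M] [CompactSpace M]

/-- The fibres of homotopic maps are cobordant. The cobordism is the zero set of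
`tail F - β(t) c` for a small regular value `c` of `tail F`, where the cutoff function `β` vanishes
near the ends. -/
theorem SmoothHomotopic.framedCobordant {f₀ f₁ : C^∞⟮𝓡 n, M; 𝓡 p, Sph p⟯}
    {N₀ N₁ : FramedSubmanifold g p} (hf₀ : IsStandardFibre f₀ N₀) (hf₁ : IsStandardFibre f₁ N₁)
    (hF : SmoothHomotopic f₀ f₁) : FramedCobordant N₀ N₁ := by
  obtain ⟨F, hF, hF0, hF1⟩ := hF.exists_extension
  obtain ⟨δ₀, hδ₀, hs₀⟩ := hf₀.exists_surjective_of_norm_lt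
  obtain ⟨δ₁, hδ₁, hs₁⟩ := hf₁.exists_surjective_of_norm_lt
  have hFc := contMDiff_coe_comp hF
  let K : M × ℝ → EuclideanSpace ℝ (Fin p) := fun z => tailL p (F z)
  have hK : ContMDiff IR (𝓡 p) ∞ K := (tailL p).contDiff.contMDiff.comp hFc
  let a : M × ℝ → ℝ := fun z => (F z : EuclideanSpace ℝ (Fin (p + 1))) 0
  have ha : Continuous a :=
    (EuclideanSpace.proj (𝕜 := ℝ) (0 : Fin (p + 1))).continuous.comp hFc.continuous
  obtain ⟨c, hcreg, hc⟩ := (dense_setOf_regularValue hK).exists_mem_open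
    (Metric.isOpen_ball (x := (0 : EuclideanSpace ℝ (Fin p))) (ε := min 1 (min δ₀ δ₁)))
    ⟨0, by simp [hδ₀, hδ₁]⟩
  obtain ⟨hc1, hc₀, hc₁⟩ : ‖c‖ < 1 ∧ ‖c‖ < δ₀ ∧ ‖c‖ < δ₁ := by simpa using hc
  let β : ℝ → ℝ := fun t => Real.smoothTransition (9 * t - 1) * Real.smoothTransition (8 - 9 * t)
  have hβ : ContDiff ℝ ∞ β := (Real.smoothTransition.contDiff.comp (by fun_prop)).mul
    (Real.smoothTransition.contDiff.comp (by fun_prop))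
  have hβ0 : ∀ t ≤ 1 / 9, β t = 0 := fun t ht => by
    simp only [β]
    rw [Real.smoothTransition.zero_of_nonpos (by linarith), zero_mul]
  have hβ1 : ∀ t ≥ 8 / 9, β t = 0 := fun t ht => by
    simp only [β]
    rw [Real.smoothTransition.zero_of_nonpos (x := 8 - 9 * t) (by linarith), mul_zero]
  have hβm : ∀ t, 2 / 9 ≤ t → t ≤ 7 / 9 → β t = 1 := fun t ht ht' => by
    simp only [β]
    rw [Real.smoothTransition.one_of_one_le (by linarith),
      Real.smoothTransition.one_of_one_le (by linarith), one_mul]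
  have hβn : ∀ t, ‖β t • c‖ ≤ ‖c‖ := fun t => by
    rw [norm_smul, Real.norm_of_nonneg (mul_nonneg (Real.smoothTransition.nonneg _)
      (Real.smoothTransition.nonneg _))]
    exact mul_le_of_le_one_left (norm_nonneg c) (mul_le_one₀ (Real.smoothTransition.le_one _)
      (Real.smoothTransition.nonneg _) (Real.smoothTransition.le_one _))
  let h : M × ℝ → EuclideanSpace ℝ (Fin p) := fun z => K z - β z.2 • c
  have hh : ContMDiff IR (𝓡 p) ∞ h :=
    hK.sub ((hβ.contMDiff.comp contMDiff_snd).smul contMDiff_const)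
  have hhd : ∀ z, MDifferentiableAt IR (𝓡 p) h z := fun z => (hh z).mdifferentiableAt (by simp)
  have hKn : ∀ z, h z = 0 → K z = β z.2 • c := fun z hz => sub_eq_zero.1 hz
  let U : Set (M × ℝ) := {z | 0 < a z}
  have hU : IsOpen U := isOpen_lt continuous_const ha
  let X : Set (M × ℝ) := {z | h z = 0 ∧ 0 < a z ∧ z.2 ∈ Icc (0 : ℝ) 1}
  -- at times where the homotopy is constant, `h` is a submersion even on the slices
  have hslice : ∀ (f : C^∞⟮𝓡 n, M; 𝓡 p, Sph p⟯) (δ : ℝ), ‖c‖ < δ →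
      (∀ x, ‖tailL p (f x : EuclideanSpace ℝ (Fin (p + 1)))‖ < δ →
        0 < (f x : EuclideanSpace ℝ (Fin (p + 1))) 0 →
        Function.Surjective (diffl (𝓡 n) (fun x => tailL p (f x)) x)) →
      ∀ t, (∀ x, F (x, t) = f x) → ∀ x, h (x, t) = 0 → (x, t) ∈ U →
      ∀ b, ∃ v, diffl IR h (x, t) (horizontal v t) = b := by
    intro f δ hδ hs t hFt x hx hxU b
    have h1 : K (x, t) = tailL p (f x) := by simp only [K, hFt]
    have h2 : Function.Surjective (diffl (𝓡 n) (fun x => tailL p (f x)) x) := by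
      refine hs x ?_ ?_
      · rw [← h1, hKn _ hx]
        exact (hβn t).trans_lt hδ
      · have h3 : 0 < (F (x, t) : EuclideanSpace ℝ (Fin (p + 1))) 0 := hxU
        rwa [hFt] at h3
    obtain ⟨v, hv⟩ := h2 b
    refine ⟨v, ?_⟩
    rw [diffl_horizontal (hhd _)]
    have h4 : (fun y => h (y, t)) = fun y => tailL p (f y : EuclideanSpace ℝ (Fin (p + 1))) - β t • c := by
      funext y
      simp only [h, K, hFt]
    rw [h4, diffl_sub_const ((contMDiff_tail f x).mdifferentiableAt (by simp))]
    exact hv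
  have hslice0 : ∀ t ≤ 1 / 3, ∀ x, h (x, t) = 0 → (x, t) ∈ U →
      ∀ b, ∃ v, diffl IR h (x, t) (horizontal v t) = b := fun t ht =>
    hslice f₀ δ₀ hc₀ hs₀ t fun x => hF0 x t ht
  have hslice1 : ∀ t ≥ 2 / 3, ∀ x, h (x, t) = 0 → (x, t) ∈ U →
      ∀ b, ∃ v, diffl IR h (x, t) (horizontal v t) = b := fun t ht =>
    hslice f₁ δ₁ hc₁ hs₁ t fun x => hF1 x t ht
  have hsurj : ∀ z, h z = 0 → z ∈ U → Function.Surjective (diffl IR h z) := by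
    rintro ⟨x, t⟩ hz hzU
    rcases le_or_gt t (1 / 3) with ht | ht
    · exact fun b => (hslice0 t ht x hz hzU b).imp' (fun v => horizontal v t) fun _ hv => hv
    rcases le_or_gt (2 / 3) t with ht' | ht'
    · exact fun b => (hslice1 t ht' x hz hzU b).imp' (fun v => horizontal v t) fun _ hv => hv
    have h1 : h =ᶠ[𝓝 (x, t)] fun z => K z - c := by
      filter_upwards [continuous_snd.continuousAt.eventually_const_lt
        (show (1 / 3 : ℝ) < (x, t).2 from ht), continuous_snd.continuousAt.eventually_lt_const
        (show (x, t).2 < (2 / 3 : ℝ) from ht')] with z h1 h2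
      simp only [h]
      rw [hβm _ (by linarith) (by linarith), one_smul]
    have h2 : K (x, t) = c := by
      rw [hKn _ hz]
      change β t • c = c
      rw [hβm _ (by linarith) (by linarith), one_smul]
    intro b
    obtain ⟨v, hv⟩ := hcreg _ h2 b
    refine ⟨v, ?_⟩
    rw [diffl_congr h1, diffl_sub_const ((hK _).mdifferentiableAt (by simp))]
    exact hv
  have hloc : ∀ z ∈ X, z.2 ∈ Ioo (0 : ℝ) 1 →
      IsLocalEquation IR p X z (U ∩ Prod.snd ⁻¹' Ioo 0 1) h := fun z hz ht =>
    { mem := hz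
      isOpen := hU.inter (isOpen_Ioo.preimage continuous_snd)
      mem_open := ⟨hz.2.1, ht⟩
      contMDiffOn := hh.contMDiffOn
      surjective := hsurj z hz.1 hz.2.1
      inter_eq := by
        ext y
        exact ⟨fun hy => ⟨hy.2, hy.1.1⟩, fun hy => ⟨⟨hy.2, hy.1.1, Ioo_subset_Icc_self hy.1.2⟩, hy.1⟩⟩ }
  have hloc0 : ∀ z ∈ X, z.2 = 0 →
      IsLocalHalfEquation IR p X z (U ∩ Prod.snd ⁻¹' Iio 1) h Prod.snd := by
    rintro ⟨x, t⟩ hz ht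
    change t = 0 at ht
    subst ht
    refine
    { mem := hz
      isOpen := hU.inter (isOpen_Iio.preimage continuous_snd)
      mem_open := ⟨hz.2.1, zero_lt_one' ℝ⟩
      contMDiffOn := hh.contMDiffOn
      contMDiffOn_rho := contMDiff_snd.contMDiffOn
      rho_eq := rfl
      surjective := ?_
      inter_eq := ?_ }
    · rintro ⟨b, s⟩
      let e : TangentSpace IR (x, (0 : ℝ)) := ((0, s) : EuclideanSpace ℝ (Fin n) × ℝ)
      obtain ⟨v, hv⟩ := hslice0 0 (by norm_num) x hz.1 hz.2.1 (b - diffl IR h (x, 0) e)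
      refine ⟨horizontal v 0 + e, Prod.ext ?_ ?_⟩
      · change diffl IR h (x, 0) (horizontal v 0 + e) = b
        rw [map_add, hv, sub_add_cancel]
      · refine (diffl_snd (n := n) (M := M) (x, 0) _).trans ?_
        exact zero_add s
    · ext y
      exact ⟨fun hy => ⟨hy.2, hy.1.1, hy.1.2.2.1⟩,
        fun hy => ⟨⟨hy.2.1, hy.1.1, hy.2.2, le_of_lt hy.1.2⟩, hy.1⟩⟩
  have hloc1 : ∀ z ∈ X, z.2 = 1 →
      IsLocalHalfEquation IR p X z (U ∩ Prod.snd ⁻¹' Ioi 0) h fun y => 1 - y.2 := by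
    rintro ⟨x, t⟩ hz ht
    change t = 1 at ht
    subst ht
    refine
    { mem := hz
      isOpen := hU.inter (isOpen_Ioi.preimage continuous_snd)
      mem_open := ⟨hz.2.1, zero_lt_one' ℝ⟩
      contMDiffOn := hh.contMDiffOn
      contMDiffOn_rho := (contMDiff_const.sub contMDiff_snd).contMDiffOn
      rho_eq := sub_self _
      surjective := ?_
      inter_eq := ?_ }
    · rintro ⟨b, s⟩
      let e : TangentSpace IR (x, (1 : ℝ)) := ((0, -s) : EuclideanSpace ℝ (Fin n) × ℝ)
      obtain ⟨v, hv⟩ := hslice1 1 (by norm_num) x hz.1 hz.2.1 (b - diffl IR h (x, 1) e)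
      refine ⟨horizontal v 1 + e, Prod.ext ?_ ?_⟩
      · change diffl IR h (x, 1) (horizontal v 1 + e) = b
        rw [map_add, hv, sub_add_cancel]
      · have hρ : (fun y : M × ℝ => 1 - y.2) =
            fun y => (-ContinuousLinearMap.id ℝ ℝ) (y.2 - 1) := by
          funext y
          simp
        have hd : MDifferentiableAt IR 𝓘(ℝ, ℝ) (fun y : M × ℝ => y.2) (x, 1) :=
          mdifferentiableAt_snd
        have hd' : MDifferentiableAt IR 𝓘(ℝ, ℝ) (fun y : M × ℝ => y.2 - 1) (x, 1) :=
          hd.sub mdifferentiableAt_const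
        change diffl IR (fun y : M × ℝ => 1 - y.2) (x, 1) (horizontal v 1 + e) = s
        rw [hρ, diffl_comp_continuousLinearMap hd', diffl_sub_const hd, diffl_snd]
        change -(0 + -s) = s
        ring
    · ext y
      exact ⟨fun hy => ⟨hy.2, hy.1.1, sub_nonneg.2 hy.1.2.2.2⟩,
        fun hy => ⟨⟨hy.2.1, hy.1.1, le_of_lt hy.1.2, sub_nonneg.1 hy.2.2⟩, hy.1⟩⟩
  have htan : ∀ z ∈ X, ∀ v, v ∈ tangentSpaceOf IR X z ↔ diffl IR h z v = 0 := by
    intro z hz v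
    rcases hz.2.2.1.eq_or_lt with h0 | h0
    · exact (hloc0 z hz h0.symm).mem_tangentSpaceOf_iff v
    rcases hz.2.2.2.eq_or_lt with h1 | h1
    · exact (hloc1 z hz h1).mem_tangentSpaceOf_iff v
    · exact (hloc z hz ⟨h0, h1⟩).mem_tangentSpaceOf_iff v
  have hX0 : ∀ x, ∀ t ∈ Icc (0 : ℝ) (1 / 9), (x, t) ∈ X ↔ x ∈ N₀.carrier := by
    intro x t ht
    have h1 : F (x, t) = f₀ x := hF0 x t (ht.2.trans (by norm_num))
    have h2 : h (x, t) = tailL p (f₀ x) := by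
      simp only [h, K]
      rw [hβ0 t ht.2, zero_smul, sub_zero, h1]
    have h3 : a (x, t) = (f₀ x : EuclideanSpace ℝ (Fin (p + 1))) 0 := by simp only [a, h1]
    rw [hf₀.mem_iff, eq_north_iff, ← h2, ← h3]
    exact ⟨fun hz => ⟨hz.1, hz.2.1⟩, fun hz => ⟨hz.1, hz.2, ht.1, ht.2.trans (by norm_num)⟩⟩
  have hX1 : ∀ x, ∀ t ∈ Icc (8 / 9 : ℝ) 1, (x, t) ∈ X ↔ x ∈ N₁.carrier := by
    intro x t ht
    have h1 : F (x, t) = f₁ x := hF1 x t (le_trans (by norm_num) ht.1)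
    have h2 : h (x, t) = tailL p (f₁ x) := by
      simp only [h, K]
      rw [hβ1 t ht.1, zero_smul, sub_zero, h1]
    have h3 : a (x, t) = (f₁ x : EuclideanSpace ℝ (Fin (p + 1))) 0 := by simp only [a, h1]
    rw [hf₁.mem_iff, eq_north_iff, ← h2, ← h3]
    exact ⟨fun hz => ⟨hz.1, hz.2.1⟩, fun hz => ⟨hz.1, hz.2, le_trans (by norm_num) ht.1, ht.2⟩⟩
  have hbd : ∀ z ∈ X, z.2 = 0 ∨ z.2 = 1 → IsBoundaryPt IR p X z := by
    rintro z hz (h0 | h1)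
    · exact isBoundaryPt_iff.2 ⟨_, _, _, hloc0 z hz h0⟩
    · exact isBoundaryPt_iff.2 ⟨_, _, _, hloc1 z hz h1⟩
  have hin : ∀ z ∈ X, ¬ (z.2 = 0 ∨ z.2 = 1) → IsInteriorPt IR p X z := by
    intro z hz hne
    push Not at hne
    exact isInteriorPt_iff.2 ⟨_, _, hloc z hz
      ⟨lt_of_le_of_ne hz.2.2.1 hne.1.symm, lt_of_le_of_ne hz.2.2.2 hne.2⟩⟩
  obtain ⟨u, hu, hue⟩ := (isSmoothMetric_prodMetric g).exists_isFraming hU (h := h) (X := X)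
    hh.contMDiffOn (fun z hz => hz.2.1) (fun z hz => hsurj z hz.1 hz.2.1) htan
    (EuclideanSpace.basisFun (Fin p) ℝ).toBasis
  have hun : ∀ z ∈ X, ∀ i v, diffl IR h z v = 0 → prodMetric g z v (u i z) = 0 := by
    intro z hz i v hv
    have h1 : u i z ∈ normalSpace (prodMetric g) X z := by
      rw [← hu.span_eq z hz]
      exact Submodule.subset_span ⟨i, rfl⟩
    exact h1 v ((htan z hz v).2 hv)
  have hue' : ∀ z ∈ X, ∀ i, diffl IR h z (u i z) = EuclideanSpace.single i 1 := fun z hz i =>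
    (hue z hz i).trans (by simp)
  refine ⟨X, u, 1 / 9, by norm_num, fun z hz => ⟨mem_univ _, hz.2.2⟩, ?_, fun z hz => ?_, ?_, ?_,
    ?_, hu, fun i x hx t ht => ?_, fun i x hx t ht => ?_⟩
  · -- on the zero set of `h` the function `a` has no zeros, so `0 < a` is a closed condition there
    have h1 : X = {z | h z = 0 ∧ 0 ≤ a z} ∩ univ ×ˢ Icc (0 : ℝ) 1 := by
      ext z
      refine ⟨fun hz => ⟨⟨hz.1, hz.2.1.le⟩, mem_univ _, hz.2.2⟩, fun hz =>
        ⟨hz.1.1, lt_of_le_of_ne hz.1.2 fun h0 => ?_, hz.2.2⟩⟩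
      have h2 := norm_sq_eq_head_tail (F z : EuclideanSpace ℝ (Fin (p + 1)))
      have h3 : (F z : EuclideanSpace ℝ (Fin (p + 1))) 0 = 0 := h0.symm
      have h4 : tailL p (F z) = β z.2 • c := hKn z hz.1.1
      rw [(F z).norm_eq, h3, h4] at h2
      have h5 := hβn z.2
      nlinarith [norm_nonneg (β z.2 • c), norm_nonneg c]
    rw [h1]
    refine (isCompact_univ.prod isCompact_Icc).inter_left ?_
    exact (isClosed_eq hh.continuous continuous_const).inter (isClosed_le continuous_const ha)
  · by_cases ht : z.2 = 0 ∨ z.2 = 1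
    · exact Or.inr (hbd z hz ht)
    · exact Or.inl (hin z hz ht)
  · ext ⟨x, t⟩
    constructor
    · intro hb
      have hz : (x, t) ∈ X := hb.1
      by_cases ht : t = 0 ∨ t = 1
      · rcases ht with rfl | rfl
        · exact Or.inl ⟨(hX0 x 0 ⟨le_rfl, by norm_num⟩).1 hz, rfl⟩
        · exact Or.inr ⟨(hX1 x 1 ⟨by norm_num, le_rfl⟩).1 hz, rfl⟩
      · exact absurd (hin _ hz ht) (IsBoundaryPt.not_isInteriorPt hb)
    · rintro (⟨hx, ht⟩ | ⟨hx, ht⟩)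
      · have ht' : t = 0 := ht
        subst ht'
        exact hbd _ ((hX0 x 0 ⟨le_rfl, by norm_num⟩).2 hx) (Or.inl rfl)
      · have ht' : t = 1 := ht
        subst ht'
        exact hbd _ ((hX1 x 1 ⟨by norm_num, le_rfl⟩).2 hx) (Or.inr rfl)
  · rintro z ⟨hz, -, ht⟩
    exact hbd z hz ht
  · rintro ⟨x, t⟩ (⟨hx, ht⟩ | ⟨hx, ht⟩)
    · exact (hX0 x t ⟨ht.1, ht.2.le⟩).2 hx
    · exact (hX1 x t ⟨by linarith [ht.1], ht.2⟩).2 hx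
  · have hz := (hX0 x t ⟨ht.1, ht.2.le⟩).2 hx
    refine hf₀.eq_horizontal hx ?_ (hun _ hz i) (hue' _ hz i)
    filter_upwards [continuous_snd.continuousAt.eventually_lt_const
      (show (x, t).2 < (1 / 9 : ℝ) from ht.2)] with z hz
    simp only [h, K]
    rw [hβ0 _ hz.le, zero_smul, sub_zero]
    exact congrArg (fun y : Sph p => tailL p (y : EuclideanSpace ℝ (Fin (p + 1))))
      (hF0 z.1 z.2 (hz.le.trans (by norm_num)))
  · have ht1 : 8 / 9 < t := by linarith [ht.1]
    have hz := (hX1 x t ⟨ht1.le, ht.2⟩).2 hx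
    refine hf₁.eq_horizontal hx ?_ (hun _ hz i) (hue' _ hz i)
    filter_upwards [continuous_snd.continuousAt.eventually_const_lt
      (show (8 / 9 : ℝ) < (x, t).2 from ht1)] with z hz
    simp only [h, K]
    rw [hβ1 _ hz.le, zero_smul, sub_zero]
    exact congrArg (fun y : Sph p => tailL p (y : EuclideanSpace ℝ (Fin (p + 1))))
      (hF1 z.1 z.2 (le_trans (by norm_num) hz.le))

end HomotopyToCobordism

/-! ### Maps with cobordant fibres are homotopic -/

section CobordismToHomotopy

theorem IsInteriorPt.congr_set {E : Type*} [NormedAddCommGroup E] [NormedSpace ℝ E]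
    {H : Type*} [TopologicalSpace H] {I : ModelWithCorners ℝ E H}
    {W : Type*} [TopologicalSpace W] [ChartedSpace H W] {p : ℕ} {X Y : Set W} {x : W}
    (hX : IsInteriorPt I p X x) (h : X =ᶠ[𝓝 x] Y) : IsInteriorPt I p Y x := by
  obtain ⟨U, k, hk⟩ := isInteriorPt_iff.1 hX
  obtain ⟨V, hV, hVo, hxV⟩ := eventually_nhds_iff.1 (eventuallyEq_set.1 h)
  refine isInteriorPt_iff.2 ⟨U ∩ V, k, (hV x hxV).1 hk.mem, hk.isOpen.inter hVo,
    ⟨hk.mem_open, hxV⟩, hk.contMDiffOn.mono inter_subset_left, hk.surjective, ?_⟩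
  ext z
  constructor
  · rintro ⟨hz, hzU, hzV⟩
    exact ⟨⟨hzU, hzV⟩, (hk.mem_iff hzU).1 ((hV z hzV).2 hz)⟩
  · rintro ⟨⟨hzU, hzV⟩, hz⟩
    exact ⟨(hV z hzV).1 ((hk.mem_iff hzU).2 hz), hzU, hzV⟩

theorem tangentSpaceOf_congr_set {E : Type*} [NormedAddCommGroup E] [NormedSpace ℝ E]
    {H : Type*} [TopologicalSpace H] {I : ModelWithCorners ℝ E H}
    {W : Type*} [TopologicalSpace W] [ChartedSpace H W] {X Y : Set W} {x : W}
    (h : X =ᶠ[𝓝 x] Y) : tangentSpaceOf I X x = tangentSpaceOf I Y x := by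
  ext v
  change (∀ φ : W → ℝ, _ → (∀ᶠ z in 𝓝[X] x, φ z = 0) → _) ↔
    ∀ φ : W → ℝ, _ → (∀ᶠ z in 𝓝[Y] x, φ z = 0) → _
  rw [nhdsWithin_eq_iff_eventuallyEq.2 h]

variable {n : ℕ} {M : Type*} [TopologicalSpace M] [ChartedSpace (EuclideanSpace ℝ (Fin n)) M]
  [IsManifold (𝓡 n) ∞ M] {p : ℕ} {g : ContMDiffRiemannianMetric (𝓡 n) ∞ (EuclideanSpace ℝ (Fin n))
      (fun x : M => TangentSpace (𝓡 n) x)}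

local notation "IR" => ModelWithCorners.prod (𝓡 n) 𝓘(ℝ, ℝ)

omit [IsManifold (𝓡 n) ∞ M] in
theorem sum_smul_horizontal {x : M} (c : Fin p → ℝ) (v : Fin p → TangentSpace (𝓡 n) x) (t : ℝ) :
    ∑ i, c i • horizontal (v i) t = horizontal (∑ i, c i • v i) t := by
  let L : EuclideanSpace ℝ (Fin n) →ₗ[ℝ] EuclideanSpace ℝ (Fin n) × ℝ := LinearMap.inl ℝ _ _
  let v' : Fin p → EuclideanSpace ℝ (Fin n) := v
  have h : ∑ i, c i • L (v' i) = L (∑ i, c i • v' i) := by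
    rw [map_sum]
    simp only [map_smul]
  exact h

/-- The cylinder `N × ℝ`, framed by the horizontal lift of the framing of `N`. -/
theorem FramedSubmanifold.isTransverseFraming_cylinder (N : FramedSubmanifold g p) :
    IsTransverseFraming (I := IR) (N.carrier ×ˢ (univ : Set ℝ))
      fun i z => horizontal (N.frame i z.1) z.2 := by
  constructor
  · intro i
    have h1 : ContMDiffOn IR (𝓡 n).tangent ∞
        (fun z : M × ℝ => (⟨z.1, N.frame i z.1⟩ : TangentBundle (𝓡 n) M))
        (N.carrier ×ˢ (univ : Set ℝ)) :=
      (N.isFraming.smooth i).comp contMDiffOn_fst fun z hz => hz.1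
    have h2 : ContMDiff IR (𝓘(ℝ, ℝ)).tangent ∞
        (fun z : M × ℝ => (⟨z.2, 0⟩ : TangentBundle 𝓘(ℝ, ℝ) ℝ)) :=
      (contMDiff_zeroSection ℝ (TangentSpace 𝓘(ℝ, ℝ) : ℝ → Type _)).comp contMDiff_snd
    exact (contMDiff_equivTangentBundleProd_symm (I := 𝓡 n) (M := M) (I' := 𝓘(ℝ, ℝ))
      (M' := ℝ)).comp_contMDiffOn (h1.prodMk h2.contMDiffOn)
  · rintro ⟨x, t⟩ ⟨hx, -⟩ c hc
    obtain ⟨U, h, hX⟩ := isInteriorPt_iff.1 (N.isSubmanifold x hx)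
    refine N.isFraming.sum_smul_eq_zero (isSmoothMetric_inner g) hx ?_
    rw [hX.mem_tangentSpaceOf_iff]
    have h1 := (hX.prod_line t).mem_tangentSpaceOf_iff (∑ i, c i • horizontal (N.frame i x) t)
    have h2 := h1.1 hc
    rw [diffl_comp_fst (z := (x, t)) hX.mdifferentiableAt, sum_smul_horizontal] at h2
    exact h2

theorem FramedSubmanifold.isSubmanifold_cylinder (N : FramedSubmanifold g p) :
    IsSubmanifold IR p (N.carrier ×ˢ (univ : Set ℝ)) := by
  rintro ⟨x, t⟩ ⟨hx, -⟩
  obtain ⟨U, h, hX⟩ := isInteriorPt_iff.1 (N.isSubmanifold x hx)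
  exact isInteriorPt_iff.2 ⟨_, _, hX.prod_line t⟩

/-- If a submanifold with equation `h` contains a half-open piece of the cylinder `N × ℝ` at
`(x, t₀)` and is transverse to the slice, it lies in the cylinder. To apply the two-sided
criterion for zero sets, the time on the half line is substituted by `σ s = t₀ ± s²`, with inverse
`τ`. -/
theorem FramedSubmanifold.eventually_mem_of_eq_zero (N : FramedSubmanifold g p) {x : M}
    (hx : x ∈ N.carrier) {t₀ : ℝ} {σ τ : ℝ → ℝ} (hσ : ContDiff ℝ ∞ σ) (hτ : Continuous τ)
    (hσ0 : σ 0 = t₀) (hτ0 : τ t₀ = 0) {h : M × ℝ → EuclideanSpace ℝ (Fin p)}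
    (hh : ContMDiffAt IR (𝓡 p) ∞ h (x, t₀))
    (h0 : ∀ᶠ z : M × ℝ in 𝓝 (x, 0), z.1 ∈ N.carrier → h (z.1, σ z.2) = 0)
    (hs : Function.Surjective fun v : TangentSpace (𝓡 n) x => diffl IR h (x, t₀) (horizontal v t₀)) :
    ∀ᶠ z : M × ℝ in 𝓝 (x, t₀), σ (τ z.2) = z.2 → h z = 0 → z.1 ∈ N.carrier := by
  obtain ⟨U, h', hX⟩ := isInteriorPt_iff.1 (N.isSubmanifold x hx)
  have hk : ContMDiffAt IR (𝓡 p) ∞ (fun z : M × ℝ => h (z.1, σ z.2)) (x, 0) := by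
    refine ContMDiffAt.comp (g := h) (x, (0 : ℝ)) ?_ (contMDiff_prod_reparam hσ).contMDiffAt
    simpa [hσ0] using hh
  have h1 := (hX.prod_line 0).eventually_mem_of_eq_zero hk (h0.mono fun z hz hzN => hz hzN.1) (by
    intro b
    obtain ⟨v, hv⟩ := hs b
    refine ⟨horizontal v 0, ?_⟩
    rw [diffl_horizontal (hk.mdifferentiableAt (by simp))]
    have h2 := diffl_horizontal (hh.mdifferentiableAt (by simp)) v
    simp only [hσ0]
    exact h2.symm.trans hv)
  have hc : Tendsto (fun z : M × ℝ => (z.1, τ z.2)) (𝓝 (x, t₀)) (𝓝 (x, 0)) := by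
    have h2 : Continuous fun z : M × ℝ => (z.1, τ z.2) :=
      continuous_fst.prodMk (hτ.comp continuous_snd)
    have h3 := h2.tendsto (x, t₀)
    simpa [hτ0] using h3
  filter_upwards [hc.eventually h1] with z hz hzσ hz0
  refine (hz ?_).1
  simpa [hzσ] using hz0

/-- The framed cylinder and a framed submanifold with boundary that agree on one side of a slice fit
together smoothly at their common boundary. -/
theorem FramedSubmanifold.eventually_mem_cylinder (N : FramedSubmanifold g p) {X : Set (M × ℝ)}
    {u : Fin p → ∀ z : M × ℝ, TangentSpace IR z} (hu : IsFraming (prodMetric g) X u) {x : M}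
    (hx : x ∈ N.carrier) {t₀ : ℝ} {σ τ : ℝ → ℝ} (hσ : ContDiff ℝ ∞ σ) (hτ : Continuous τ)
    (hσ0 : σ 0 = t₀) (hτ0 : τ t₀ = 0) (hb : IsBoundaryPt IR p X (x, t₀))
    (hcol : ∀ᶠ s in 𝓝 (0 : ℝ), ∀ y ∈ N.carrier, (y, σ s) ∈ X)
    (hux : ∀ i, u i (x, t₀) = horizontal (N.frame i x) t₀)
    (hστ : ∀ z ∈ X, σ (τ z.2) = z.2) :
    ∀ᶠ z in 𝓝 (x, t₀), z ∈ X → z.1 ∈ N.carrier := by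
  obtain ⟨U, h, ρ, hX⟩ := isBoundaryPt_iff.1 hb
  have hU : U ∈ 𝓝 (x, t₀) := hX.isOpen.mem_nhds hX.mem_open
  have h1 := N.eventually_mem_of_eq_zero hx hσ hτ hσ0 hτ0 (hX.contMDiffOn.contMDiffAt hU) ?_ ?_
  · filter_upwards [h1, hU] with z hz hzU hzX
    exact hz (hστ z hzX) ((hX.mem_iff hzU).1 hzX).1
  · have hc : Tendsto (fun z : M × ℝ => (z.1, σ z.2)) (𝓝 (x, 0)) (𝓝 (x, t₀)) := by
      have h2 := (contMDiff_prod_reparam (n := n) (M := M) hσ).continuous.tendsto (x, 0)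
      simpa [hσ0] using h2
    filter_upwards [hc.eventually hU, continuous_snd.continuousAt.eventually
      (show ∀ᶠ s in 𝓝 ((x, (0 : ℝ)) : M × ℝ).2, _ from hcol)] with z hzU hz hzN
    exact ((hX.mem_iff hzU).1 (hz z.1 hzN)).1
  · -- the differential of `h` is injective on the span of the framing, which is horizontal
    let D : (Fin p → ℝ) →ₗ[ℝ] EuclideanSpace ℝ (Fin p) :=
      { toFun := fun c => diffl IR h (x, t₀) (∑ i, c i • u i (x, t₀))
        map_add' := fun c d => by
          simp only [Pi.add_apply, add_smul, Finset.sum_add_distrib, map_add]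
        map_smul' := fun r c => by
          simp only [Pi.smul_apply, smul_eq_mul, mul_smul, ← Finset.smul_sum, map_smul,
            RingHom.id_apply] }
    have hD : Function.Injective D := by
      rw [injective_iff_map_eq_zero]
      intro c hc
      exact hu.sum_smul_eq_zero (isSmoothMetric_prodMetric g) hX.mem
        ((hX.mem_tangentSpaceOf_iff _).2 hc)
    have hD' : Function.Surjective D :=
      (LinearMap.injective_iff_surjective_of_finrank_eq_finrank (by simp)).1 hD
    intro b
    obtain ⟨c, hc⟩ := hD' b
    refine ⟨∑ i, c i • N.frame i x, ?_⟩
    refine Eq.trans ?_ hc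
    change diffl IR h (x, t₀) (horizontal (∑ i, c i • N.frame i x) t₀) =
      diffl IR h (x, t₀) (∑ i, c i • u i (x, t₀))
    simp only [hux]
    rw [sum_smul_horizontal]

/-- A cobordism, extended by the cylinders over its ends, is a closed framed submanifold of
`M × ℝ`. -/
theorem FramedCobordant.exists_extension [T2Space M] {N₀ N₁ : FramedSubmanifold g p}
    (h : FramedCobordant N₀ N₁) :
    ∃ (Y : Set (M × ℝ)) (ν : Fin p → ∀ z : M × ℝ, TangentSpace IR z), IsClosed Y ∧
      IsSubmanifold IR p Y ∧ IsTransverseFraming Y ν ∧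
      (∀ x, (x, (0 : ℝ)) ∈ Y ↔ x ∈ N₀.carrier) ∧ (∀ x, (x, (1 : ℝ)) ∈ Y ↔ x ∈ N₁.carrier) ∧
      (∀ i x, ν i (x, 0) = horizontal (N₀.frame i x) 0) ∧
      ∀ i x, ν i (x, 1) = horizontal (N₁.frame i x) 1 := by
  obtain ⟨X, u, ε, hε, hXI, hXc, hX, hXb, hXe, hXcol, hu, hu0, hu1⟩ := h
  have hb0 : ∀ x, (x, (0 : ℝ)) ∈ X → x ∈ N₀.carrier := by
    intro x hx
    have h1 : (x, (0 : ℝ)) ∈ submanifoldBoundary IR p X := hXe ⟨hx, mem_univ _, Or.inl rfl⟩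
    rw [hXb] at h1
    rcases h1 with h1 | h1
    · exact h1.1
    · exact absurd (show (0 : ℝ) = 1 from h1.2) zero_ne_one
  have hb1 : ∀ x, (x, (1 : ℝ)) ∈ X → x ∈ N₁.carrier := by
    intro x hx
    have h1 : (x, (1 : ℝ)) ∈ submanifoldBoundary IR p X := hXe ⟨hx, mem_univ _, Or.inr rfl⟩
    rw [hXb] at h1
    rcases h1 with h1 | h1
    · exact absurd (show (1 : ℝ) = 0 from h1.2) one_ne_zero
    · exact h1.1
  have hbd0 : ∀ x ∈ N₀.carrier, IsBoundaryPt IR p X (x, 0) := fun x hx => by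
    have h1 : (x, (0 : ℝ)) ∈ submanifoldBoundary IR p X := by
      rw [hXb]
      exact Or.inl ⟨hx, rfl⟩
    exact h1
  have hbd1 : ∀ x ∈ N₁.carrier, IsBoundaryPt IR p X (x, 1) := fun x hx => by
    have h1 : (x, (1 : ℝ)) ∈ submanifoldBoundary IR p X := by
      rw [hXb]
      exact Or.inr ⟨hx, rfl⟩
    exact h1
  have hIcc : ∀ z ∈ X, 0 ≤ z.2 ∧ z.2 ≤ 1 := fun z hz => (hXI hz).2
  have hcyl0 : ∀ x ∈ N₀.carrier, ∀ᶠ z in 𝓝 (x, (0 : ℝ)), z ∈ X → z.1 ∈ N₀.carrier := by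
    intro x hx
    refine N₀.eventually_mem_cylinder hu hx (σ := fun s => s ^ 2) (τ := Real.sqrt) (by fun_prop)
      Real.continuous_sqrt (by simp) (by simp) (hbd0 x hx) ?_ (fun i => hu0 i x hx 0 ⟨le_rfl, hε⟩)
      fun z hz => Real.sq_sqrt (hIcc z hz).1
    have h1 : Tendsto (fun s : ℝ => s ^ 2) (𝓝 0) (𝓝 0) := by
      have h2 : Continuous fun s : ℝ => s ^ 2 := by fun_prop
      simpa using h2.tendsto 0
    filter_upwards [h1.eventually_lt_const hε] with s hs y hy
    exact hXcol (Or.inl ⟨hy, sq_nonneg s, hs⟩)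
  have hcyl1 : ∀ x ∈ N₁.carrier, ∀ᶠ z in 𝓝 (x, (1 : ℝ)), z ∈ X → z.1 ∈ N₁.carrier := by
    intro x hx
    refine N₁.eventually_mem_cylinder hu hx (σ := fun s => 1 - s ^ 2) (τ := fun t => √(1 - t))
      (by fun_prop) (by fun_prop) (by simp) (by simp) (hbd1 x hx) ?_
      (fun i => hu1 i x hx 1 ⟨by linarith, le_rfl⟩) fun z hz => ?_
    · have h1 : Tendsto (fun s : ℝ => s ^ 2) (𝓝 0) (𝓝 0) := by
        have h2 : Continuous fun s : ℝ => s ^ 2 := by fun_prop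
        simpa using h2.tendsto 0
      filter_upwards [h1.eventually_lt_const hε] with s hs y hy
      exact hXcol (Or.inr ⟨hy, by linarith, by linarith [sq_nonneg s]⟩)
    · rw [Real.sq_sqrt (sub_nonneg.2 (hIcc z hz).2)]
      ring
  let Y : Set (M × ℝ) := X ∪ (N₀.carrier ×ˢ Iic (0 : ℝ) ∪ N₁.carrier ×ˢ Ici (1 : ℝ))
  let ν : Fin p → ∀ z : M × ℝ, TangentSpace IR z := fun i z =>
    if z.2 ≤ 0 then horizontal (N₀.frame i z.1) z.2
    else if 1 ≤ z.2 then horizontal (N₁.frame i z.1) z.2 else u i z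
  have hY0 : ∀ x, ∀ t ≤ 0, (x, t) ∈ Y → x ∈ N₀.carrier := by
    rintro x t ht (h | h | h)
    · have : t = 0 := le_antisymm ht (hIcc _ h).1
      subst this
      exact hb0 x h
    · exact h.1
    · exact absurd (show (1 : ℝ) ≤ t from h.2) (by linarith)
  have hY1 : ∀ x, ∀ t ≥ 1, (x, t) ∈ Y → x ∈ N₁.carrier := by
    rintro x t ht (h | h | h)
    · have : t = 1 := le_antisymm (hIcc _ h).2 ht
      subst this
      exact hb1 x h
    · exact absurd (show t ≤ (0 : ℝ) from h.2) (by linarith)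
    · exact h.1
  have hYm : ∀ z : M × ℝ, 0 < z.2 → z.2 < 1 → (z ∈ Y ↔ z ∈ X) := by
    intro z h0 h1
    refine ⟨?_, Or.inl⟩
    rintro (h | h | h)
    · exact h
    · exact absurd (show z.2 ≤ (0 : ℝ) from h.2) (by linarith)
    · exact absurd (show (1 : ℝ) ≤ z.2 from h.2) (by linarith)
  -- near each of its points, `Y` is a framed cylinder or coincides with `X`
  have hloc : ∀ z ∈ Y, (∃ (Z : Set (M × ℝ)) (ν' : Fin p → ∀ z : M × ℝ, TangentSpace IR z),
      IsInteriorPt IR p Z z ∧ IsTransverseFraming Z ν' ∧ Z =ᶠ[𝓝 z] Y ∧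
      ∀ᶠ y in 𝓝 z, y ∈ Z → ∀ i, ν i y = ν' i y) := by
    rintro ⟨x, t⟩ hz
    rcases le_or_gt t 0 with ht | ht
    · have hx := hY0 x t ht hz
      have hlt : ∀ᶠ y in 𝓝 ((x, t) : M × ℝ), y.2 < min ε 1 :=
        continuous_snd.continuousAt.eventually_lt_const
          (show ((x, t) : M × ℝ).2 < min ε 1 from ht.trans_lt (lt_min hε one_pos))
      have hcyl : ∀ᶠ y in 𝓝 ((x, t) : M × ℝ), y ∈ X → y.1 ∈ N₀.carrier := by
        rcases ht.eq_or_lt with rfl | ht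
        · exact hcyl0 x hx
        · filter_upwards [continuous_snd.continuousAt.eventually_lt_const
            (show ((x, t) : M × ℝ).2 < 0 from ht)] with y hy hyX
          exact absurd (hIcc y hyX).1 (by linarith)
      refine ⟨_, _, N₀.isSubmanifold_cylinder _ ⟨hx, mem_univ _⟩,
        N₀.isTransverseFraming_cylinder, eventuallyEq_set.2 ?_, ?_⟩
      · filter_upwards [hlt, hcyl] with y hy hyX
        constructor
        · intro h
          rcases le_or_gt y.2 0 with hy0 | hy0
          · exact Or.inr (Or.inl ⟨h.1, hy0⟩)
          · exact Or.inl (hXcol (Or.inl ⟨h.1, hy0.le, hy.trans_le (min_le_left _ _)⟩))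
        · rintro (h | h | h)
          · exact ⟨hyX h, mem_univ _⟩
          · exact ⟨h.1, mem_univ _⟩
          · exact absurd (show (1 : ℝ) ≤ y.2 from h.2) (hy.trans_le (min_le_right _ _)).not_ge
      · filter_upwards [hlt] with y hy hyN i
        by_cases hy0 : y.2 ≤ 0
        · exact if_pos hy0
        · refine (if_neg hy0).trans ((if_neg (hy.trans_le (min_le_right _ _)).not_ge).trans ?_)
          exact hu0 i y.1 hyN.1 y.2 ⟨(not_le.1 hy0).le, hy.trans_le (min_le_left _ _)⟩
    rcases le_or_gt 1 t with ht1 | ht1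
    · have hx := hY1 x t ht1 hz
      have hlt : ∀ᶠ y in 𝓝 ((x, t) : M × ℝ), max (1 - ε) 0 < y.2 :=
        continuous_snd.continuousAt.eventually_const_lt
          (show max (1 - ε) 0 < ((x, t) : M × ℝ).2 from
            lt_of_lt_of_le (max_lt (by linarith) one_pos) ht1)
      have hcyl : ∀ᶠ y in 𝓝 ((x, t) : M × ℝ), y ∈ X → y.1 ∈ N₁.carrier := by
        rcases ht1.eq_or_lt with rfl | ht1
        · exact hcyl1 x hx
        · filter_upwards [continuous_snd.continuousAt.eventually_const_lt
            (show 1 < ((x, t) : M × ℝ).2 from ht1)] with y hy hyX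
          exact absurd (hIcc y hyX).2 (by linarith)
      refine ⟨_, _, N₁.isSubmanifold_cylinder _ ⟨hx, mem_univ _⟩,
        N₁.isTransverseFraming_cylinder, eventuallyEq_set.2 ?_, ?_⟩
      · filter_upwards [hlt, hcyl] with y hy hyX
        constructor
        · intro h
          rcases le_or_gt 1 y.2 with hy1 | hy1
          · exact Or.inr (Or.inr ⟨h.1, hy1⟩)
          · exact Or.inl (hXcol (Or.inr ⟨h.1, (le_max_left _ _).trans_lt hy, hy1.le⟩))
        · rintro (h | h | h)
          · exact ⟨hyX h, mem_univ _⟩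
          · exact absurd (show y.2 ≤ (0 : ℝ) from h.2) ((le_max_right _ _).trans_lt hy).not_ge
          · exact ⟨h.1, mem_univ _⟩
      · filter_upwards [hlt] with y hy hyN i
        refine (if_neg ((le_max_right _ _).trans_lt hy).not_ge).trans ?_
        by_cases hy1 : 1 ≤ y.2
        · exact if_pos hy1
        · refine (if_neg hy1).trans ?_
          exact hu1 i y.1 hyN.1 y.2 ⟨(le_max_left _ _).trans_lt hy, (not_le.1 hy1).le⟩
    · have hzX : (x, t) ∈ X := (hYm (x, t) ht ht1).1 hz
      have hev : ∀ᶠ y in 𝓝 ((x, t) : M × ℝ), 0 < y.2 ∧ y.2 < 1 :=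
        (continuous_snd.continuousAt.eventually_const_lt
          (show 0 < ((x, t) : M × ℝ).2 from ht)).and
        (continuous_snd.continuousAt.eventually_lt_const (show ((x, t) : M × ℝ).2 < 1 from ht1))
      refine ⟨X, u, ?_, hu.isTransverseFraming (isSmoothMetric_prodMetric g),
        eventuallyEq_set.2 (hev.mono fun y hy => (hYm y hy.1 hy.2).symm),
        hev.mono fun y hy _ i => (if_neg (not_le.2 hy.1)).trans (if_neg (not_le.2 hy.2))⟩
      refine (hX _ hzX).resolve_right fun hb => ?_
      have h1 : (x, t) ∈ submanifoldBoundary IR p X := hb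
      rw [hXb] at h1
      rcases h1 with h1 | h1
      · exact ht.ne' h1.2
      · exact ht1.ne h1.2
  refine ⟨Y, ν, ?_, fun z hz => ?_, ⟨fun i z hz => ?_, fun z hz c hc => ?_⟩, fun x => ⟨hY0 x 0 le_rfl,
    fun hx => Or.inr (Or.inl ⟨hx, self_mem_Iic⟩)⟩, fun x => ⟨hY1 x 1 le_rfl,
    fun hx => Or.inr (Or.inr ⟨hx, self_mem_Ici⟩)⟩, fun i x => if_pos le_rfl,
    fun i x => (if_neg (not_le.2 one_pos)).trans (if_pos le_rfl)⟩
  · exact hXc.isClosed.union ((N₀.isCompact.isClosed.prod isClosed_Iic).union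
      (N₁.isCompact.isClosed.prod isClosed_Ici))
  · obtain ⟨Z, ν', hZ, -, hZY, -⟩ := hloc z hz
    exact hZ.congr_set hZY
  · obtain ⟨Z, ν', hZ, hν', hZY, hνν'⟩ := hloc z hz
    have h1 := (hν'.smooth i) z hZ.1
    have h2 : 𝓝[Z] z = 𝓝[Y] z := nhdsWithin_eq_iff_eventuallyEq.2 hZY
    have h3 : (fun y : M × ℝ => (⟨y, ν i y⟩ : TangentBundle IR (M × ℝ))) =ᶠ[𝓝[Z] z]
        fun y => ⟨y, ν' i y⟩ := by
      filter_upwards [mem_nhdsWithin_of_mem_nhds hνν', self_mem_nhdsWithin] with y hy hyZ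
      rw [hy hyZ i]
    exact (h1.congr_of_eventuallyEq h3 (h3.self_of_nhdsWithin hZ.1)).congr_set hZY
  · obtain ⟨Z, ν', hZ, hν', hZY, hνν'⟩ := hloc z hz
    refine hν'.transverse z hZ.1 c ?_
    rw [tangentSpaceOf_congr_set hZY]
    simpa only [hνν'.self_of_nhds hZ.1] using hc

/-- Maps with cobordant fibres are homotopic: the collapse map of the extended cobordism is a
homotopy between maps with the given fibres. -/
theorem FramedCobordant.smoothHomotopic [T2Space M] [SigmaCompactSpace M]
    {N₀ N₁ : FramedSubmanifold g p} (h : FramedCobordant N₀ N₁) {f₀ f₁ : C^∞⟮𝓡 n, M; 𝓡 p, Sph p⟯}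
    (hf₀ : IsStandardFibre f₀ N₀) (hf₁ : IsStandardFibre f₁ N₁) : SmoothHomotopic f₀ f₁ := by
  obtain ⟨Y, ν, hYc, hY, hν, hY0, hY1, hν0, hν1⟩ := h.exists_extension
  obtain ⟨G, hG, hGY, hGν⟩ := exists_collapse hYc hY hν
  have hd : ∀ z, MDifferentiableAt IR (𝓡 p) (fun z => tailL p (G z)) z := fun z =>
    ((tailL p).contDiff.contMDiff.comp (contMDiff_coe_comp hG) z).mdifferentiableAt (by simp)
  let G₀ : C^∞⟮𝓡 n, M; 𝓡 p, Sph p⟯ := ⟨fun x => G (x, 0), hG.comp (contMDiff_slice 0)⟩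
  let G₁ : C^∞⟮𝓡 n, M; 𝓡 p, Sph p⟯ := ⟨fun x => G (x, 1), hG.comp (contMDiff_slice 1)⟩
  have h0 : IsStandardFibre G₀ N₀ := by
    refine ⟨fun x => (hY0 x).symm.trans (hGY (x, 0)).symm, fun x hx i => ?_⟩
    rw [← hGν (x, 0) ((hY0 x).2 hx) i, hν0, diffl_horizontal (hd _)]
    rfl
  have h1 : IsStandardFibre G₁ N₁ := by
    refine ⟨fun x => (hY1 x).symm.trans (hGY (x, 1)).symm, fun x hx i => ?_⟩
    rw [← hGν (x, 1) ((hY1 x).2 hx) i, hν1, diffl_horizontal (hd _)]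
    rfl
  exact (hf₀.smoothHomotopic h0).trans
    (SmoothHomotopic.trans ⟨G, hG.contMDiffOn, fun _ => rfl, fun _ => rfl⟩ (h1.smoothHomotopic hf₁))

end CobordismToHomotopy

/-! ### The correspondence between cobordism classes and homotopy classes -/

section Correspondence

variable {n : ℕ} {M : Type*} [TopologicalSpace M] [T2Space M] [CompactSpace M]
  [ChartedSpace (EuclideanSpace ℝ (Fin n)) M] [IsManifold (𝓡 n) ∞ M] {p : ℕ}
  {g : ContMDiffRiemannianMetric (𝓡 n) ∞ (EuclideanSpace ℝ (Fin n))
    (fun x : M => TangentSpace (𝓡 n) x)}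

theorem IsStandardFibre.smoothHomotopic_iff {f₀ f₁ : C^∞⟮𝓡 n, M; 𝓡 p, Sph p⟯}
    {N₀ N₁ : FramedSubmanifold g p} (h₀ : IsStandardFibre f₀ N₀) (h₁ : IsStandardFibre f₁ N₁) :
    SmoothHomotopic f₀ f₁ ↔ FramedCobordant N₀ N₁ :=
  ⟨fun h => h.framedCobordant h₀ h₁, fun h => h.smoothHomotopic h₀ h₁⟩

theorem IsPontryaginManifold.smoothHomotopic_iff {f₀ f₁ : C^∞⟮𝓡 n, M; 𝓡 p, Sph p⟯}
    {y₀ y₁ : Sph p} {w₀ : Fin p → TangentSpace (𝓡 p) y₀} {w₁ : Fin p → TangentSpace (𝓡 p) y₁}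
    {N₀ N₁ : FramedSubmanifold g p} (h₀ : IsPontryaginManifold f₀ y₀ w₀ N₀)
    (h₁ : IsPontryaginManifold f₁ y₁ w₁ N₁) :
    SmoothHomotopic f₀ f₁ ↔ FramedCobordant N₀ N₁ := by
  obtain ⟨f₀', hf₀, hN₀⟩ := h₀.exists_isStandardFibre
  obtain ⟨f₁', hf₁, hN₁⟩ := h₁.exists_isStandardFibre
  rw [← hN₀.smoothHomotopic_iff hN₁]
  exact ⟨fun h => hf₀.symm.trans (h.trans hf₁), fun h => hf₀.trans (h.trans hf₁.symm)⟩

/-- Framed cobordism is an equivalence relation because it corresponds to homotopy of the collapse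
maps; no gluing of cobordisms is needed. -/
theorem equivalence_framedCobordant : Equivalence (FramedCobordant (g := g) (p := p)) := by
  choose f hf using fun N : FramedSubmanifold g p => N.exists_isStandardFibre
  have h : ∀ N N', FramedCobordant N N' ↔ SmoothHomotopic (f N) (f N') := fun N N' =>
    ((hf N).smoothHomotopic_iff (hf N')).symm
  exact ⟨fun N => (h N N).2 (.refl _), fun h' => (h _ _).2 ((h _ _).1 h').symm,
    fun h' h'' => (h _ _).2 (((h _ _).1 h').trans ((h _ _).1 h''))⟩

end Correspondence

end Pontryagin

theorem mainTheorem5 (n p : ℕ) (hp : 1 ≤ p)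
    {M : Type*} [TopologicalSpace M] [T2Space M] [CompactSpace M]
    [ChartedSpace (EuclideanSpace ℝ (Fin n)) M] [IsManifold (𝓡 n) ∞ M]
    (g : ContMDiffRiemannianMetric (𝓡 n) ∞ (EuclideanSpace ℝ (Fin n))
      (fun x : M => TangentSpace (𝓡 n) x)) :
    -- smooth homotopy and framed cobordism are equivalence relations
    Equivalence (Pontryagin.SmoothHomotopic (n := n) (M := M) (p := p)) ∧
    Equivalence (Pontryagin.FramedCobordant (g := g) (p := p)) ∧
    -- every smooth map has a regular value, and the Pontryagin manifold exists and is unique for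
    -- every regular value and every positively oriented basis
    (∀ f : C^∞⟮𝓡 n, M; 𝓡 p, Pontryagin.Sph p⟯,
      (∃ y, Pontryagin.IsRegularValue f y) ∧
      ∀ (y : Pontryagin.Sph p) (w : Fin p → TangentSpace (𝓡 p) y),
        Pontryagin.IsRegularValue f y → Pontryagin.IsPositiveBasis y w →
        ∃ N : Pontryagin.FramedSubmanifold g p, Pontryagin.IsPontryaginManifold f y w N ∧
          ∀ N' : Pontryagin.FramedSubmanifold g p, Pontryagin.IsPontryaginManifold f y w N' →
            N'.carrier = N.carrier ∧ ∀ x ∈ N.carrier, ∀ i, N'.frame i x = N.frame i x) ∧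
    -- its framed cobordism class depends neither on the regular value nor on the basis
    (∀ (f : C^∞⟮𝓡 n, M; 𝓡 p, Pontryagin.Sph p⟯) (y y' : Pontryagin.Sph p)
      (w : Fin p → TangentSpace (𝓡 p) y) (w' : Fin p → TangentSpace (𝓡 p) y')
      (N N' : Pontryagin.FramedSubmanifold g p),
      Pontryagin.IsPontryaginManifold f y w N → Pontryagin.IsPontryaginManifold f y' w' N' →
      Pontryagin.FramedCobordant N N') ∧
    -- every compact framed submanifold is a Pontryagin manifold
    (∀ N : Pontryagin.FramedSubmanifold g p,
      ∃ (f : C^∞⟮𝓡 n, M; 𝓡 p, Pontryagin.Sph p⟯) (y : Pontryagin.Sph p)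
        (w : Fin p → TangentSpace (𝓡 p) y), Pontryagin.IsPontryaginManifold f y w N) ∧
    -- two maps are smoothly homotopic iff their Pontryagin manifolds are framed cobordant
    (∀ (f₀ f₁ : C^∞⟮𝓡 n, M; 𝓡 p, Pontryagin.Sph p⟯) (y₀ y₁ : Pontryagin.Sph p)
      (w₀ : Fin p → TangentSpace (𝓡 p) y₀) (w₁ : Fin p → TangentSpace (𝓡 p) y₁)
      (N₀ N₁ : Pontryagin.FramedSubmanifold g p),
      Pontryagin.IsPontryaginManifold f₀ y₀ w₀ N₀ → Pontryagin.IsPontryaginManifold f₁ y₁ w₁ N₁ →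
      (Pontryagin.SmoothHomotopic f₀ f₁ ↔ Pontryagin.FramedCobordant N₀ N₁)) ∧
    -- the resulting bijection between `Π^p_fr(M)` and `[M, S^p]`
    (∃! Φ : Pontryagin.FramedCobordismClasses g p ≃ Pontryagin.HomotopyClasses n M p,
      ∀ (f : C^∞⟮𝓡 n, M; 𝓡 p, Pontryagin.Sph p⟯) (y : Pontryagin.Sph p)
        (w : Fin p → TangentSpace (𝓡 p) y) (N : Pontryagin.FramedSubmanifold g p),
        Pontryagin.IsPontryaginManifold f y w N →
        Φ (Quot.mk Pontryagin.FramedCobordant N) = Quot.mk Pontryagin.SmoothHomotopic f) := by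
  have hC : ∀ (f₀ f₁ : C^∞⟮𝓡 n, M; 𝓡 p, Pontryagin.Sph p⟯) (y₀ y₁ : Pontryagin.Sph p)
      (w₀ : Fin p → TangentSpace (𝓡 p) y₀) (w₁ : Fin p → TangentSpace (𝓡 p) y₁)
      (N₀ N₁ : Pontryagin.FramedSubmanifold g p),
      Pontryagin.IsPontryaginManifold f₀ y₀ w₀ N₀ → Pontryagin.IsPontryaginManifold f₁ y₁ w₁ N₁ →
      (Pontryagin.SmoothHomotopic f₀ f₁ ↔ Pontryagin.FramedCobordant N₀ N₁) :=
    fun _ _ _ _ _ _ _ _ h₀ h₁ => h₀.smoothHomotopic_iff h₁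
  have hreg := Pontryagin.exists_isRegularValue (n := n) (M := M) (p := p)
  have hexists : ∀ (f : C^∞⟮𝓡 n, M; 𝓡 p, Pontryagin.Sph p⟯) (y : Pontryagin.Sph p)
      (w : Fin p → TangentSpace (𝓡 p) y),
      Pontryagin.IsRegularValue f y → Pontryagin.IsPositiveBasis y w →
      ∃ N : Pontryagin.FramedSubmanifold g p, Pontryagin.IsPontryaginManifold f y w N ∧
        ∀ N' : Pontryagin.FramedSubmanifold g p, Pontryagin.IsPontryaginManifold f y w N' →
          N'.carrier = N.carrier ∧ ∀ x ∈ N.carrier, ∀ i, N'.frame i x = N.frame i x := by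
    intro f y w hf hw
    obtain ⟨A, -, hA⟩ := hw.exists_isAdapted
    obtain ⟨N, hN⟩ := hA.exists_isPontryaginManifold (g := g) hw hf
    exact ⟨N, hN, fun N' hN' => hA.frame_eq hw hN hN'⟩
  have hB : ∀ N : Pontryagin.FramedSubmanifold g p,
      ∃ (f : C^∞⟮𝓡 n, M; 𝓡 p, Pontryagin.Sph p⟯) (y : Pontryagin.Sph p)
        (w : Fin p → TangentSpace (𝓡 p) y), Pontryagin.IsPontryaginManifold f y w N := by
    intro N
    obtain ⟨f, hf⟩ := N.exists_isStandardFibre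
    exact ⟨f, hf.exists_isPontryaginManifold⟩
  have hfib : ∀ f : C^∞⟮𝓡 n, M; 𝓡 p, Pontryagin.Sph p⟯,
      ∃ (N : Pontryagin.FramedSubmanifold g p) (y : Pontryagin.Sph p)
        (w : Fin p → TangentSpace (𝓡 p) y), Pontryagin.IsPontryaginManifold f y w N := by
    intro f
    obtain ⟨y, hy⟩ := hreg f
    obtain ⟨w, hw⟩ := Pontryagin.exists_isPositiveBasis hp y
    obtain ⟨N, hN, -⟩ := hexists f y w hy hw
    exact ⟨N, y, w, hN⟩
  refine ⟨Pontryagin.equivalence_smoothHomotopic, Pontryagin.equivalence_framedCobordant,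
    fun f => ⟨hreg f, hexists f⟩,
    fun f y y' w w' N N' h h' => (hC f f y y' w w' N N' h h').1 (.refl f), hB, hC, ?_⟩
  choose fN yN wN hfN using hB
  choose Nf yf wf hNf using hfib
  let Φ : Pontryagin.FramedCobordismClasses g p ≃ Pontryagin.HomotopyClasses n M p :=
    { toFun := Quot.lift (fun N => Quot.mk _ (fN N)) fun N N' h =>
        Quot.sound ((hC _ _ _ _ _ _ _ _ (hfN N) (hfN N')).2 h)
      invFun := Quot.lift (fun f => Quot.mk _ (Nf f)) fun f f' h =>
        Quot.sound ((hC _ _ _ _ _ _ _ _ (hNf f) (hNf f')).1 h)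
      left_inv := by
        rintro ⟨N⟩
        exact Quot.sound ((hC _ _ _ _ _ _ _ _ (hNf (fN N)) (hfN N)).1 (.refl _))
      right_inv := by
        rintro ⟨f⟩
        exact Quot.sound ((hC _ _ _ _ _ _ _ _ (hfN (Nf f)) (hNf f)).2
          (Pontryagin.equivalence_framedCobordant.refl _)) }
  refine ⟨Φ, fun f y w N h => Quot.sound ((hC _ _ _ _ _ _ _ _ (hfN N) h).2
    (Pontryagin.equivalence_framedCobordant.refl _)), fun Φ' h' => ?_⟩
  ext ⟨N⟩
  exact h' _ _ _ _ (hfN N)
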